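/- Let $N=\{1,\dots,n\}$, $n\ge 1$, be a set of agents and $D$ a finite set of alternatives. Each agent $a$ casts a ballot $B_a=B_a(0)\succ\dots\succ B_a(k_a-1)\succ B_a(k_a)$, where $B_a(0),\dots,B_a(k_a-1)$ are pairwise distinct elements of $N\setminus\{a\}$ and $B_a(k_a)\in D$; put $m=n+\sum_{a\in N}k_a$. The delegation graph has vertex set $N\cup D\cup\{r\}$, an edge $a\to B_a(i)$ for all $a\in N$ and $0\le i\le k_a$, and an edge $d\to r$ for every $d\in D$. A certificate is a family $c=(c_a)_{a\in N}$ of positions $0\le c_a\le k_a$; it is consistent if the edges $a\to B_a(c_a)$ ($a\in N$) together with the edges $d\to r$ ($d\in D$) form a spanning tree of the delegation graph directed towards $r$. A MinSum (respectively MinMax) certificate is a consistent certificate that minimises $\sum_{a\in N}c_a$ (respectively $\max_{a\in N}c_a$) among all consistent certificates. Then, on a word RAM with words of $O(\log(n+|D|))$ bits that is given the ballots as arrays, a MinSum certificate can be computed in time $O(n\log n+m)$, and a MinMax certificate can be computed in time $O(n+m)$. -/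

import Mathlib

namespace LiquidDemocracy

/-- A profile of ordered ballots of the agents `Fin n` over the alternatives `Fin d`:
agent `a` ranks the `size a` agents `deleg a 0, deleg a 1, …` and then, as the last option, the
direct vote `direct a`. -/
structure Profile (n d : ℕ) where
  size : Fin n → ℕ
  deleg : (a : Fin n) → Fin (size a) → Fin n
  deleg_ne_self : ∀ a i, deleg a i ≠ a
  deleg_injective : ∀ a, Function.Injective (deleg a)
  direct : Fin n → Fin d

/-- The vertices of the delegation graph. -/
inductive Vertex (n d : ℕ) where
  | agent (a : Fin n)
  | alt (x : Fin d)
  | root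

/-- `T` is an `r`-arborescence of the directed graph with edge set `E`: a spanning tree whose
edges are directed towards the sink `r`. -/
def IsArborescence {V : Type*} (E : Set (V × V)) (r : V) (T : Set (V × V)) : Prop :=
  T ⊆ E ∧
  (∀ v, (r, v) ∉ T) ∧
  (∀ u, u ≠ r → ∃! v, (u, v) ∈ T) ∧
  (∀ u, Relation.ReflTransGen (fun x y => (x, y) ∈ T) u r)

namespace Profile

variable {n d : ℕ} (B : Profile n d)

/-- The number `m` of edges of the delegation graph in which all alternatives are identified
with the root. -/
def numEdges : ℕ := n + ∑ a, B.size a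

/-- The entry of the ballot of `a` at position `i`, where `0 ≤ i ≤ size a`. -/
def entry (a : Fin n) (i : Fin (B.size a + 1)) : Vertex n d :=
  if h : (i : ℕ) < B.size a then .agent (B.deleg a ⟨i, h⟩) else .alt (B.direct a)

/-- The edge set of the delegation graph. -/
def edges : Set (Vertex n d × Vertex n d) :=
  {e | (∃ a i, e = (.agent a, B.entry a i)) ∨ ∃ x, e = (.alt x, .root)}

/-- A certificate selects one position in each ballot. -/
abbrev Certificate : Type := (a : Fin n) → Fin (B.size a + 1)

/-- The edges selected by a certificate. -/
def certEdges (c : B.Certificate) : Set (Vertex n d × Vertex n d) :=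
  {e | (∃ a, e = (.agent a, B.entry a (c a))) ∨ ∃ x, e = (.alt x, .root)}

def IsConsistent (c : B.Certificate) : Prop :=
  IsArborescence B.edges .root (B.certEdges c)

def IsMinSum (c : B.Certificate) : Prop :=
  B.IsConsistent c ∧
    ∀ c' : B.Certificate, B.IsConsistent c' → ∑ a, (c a : ℕ) ≤ ∑ a, (c' a : ℕ)

def IsMinMax (c : B.Certificate) : Prop :=
  B.IsConsistent c ∧
    ∀ c' : B.Certificate, B.IsConsistent c' →
      Finset.univ.sup (fun a => (c a : ℕ)) ≤ Finset.univ.sup (fun a => (c' a : ℕ))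

end Profile

end LiquidDemocracy

/-! A word RAM, programmed in structured form. A program mentions finitely many registers and
finitely many random-access arrays of words; each arithmetic operation, comparison, register or
memory access and each branching costs one time unit. -/

namespace WordRAM

/-- The memory: registers and arrays, named by natural numbers. -/
structure State where
  reg : ℕ → ℕ
  arr : ℕ → ℕ → ℕ

namespace State

def setReg (s : State) (x v : ℕ) : State :=
  { s with reg := Function.update s.reg x v }

def setArr (s : State) (A i v : ℕ) : State :=
  { s with arr := Function.update s.arr A (Function.update (s.arr A) i v) }

end State

inductive Op where
  | add | sub | mul | div | lt | eq

/-- Truncated subtraction, division rounded down (with value `0` for divisor `0`), and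
comparisons with values `1` (true) and `0` (false). -/
def Op.eval : Op → ℕ → ℕ → ℕ
  | .add, x, y => x + y
  | .sub, x, y => x - y
  | .mul, x, y => x * y
  | .div, x, y => x / y
  | .lt, x, y => if x < y then 1 else 0
  | .eq, x, y => if x = y then 1 else 0

inductive Expr where
  | const (k : ℕ)
  | reg (x : ℕ)
  | read (A : ℕ) (i : Expr)
  | op (o : Op) (e₁ e₂ : Expr)

namespace Expr

def eval (s : State) : Expr → ℕ
  | const k => k
  | reg x => s.reg x
  | read A i => s.arr A (i.eval s)
  | op o e₁ e₂ => o.eval (e₁.eval s) (e₂.eval s)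

/-- The number of elementary operations in the evaluation of an expression. -/
def cost : Expr → ℕ
  | const _ => 1
  | reg _ => 1
  | read _ i => i.cost + 1
  | op _ e₁ e₂ => e₁.cost + e₂.cost + 1

/-- Every value (in particular every address) that occurs in the evaluation is a word, that is,
smaller than `W`. -/
def Fits (W : ℕ) (s : State) : Expr → Prop
  | const k => k < W
  | reg x => s.reg x < W
  | read A i => i.Fits W s ∧ s.arr A (i.eval s) < W
  | op o e₁ e₂ => e₁.Fits W s ∧ e₂.Fits W s ∧ o.eval (e₁.eval s) (e₂.eval s) < W

end Expr

inductive Prog where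
  | skip
  | assign (x : ℕ) (e : Expr)
  | store (A : ℕ) (i e : Expr)
  | seq (p q : Prog)
  | ite (b : Expr) (p q : Prog)
  | loop (b : Expr) (p : Prog)

/-- `Run W p s t s'`: on the machine whose words are the numbers smaller than `W`, the program `p`
started in the state `s` halts after exactly `t` steps in the state `s'`, without any overflow.
A condition is true iff its value is not `0`; `loop b p` repeats `p` while `b` is true. -/
inductive Run (W : ℕ) : Prog → State → ℕ → State → Prop where
  | skip (s : State) : Run W .skip s 1 s
  | assign (s : State) (x : ℕ) (e : Expr) (he : e.Fits W s) :
      Run W (.assign x e) s (e.cost + 1) (s.setReg x (e.eval s))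
  | store (s : State) (A : ℕ) (i e : Expr) (hi : i.Fits W s) (he : e.Fits W s) :
      Run W (.store A i e) s (i.cost + e.cost + 1) (s.setArr A (i.eval s) (e.eval s))
  | seq (s s' s'' : State) (p q : Prog) (t t' : ℕ)
      (hp : Run W p s t s') (hq : Run W q s' t' s'') : Run W (.seq p q) s (t + t') s''
  | ite_true (s s' : State) (b : Expr) (p q : Prog) (t : ℕ) (hb : b.Fits W s)
      (h : b.eval s ≠ 0) (hp : Run W p s t s') : Run W (.ite b p q) s (b.cost + 1 + t) s'
  | ite_false (s s' : State) (b : Expr) (p q : Prog) (t : ℕ) (hb : b.Fits W s)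
      (h : b.eval s = 0) (hq : Run W q s t s') : Run W (.ite b p q) s (b.cost + 1 + t) s'
  | loop_true (s s' s'' : State) (b : Expr) (p : Prog) (t t' : ℕ) (hb : b.Fits W s)
      (h : b.eval s ≠ 0) (hp : Run W p s t s') (hl : Run W (.loop b p) s' t' s'') :
      Run W (.loop b p) s (b.cost + 1 + t + t') s''
  | loop_false (s : State) (b : Expr) (p : Prog) (hb : b.Fits W s) (h : b.eval s = 0) :
      Run W (.loop b p) s (b.cost + 1) s

end WordRAM

namespace LiquidDemocracy

open WordRAM

/-- The input of the machine: registers `0` and `1` hold the numbers of agents and of alternatives,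
array `0` the ballot sizes, array `1` the concatenation of the delegation lists of the agents
`0, 1, …, n - 1`, and array `2` the direct votes. Everything else is `0`. -/
def Profile.input {n d : ℕ} (B : Profile n d) : State where
  reg x := [n, d].getD x 0
  arr A i :=
    match A with
    | 0 => (List.ofFn B.size).getD i 0
    | 1 => ((List.finRange n).flatMap
        fun a => List.ofFn fun j => (B.deleg a j : ℕ)).getD i 0
    | 2 => (List.ofFn fun a => (B.direct a : ℕ)).getD i 0
    | _ => 0

/-- Array `3` holds the certificate `c`. -/
def Profile.IsOutput {n d : ℕ} (B : Profile n d) (s : State) (c : B.Certificate) : Prop :=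
  ∀ a : Fin n, s.arr 3 a = (c a : ℕ)

/-- One program, running on words of `O(log (n + d))` bits, computes for every profile with at
least one agent a certificate that satisfies `Spec`, in `O(T n m)` steps. -/
def ComputableInTime (Spec : ∀ {n d : ℕ} (B : Profile n d), B.Certificate → Prop)
    (T : ℕ → ℕ → ℝ) : Prop :=
  ∃ (p : Prog) (k : ℕ) (C : ℝ), ∀ (n d : ℕ) (B : Profile n d), 0 < n →
    ∃ (t : ℕ) (s : State) (c : B.Certificate),
      Run ((n + d + 2) ^ k) p B.input t s ∧ (t : ℝ) ≤ C * T n B.numEdges ∧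
        B.IsOutput s c ∧ Spec B c

end LiquidDemocracy

/-! MinSum asks for a minimum-cost spanning arborescence, and the proof rests on linear-programming
duality. Take a list of nonempty sets of agents ("cuts", repetitions allowed) such that the option
at position `p` of any ballot leaves at most `p` of the cuts. A consistent certificate leaves every
cut at least once, so it costs at least the number of cuts. Equality holds if each chosen option at
position `c a` leaves `c a` cuts and no cut is left twice (`Profile.isMinSum_certOf`).

Both solutions are built by growing a path with contractions. Visited agents are numbered 1, 2, … in
the order of their visits, and the root has number 0. The visited agents that are not yet connected
to the root form a path of contracted sets, each an interval of numbers and each with a selected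
edge into the next one. The agents of the last set explore their current options. An option that
stays in the set is dropped. One that leaves it is selected: an unvisited head is appended to the
path, a head on the path merges all sets from there on, and any other head finishes the whole path.
When nothing is left to explore, the last set becomes one more cut and each of its agents advances
by one position. Ranks are consecutive integers, so unit dual steps suffice. No priority queue is
needed, and every advance is charged to one ballot position. The position of an agent always equals
the number of cuts that contain it, which keeps the packing feasible (`GrowthInv.grow`) and the
selected edges tight (`GrowthInv.select`).

There is one selected edge per contracted set, hence too many. Going through the sets from the last
to the first, a set inherits the exit of its parent if that exit lies in it; only otherwise is its
own edge kept (`ExitInv`). Then each agent keeps exactly one edge, only the exit of a set leaves it,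
and all agents lead to the root. The whole computation is linear in `m`; the term `n log n` is not
needed.

For MinMax, options are examined by increasing rank from a queue. An agent is settled once an
examined option of it is a direct vote or leads to a settled agent. When all settlements have been
propagated, every option of an unsettled agent below the current rank leads to an unsettled agent.
So some agent must use at least this rank (`SearchInv.raise`), while all votes settled so far stay
within it.

On the machine, the programs only increment, subtract and compare, so contents exceed the input by
at most the running time and words of logarithmic length suffice (`Exec.run`). Running times are
proved with credits (`Halts`), the loop invariants containing a potential. -/

namespace WordRAM

/-! ### Executions without overflow checks, and why tame programs do not overflow -/

/-- Execution on a machine with unbounded words. -/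
inductive Exec : Prog → State → ℕ → State → Prop where
  | skip (s : State) : Exec .skip s 1 s
  | assign (s : State) (x : ℕ) (e : Expr) :
      Exec (.assign x e) s (e.cost + 1) (s.setReg x (e.eval s))
  | store (s : State) (A : ℕ) (i e : Expr) :
      Exec (.store A i e) s (i.cost + e.cost + 1) (s.setArr A (i.eval s) (e.eval s))
  | seq (s s' s'' : State) (p q : Prog) (t t' : ℕ)
      (hp : Exec p s t s') (hq : Exec q s' t' s'') : Exec (.seq p q) s (t + t') s''
  | ite_true (s s' : State) (b : Expr) (p q : Prog) (t : ℕ)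
      (h : b.eval s ≠ 0) (hp : Exec p s t s') : Exec (.ite b p q) s (b.cost + 1 + t) s'
  | ite_false (s s' : State) (b : Expr) (p q : Prog) (t : ℕ)
      (h : b.eval s = 0) (hq : Exec q s t s') : Exec (.ite b p q) s (b.cost + 1 + t) s'
  | loop_true (s s' s'' : State) (b : Expr) (p : Prog) (t t' : ℕ)
      (h : b.eval s ≠ 0) (hp : Exec p s t s') (hl : Exec (.loop b p) s' t' s'') :
      Exec (.loop b p) s (b.cost + 1 + t + t') s''
  | loop_false (s : State) (b : Expr) (p : Prog) (h : b.eval s = 0) :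
      Exec (.loop b p) s (b.cost + 1) s

/-- Expressions whose values exceed the contents of the memory by at most their cost. -/
def Expr.tame : Expr → Bool
  | const k => decide (k ≤ 1)
  | reg _ => true
  | read _ i => i.tame
  | op .add e (const k) => e.tame && decide (k ≤ 1)
  | op .sub e₁ e₂ => e₁.tame && e₂.tame
  | op .lt e₁ e₂ => e₁.tame && e₂.tame
  | op .eq e₁ e₂ => e₁.tame && e₂.tame
  | _ => false

def Prog.tame : Prog → Bool
  | .skip => true
  | .assign _ e => e.tame
  | .store _ i e => i.tame && e.tame
  | .seq p q => p.tame && q.tame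
  | .ite b p q => b.tame && p.tame && q.tame
  | .loop b p => b.tame && p.tame

/-- All contents of the memory are at most `V`. -/
structure State.Bounded (V : ℕ) (s : State) : Prop where
  reg : ∀ x, s.reg x ≤ V
  arr : ∀ A i, s.arr A i ≤ V

lemma State.Bounded.mono {V V' : ℕ} {s : State} (h : s.Bounded V) (hV : V ≤ V') : s.Bounded V' :=
  ⟨fun x => (h.reg x).trans hV, fun A i => (h.arr A i).trans hV⟩

lemma State.Bounded.setReg {V : ℕ} {s : State} (h : s.Bounded V) {x v : ℕ} (hv : v ≤ V) :
    (s.setReg x v).Bounded V := by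
  refine ⟨fun y => ?_, h.arr⟩
  by_cases hy : y = x
  · subst hy; simpa [State.setReg] using hv
  · simpa [State.setReg, Function.update_of_ne hy] using h.reg y

lemma State.Bounded.setArr {V : ℕ} {s : State} (h : s.Bounded V) {A i v : ℕ} (hv : v ≤ V) :
    (s.setArr A i v).Bounded V := by
  refine ⟨h.reg, fun A' i' => ?_⟩
  by_cases hA : A' = A
  · subst hA
    by_cases hi : i' = i
    · subst hi; simpa [State.setArr] using hv
    · simpa [State.setArr, Function.update_of_ne hi] using h.arr A' i'
  · simpa [State.setArr, Function.update_of_ne hA] using h.arr A' i'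

/-- The only operation that can enlarge a value adds a constant at most `1`, and it costs at least
one step; subtraction is truncated and comparisons yield at most `1`. -/
lemma Expr.tame_eval_fits {V W : ℕ} {s : State} (hs : s.Bounded V) :
    ∀ e : Expr, e.tame = true → V + e.cost < W → e.eval s ≤ V + e.cost ∧ e.Fits W s := by
  intro e
  induction e with
  | const k => intro h hW; simp [tame] at h; simp [eval, cost, Fits] at *; omega
  | reg x => intro h hW; have := hs.reg x; simp [eval, cost, Fits] at *; omega
  | read A i ih =>
    intro h hW
    simp only [tame] at h
    simp only [cost] at hW
    have h1 := ih h (by omega)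
    have h2 := hs.arr A (i.eval s)
    refine ⟨by simp only [eval, cost]; omega, h1.2, by omega⟩
  | op o e₁ e₂ ih₁ ih₂ =>
    intro h hW
    simp only [cost] at hW
    cases o with
    | add =>
      cases e₂ with
      | const k =>
        simp [tame] at h
        have h1 := ih₁ h.1 (by omega)
        simp only [cost] at hW
        refine ⟨by simp only [eval, cost, Op.eval]; omega, h1.2, ?_, ?_⟩
        · simp only [Fits]; omega
        · simp only [eval, Op.eval]; omega
      | _ => simp [tame] at h
    | mul => simp [tame] at h
    | div => simp [tame] at h
    | sub =>
      simp [tame] at h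
      have h1 := ih₁ h.1 (by omega)
      have h2 := ih₂ h.2 (by omega)
      exact ⟨by simp only [eval, cost, Op.eval]; omega, h1.2, h2.2, by
        simp only [Op.eval]; omega⟩
    | lt =>
      simp [tame] at h
      have h1 := ih₁ h.1 (by omega)
      have h2 := ih₂ h.2 (by omega)
      exact ⟨by simp only [eval, cost, Op.eval]; split_ifs <;> omega, h1.2, h2.2, by
        simp only [Op.eval]; split_ifs <;> omega⟩
    | eq =>
      simp [tame] at h
      have h1 := ih₁ h.1 (by omega)
      have h2 := ih₂ h.2 (by omega)
      exact ⟨by simp only [eval, cost, Op.eval]; split_ifs <;> omega, h1.2, h2.2, by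
        simp only [Op.eval]; split_ifs <;> omega⟩

/-- A tame program that is started in a bounded state and halts soon does not overflow. -/
theorem Exec.run {W : ℕ} {p : Prog} {s s' : State} {t : ℕ} (h : Exec p s t s') :
    ∀ {V : ℕ}, p.tame = true → s.Bounded V → V + t < W →
      Run W p s t s' ∧ s'.Bounded (V + t) := by
  induction h with
  | skip s => intro V _ hs _; exact ⟨.skip s, hs.mono (by omega)⟩
  | assign s x e =>
    intro V hp hs hW
    have h1 := Expr.tame_eval_fits (W := W) hs e hp (by omega)
    exact ⟨.assign s x e h1.2, (hs.mono (by omega)).setReg (by omega)⟩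
  | store s A i e =>
    intro V hp hs hW
    simp [Prog.tame] at hp
    have h1 := Expr.tame_eval_fits (W := W) hs i hp.1 (by omega)
    have h2 := Expr.tame_eval_fits (W := W) hs e hp.2 (by omega)
    exact ⟨.store s A i e h1.2 h2.2, (hs.mono (by omega)).setArr (by omega)⟩
  | seq s s' s'' p q t t' _ _ ih₁ ih₂ =>
    intro V hp hs hW
    simp [Prog.tame] at hp
    have h1 := ih₁ hp.1 hs (by omega)
    have h2 := ih₂ hp.2 h1.2 (by omega)
    exact ⟨.seq _ _ _ _ _ _ _ h1.1 h2.1, h2.2.mono (by omega)⟩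
  | ite_true s s' b p q t hb _ ih =>
    intro V hp hs hW
    simp [Prog.tame] at hp
    have h1 := ih hp.1.2 hs (by omega)
    have h2 := Expr.tame_eval_fits (W := W) hs b hp.1.1 (by omega)
    exact ⟨.ite_true _ _ _ _ _ _ h2.2 hb h1.1, h1.2.mono (by omega)⟩
  | ite_false s s' b p q t hb _ ih =>
    intro V hp hs hW
    simp [Prog.tame] at hp
    have h1 := ih hp.2 hs (by omega)
    have h2 := Expr.tame_eval_fits (W := W) hs b hp.1.1 (by omega)
    exact ⟨.ite_false _ _ _ _ _ _ h2.2 hb h1.1, h1.2.mono (by omega)⟩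
  | loop_true s s' s'' b p t t' hb _ _ ih₁ ih₂ =>
    intro V hp hs hW
    have hp' := hp
    simp [Prog.tame] at hp
    have h0 := Expr.tame_eval_fits (W := W) hs b hp.1 (by omega)
    have h1 := ih₁ hp.2 hs (by omega)
    have h2 := ih₂ hp' h1.2 (by omega)
    exact ⟨.loop_true _ _ _ _ _ _ _ h0.2 hb h1.1 h2.1, h2.2.mono (by omega)⟩
  | loop_false s b p hb =>
    intro V hp hs hW
    simp [Prog.tame] at hp
    have h0 := Expr.tame_eval_fits (W := W) hs b hp.1 (by omega)
    exact ⟨.loop_false _ _ _ h0.2 hb, hs.mono (by omega)⟩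

/-! ### Running times by credits -/

/-- Started in `s` with `c` credits, `p` halts; each step consumes a credit, and the final state
and the remaining credits satisfy `Q`. -/
def Halts (p : Prog) (s : State) (c : ℕ) (Q : State → ℕ → Prop) : Prop :=
  ∃ t s', Exec p s t s' ∧ t ≤ c ∧ Q s' (c - t)

namespace Halts

variable {p q : Prog} {s : State} {c : ℕ} {b : Expr} {Q Q' : State → ℕ → Prop}

lemma mono (h : Halts p s c Q) (hQ : ∀ s' c', Q s' c' → Q' s' c') : Halts p s c Q' := by
  obtain ⟨t, s', h1, h2, h3⟩ := h
  exact ⟨t, s', h1, h2, hQ _ _ h3⟩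

lemma skip (hc : 1 ≤ c) (h : Q s (c - 1)) : Halts .skip s c Q := ⟨1, s, .skip s, hc, h⟩

lemma assign {x : ℕ} {e : Expr} (hc : e.cost + 1 ≤ c)
    (h : Q (s.setReg x (e.eval s)) (c - (e.cost + 1))) : Halts (.assign x e) s c Q :=
  ⟨_, _, .assign s x e, hc, h⟩

lemma seq (h : Halts p s c fun s' c' => Halts q s' c' Q) : Halts (.seq p q) s c Q := by
  obtain ⟨t, s', h1, h2, t', s'', h3, h4, h5⟩ := h
  exact ⟨_, _, .seq _ _ _ _ _ _ _ h1 h3, by omega, by rwa [← Nat.sub_sub]⟩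

lemma ite (hc : b.cost + 1 ≤ c) (h₁ : b.eval s ≠ 0 → Halts p s (c - (b.cost + 1)) Q)
    (h₂ : b.eval s = 0 → Halts q s (c - (b.cost + 1)) Q) : Halts (.ite b p q) s c Q := by
  by_cases hb : b.eval s = 0
  · obtain ⟨t, s', h3, h4, h5⟩ := h₂ hb
    exact ⟨_, _, .ite_false _ _ _ _ _ _ hb h3, by omega, by rwa [← Nat.sub_sub]⟩
  · obtain ⟨t, s', h3, h4, h5⟩ := h₁ hb
    exact ⟨_, _, .ite_true _ _ _ _ _ _ hb h3, by omega, by rwa [← Nat.sub_sub]⟩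

/-- The credits bound the number of iterations. -/
lemma loop (I : State → ℕ → Prop)
    (h : ∀ s c, I s c → b.cost + 1 ≤ c ∧
      (b.eval s ≠ 0 → Halts p s (c - (b.cost + 1)) I) ∧
      (b.eval s = 0 → Q s (c - (b.cost + 1))))
    (hI : I s c) : Halts (.loop b p) s c Q := by
  -- Every test of the condition consumes a credit, so the credits serve as termination measure.
  induction c using Nat.strong_induction_on generalizing s with
  | _ c ih =>
    obtain ⟨h1, h2, h3⟩ := h s c hI
    by_cases hb : b.eval s = 0
    · exact ⟨_, _, .loop_false _ _ _ hb, h1, h3 hb⟩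
    · obtain ⟨t, s', h4, h5, h6⟩ := h2 hb
      obtain ⟨t', s'', h7, h8, h9⟩ := ih _ (by omega) h6
      refine ⟨_, _, .loop_true _ _ _ _ _ _ _ hb h4 h7, by omega, ?_⟩
      rwa [← Nat.sub_sub, ← Nat.sub_sub]

end Halts

/-- Programs without branching. -/
def Prog.straight : Prog → Bool
  | .skip => true
  | .assign _ _ => true
  | .store _ _ _ => true
  | .seq p q => p.straight && q.straight
  | _ => false

/-- The running time of a program without branching. -/
def Prog.ticks : Prog → ℕ
  | .assign _ e => e.cost + 1
  | .store _ i e => i.cost + e.cost + 1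
  | .seq p q => p.ticks + q.ticks
  | _ => 1

/-- The result of a program without branching. -/
def Prog.result : Prog → State → State
  | .assign x e, s => s.setReg x (e.eval s)
  | .store A i e, s => s.setArr A (i.eval s) (e.eval s)
  | .seq p q, s => q.result (p.result s)
  | _, s => s

lemma Exec.straight : ∀ (p : Prog) (s : State), p.straight = true →
    Exec p s p.ticks (p.result s)
  | .skip, s, _ => .skip s
  | .assign x e, s, _ => .assign s x e
  | .store A i e, s, _ => .store s A i e
  | .seq p q, s, h => by
    simp [Prog.straight] at h
    exact .seq _ _ _ _ _ _ _ (straight p s h.1) (straight q _ h.2)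
  | .ite _ _ _, _, h => by simp [Prog.straight] at h
  | .loop _ _, _, h => by simp [Prog.straight] at h

/-- Time and result of branch-free code are computed by evaluation, so that its effect on the
abstract data can mostly be checked by `rfl` and its cost by `omega`. -/
lemma Halts.straight {p : Prog} {s : State} {c : ℕ} {Q : State → ℕ → Prop}
    (hp : p.straight = true) (hc : p.ticks ≤ c) (h : Q (p.result s) (c - p.ticks)) :
    Halts p s c Q :=
  ⟨_, _, .straight p s hp, hc, h⟩

end WordRAM

/-! ### Ballots as arrays, and consistency of certificates -/

namespace LiquidDemocracy

/-- Ballots stored as arrays: the delegations of agent `a` are the entries `del e` with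
`off a ≤ e < off (a + 1)`, and the position `off (a + 1)` stands for the direct vote of `a`. -/
structure Ballots where
  n : ℕ
  off : ℕ → ℕ
  del : ℕ → ℕ
  off_zero : off 0 = 0
  off_le : ∀ a, off a ≤ off (a + 1)
  del_lt : ∀ e, e < off n → del e < n

namespace Ballots

variable (g : Ballots)

lemma off_mono : Monotone g.off := monotone_nat_of_le_succ g.off_le

def size (a : ℕ) : ℕ := g.off (a + 1) - g.off a

lemma off_add_size (a : ℕ) : g.off a + g.size a = g.off (a + 1) := by
  have := g.off_le a
  unfold size; omega

/-- Following the positions `c` from agent `a` leads to a direct vote. -/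
inductive Reaches (c : ℕ → ℕ) : ℕ → Prop where
  | direct (a : ℕ) (h : c a = g.size a) : Reaches c a
  | deleg (a : ℕ) (h : c a < g.size a) (hr : Reaches c (g.del (g.off a + c a))) : Reaches c a

/-- The option at position `p` in the ballot of `a` leads out of the set `X` of agents. -/
def Crosses (X : ℕ → Prop) (a p : ℕ) : Prop :=
  X a ∧ ¬ (p < g.size a ∧ X (g.del (g.off a + p)))

end Ballots

/-- Locates the ballot of one agent in the concatenation stored in array `1`. -/
lemma getElem?_flatMap_add {α β : Type*} (f : α → List β) :
    ∀ (l : List α) (i j : ℕ) (x : α), l[i]? = some x → j < (f x).length →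
      (l.flatMap f)[((l.take i).map fun y => (f y).length).sum + j]? = (f x)[j]?
  | [], i, j, x, h, _ => by simp at h
  | y :: l, 0, j, x, h, hj => by
    simp at h; subst h
    simp [List.getElem?_append_left hj]
  | y :: l, i + 1, j, x, h, hj => by
    simp at h
    have := getElem?_flatMap_add f l i j x h hj
    simp only [List.flatMap_cons, List.take_succ_cons, List.map_cons, List.sum_cons]
    rw [List.getElem?_append_right (by omega)]
    rw [← this]; congr 1; omega

lemma sum_range_getD (l : List ℕ) : ∀ a, ∑ i ∈ Finset.range a, l.getD i 0 = (l.take a).sum := by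
  intro a
  induction a with
  | zero => simp
  | succ a ih =>
    rw [Finset.sum_range_succ, ih, List.take_add_one, List.sum_append]
    cases h : l[a]? <;> simp [h]

namespace Profile

variable {n d : ℕ} (B : Profile n d)

lemma size_lt (a : Fin n) : B.size a < n := by
  have h : Fintype.card (Fin (B.size a)) ≤ (Finset.univ.erase a).card := by
    rw [← Finset.card_univ, ← Finset.card_image_of_injective _ (B.deleg_injective a)]
    refine Finset.card_le_card fun x hx => ?_
    simp only [Finset.mem_image, Finset.mem_univ, true_and] at hx
    obtain ⟨i, rfl⟩ := hx
    simpa using B.deleg_ne_self a i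
  rw [Finset.card_erase_of_mem (Finset.mem_univ a)] at h
  simp at h
  have := a.pos
  omega

lemma input_size (a : Fin n) : B.input.arr 0 a = B.size a := by
  simp [input]

/-- The input array is `0` beyond the agents, so the offsets are defined and monotone on all natural
numbers. -/
def offset (a : ℕ) : ℕ := ∑ i ∈ Finset.range a, B.input.arr 0 i

lemma offset_n : B.offset n = ∑ a, B.size a := by
  rw [offset, Finset.sum_range]
  exact Finset.sum_congr rfl fun a _ => B.input_size a

lemma offset_succ (a : Fin n) : B.offset (a + 1) = B.offset a + B.size a := by
  rw [offset, Finset.sum_range_succ, ← offset, input_size]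

lemma offset_eq (a : ℕ) :
    B.offset a = (((List.finRange n).take a).map B.size).sum := by
  have : ∀ i, B.input.arr 0 i = (List.ofFn B.size).getD i 0 := fun i => rfl
  simp only [offset, this]
  rw [sum_range_getD, List.map_take, List.ofFn_eq_map]

lemma input_deleg (a : Fin n) (j : Fin (B.size a)) :
    B.input.arr 1 (B.offset a + j) = B.deleg a j := by
  have := getElem?_flatMap_add (fun a => List.ofFn fun j => (B.deleg a j : ℕ))
    (List.finRange n) a j a (by simp) (by simp)
  simp only [List.length_ofFn] at this
  rw [← offset_eq] at this
  change List.getD _ _ _ = _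
  rw [List.getD_eq_getElem?_getD, this]
  simp

lemma exists_of_lt_offset {e : ℕ} (he : e < B.offset n) :
    ∃ (a : Fin n) (j : Fin (B.size a)), e = B.offset a + j := by
  have key : ∀ b, b ≤ n → e < B.offset b →
      ∃ (a : Fin n) (j : Fin (B.size a)), e = B.offset a + j := by
    intro b
    induction b with
    | zero => intro _ h; simp [offset] at h
    | succ b ih =>
      intro hb h
      by_cases h' : e < B.offset b
      · exact ih (by omega) h'
      · have h2 := B.offset_succ ⟨b, hb⟩
        simp only at h2
        exact ⟨⟨b, hb⟩, ⟨e - B.offset b, by omega⟩, by simp only; omega⟩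
  exact key n le_rfl he

def ballots : Ballots where
  n := n
  off := B.offset
  del := B.input.arr 1
  off_zero := by simp [offset]
  off_le a := by rw [offset, offset, Finset.sum_range_succ]; omega
  del_lt e he := by
    obtain ⟨a, j, rfl⟩ := B.exists_of_lt_offset he
    rw [input_deleg]
    exact Fin.is_lt _

lemma ballots_size (a : Fin n) : B.ballots.size a = B.size a := by
  change B.offset (a + 1) - B.offset a = _
  rw [offset_succ]; omega

def certOf (c : ℕ → ℕ) : B.Certificate := fun a => ⟨min (c a) (B.size a), by omega⟩

lemma certOf_val {c : ℕ → ℕ} {a : Fin n} (h : c a ≤ B.ballots.size a) :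
    (B.certOf c a : ℕ) = c a := by
  rw [ballots_size] at h
  simpa [certOf] using h

/-- A certificate selects one edge at every vertex other than the root and none at the root; only
reachability of the root can fail, and only for agents. -/
lemma isConsistent_of_forall {c : B.Certificate}
    (h : ∀ a, Relation.ReflTransGen (fun x y => (x, y) ∈ B.certEdges c) (.agent a) .root) :
    B.IsConsistent c := by
  refine ⟨?_, ?_, ?_, ?_⟩
  · rintro e (⟨a, rfl⟩ | ⟨x, rfl⟩)
    · exact Or.inl ⟨a, _, rfl⟩
    · exact Or.inr ⟨x, rfl⟩
  · rintro v (⟨a, h⟩ | ⟨x, h⟩) <;> simp at h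
  · rintro (a | x | _) hu
    · refine ⟨B.entry a (c a), Or.inl ⟨a, rfl⟩, ?_⟩
      rintro y (⟨a', h⟩ | ⟨x, h⟩)
      · simp only [Prod.mk.injEq, Vertex.agent.injEq] at h
        obtain ⟨rfl, rfl⟩ := h
        rfl
      · simp at h
    · refine ⟨.root, Or.inr ⟨x, rfl⟩, ?_⟩
      rintro y (⟨a', h⟩ | ⟨x, h⟩) <;> simp at h
      exact h.2
    · exact absurd rfl hu
  · rintro (a | x | _)
    · exact h a
    · exact .single (Or.inr ⟨x, rfl⟩)
    · exact .refl

lemma isConsistent_certOf {c : ℕ → ℕ}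
    (h : ∀ a < n, B.ballots.Reaches c a) : B.IsConsistent (B.certOf c) := by
  refine B.isConsistent_of_forall fun a => ?_
  have key : ∀ x, B.ballots.Reaches c x → ∀ a : Fin n, (a : ℕ) = x →
      Relation.ReflTransGen (fun x y => (x, y) ∈ B.certEdges (B.certOf c)) (.agent a) .root := by
    intro x hx
    induction hx with
    | direct x hx =>
      rintro a rfl
      refine .head (b := .alt (B.direct a)) (Or.inl ⟨a, ?_⟩) (.single (Or.inr ⟨_, rfl⟩))
      have := B.certOf_val hx.le
      rw [hx, ballots_size] at this
      simp [entry, this]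
    | deleg x hx _ ih =>
      rintro a rfl
      have h1 := B.certOf_val hx.le
      rw [ballots_size] at hx
      have h2 := B.input_deleg a ⟨c a, hx⟩
      refine .head (b := .agent (B.deleg a ⟨c a, hx⟩)) (Or.inl ⟨a, ?_⟩) (ih _ h2.symm)
      simp [entry, h1, hx]
  exact key a (h a a.is_lt) a rfl

/-- A consistent certificate leads out of every nonempty set of agents. -/
lemma IsConsistent.exists_crosses {c : B.Certificate} (hc : B.IsConsistent c) {X : ℕ → Prop}
    (hX : ∃ a < n, X a) : ∃ a : Fin n, B.ballots.Crosses X a (c a) := by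
  by_contra! hcon
  obtain ⟨a, ha, haX⟩ := hX
  have key : ∀ v, Relation.ReflTransGen (fun x y => (x, y) ∈ B.certEdges c) (.agent ⟨a, ha⟩) v →
      ∃ b : Fin n, v = .agent b ∧ X b := by
    intro v hv
    induction hv with
    | refl => exact ⟨_, rfl, haX⟩
    | tail _ h ih =>
      obtain ⟨b, rfl, hb⟩ := ih
      obtain ⟨h4, h5⟩ := not_not.1 fun hn => hcon b ⟨hb, hn⟩
      rw [ballots_size] at h4
      rcases h with ⟨b', h⟩ | ⟨x, h⟩
      · simp only [Prod.mk.injEq, Vertex.agent.injEq] at h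
        obtain ⟨rfl, rfl⟩ := h
        refine ⟨B.deleg b ⟨c b, h4⟩, by simp [entry, h4], ?_⟩
        rw [← input_deleg]; exact h5
      · simp at h
  obtain ⟨b, hb, _⟩ := key _ (hc.2.2.2 _)
  simp at hb

end Profile

/-! ### Weak duality for sums and for maxima -/

open Classical in
-- Double counting of pairs (cut, agent leaving it), for the lower bound on the cost of an arbitrary
-- certificate.
lemma length_le_sum_countP {ι : Type*} (n : ℕ) (P : ι → ℕ → Prop) :
    ∀ l : List ι, (∀ S ∈ l, ∃ a < n, P S a) →
      l.length ≤ ∑ a ∈ Finset.range n, l.countP fun S => decide (P S a)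
  | [], _ => by simp
  | S :: l, h => by
    have ih := length_le_sum_countP n P l fun T hT => h T (List.mem_cons_of_mem _ hT)
    obtain ⟨a, ha, haS⟩ := h S List.mem_cons_self
    simp only [List.countP_cons, Finset.sum_add_distrib, List.length_cons]
    have : 1 ≤ ∑ a ∈ Finset.range n, if decide (P S a) = true then 1 else 0 := by
      refine le_trans ?_ (Finset.single_le_sum (fun _ _ => Nat.zero_le _) (Finset.mem_range.2 ha))
      simp [haS]
    omega

open Classical in
-- The opposite count, for the certificate that leaves each cut at most once.
lemma sum_countP_le_length {ι : Type*} (n : ℕ) (P : ι → ℕ → Prop) :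
    ∀ l : List ι, (∀ S ∈ l, ∀ a < n, ∀ b < n, P S a → P S b → a = b) →
      ∑ a ∈ Finset.range n, (l.countP fun S => decide (P S a)) ≤ l.length
  | [], _ => by simp
  | S :: l, h => by
    have ih := sum_countP_le_length n P l fun T hT => h T (List.mem_cons_of_mem _ hT)
    have hS := h S List.mem_cons_self
    simp only [List.countP_cons, Finset.sum_add_distrib, List.length_cons]
    have : (∑ a ∈ Finset.range n, if decide (P S a) = true then 1 else 0) ≤ 1 := by
      simp only [decide_eq_true_eq, Finset.sum_boole, Nat.cast_id]
      rw [Finset.card_le_one]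
      intro a ha b hb
      simp only [Finset.mem_filter, Finset.mem_range] at ha hb
      exact hS a ha.1 b hb.1 ha.2 hb.2
    omega

namespace Profile

variable {n d : ℕ} (B : Profile n d)

open Classical in
/-- Optimality by duality: the total cost is the number of cuts in a packing. -/
theorem isMinSum_certOf {ι : Type*} {c : ℕ → ℕ} (l : List ι) (X : ι → ℕ → Prop)
    (hle : ∀ a < n, c a ≤ B.ballots.size a) (hr : ∀ a < n, B.ballots.Reaches c a)
    (hne : ∀ S ∈ l, ∃ a < n, X S a)
    (hpack : ∀ a < n, ∀ p ≤ B.ballots.size a,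
      (l.countP fun S => decide (B.ballots.Crosses (X S) a p)) ≤ p)
    (htight : ∀ a < n, c a ≤ l.countP fun S => decide (B.ballots.Crosses (X S) a (c a)))
    (honce : ∀ S ∈ l, ∀ a < n, ∀ b < n, B.ballots.Crosses (X S) a (c a) →
      B.ballots.Crosses (X S) b (c b) → a = b) :
    B.IsMinSum (B.certOf c) := by
  refine ⟨B.isConsistent_certOf hr, fun c' hc' => ?_⟩
  have h1 : ∑ a, (B.certOf c a : ℕ) = ∑ a ∈ Finset.range n, c a := by
    rw [Finset.sum_range]
    exact Finset.sum_congr rfl fun a _ => B.certOf_val (hle a a.is_lt)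
  have h2 : ∑ a ∈ Finset.range n, c a ≤ l.length :=
    le_trans (Finset.sum_le_sum fun a ha => htight a (Finset.mem_range.1 ha))
      (sum_countP_le_length n (fun S a => B.ballots.Crosses (X S) a (c a)) l honce)
  let c'' : ℕ → ℕ := fun a => if h : a < n then c' ⟨a, h⟩ else 0
  have h3 : l.length ≤ ∑ a ∈ Finset.range n, c'' a := by
    refine le_trans (length_le_sum_countP n (fun S a => B.ballots.Crosses (X S) a (c'' a)) l ?_)
      (Finset.sum_le_sum fun a ha => ?_)
    · intro S hS
      obtain ⟨a, ha⟩ := hc'.exists_crosses B (hne S hS)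
      exact ⟨a, a.is_lt, by simpa [c''] using ha⟩
    · have ha := Finset.mem_range.1 ha
      refine hpack a ha _ ?_
      simp only [c'', ha, dif_pos]
      have := B.ballots_size ⟨a, ha⟩
      have h5 := (c' ⟨a, ha⟩).is_lt
      simp only at this; omega
  have h4 : ∑ a ∈ Finset.range n, c'' a = ∑ a, (c' a : ℕ) := by
    rw [Finset.sum_range]
    exact Finset.sum_congr rfl fun a _ => by simp [c'']
  omega

/-- A single cut suffices as dual certificate of a bottleneck: every consistent certificate leaves
`X`, and this requires a rank of at least `K`. -/
theorem isMinMax_certOf {c : ℕ → ℕ} (K : ℕ) (X : ℕ → Prop)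
    (hle : ∀ a < n, c a ≤ B.ballots.size a) (hr : ∀ a < n, B.ballots.Reaches c a)
    (hK : ∀ a < n, c a ≤ K) (hne : ∃ a < n, X a)
    (hX : ∀ a < n, ∀ p ≤ B.ballots.size a, B.ballots.Crosses X a p → K ≤ p) :
    B.IsMinMax (B.certOf c) := by
  refine ⟨B.isConsistent_certOf hr, fun c' hc' => ?_⟩
  obtain ⟨a, ha⟩ := hc'.exists_crosses B hne
  have h1 : K ≤ c' a := hX a a.is_lt _ (by
    have := (c' a).is_lt
    rw [ballots_size]; omega) ha
  refine le_trans (Finset.sup_le fun b _ => ?_)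
    (Finset.le_sup (f := fun a => (c' a : ℕ)) (Finset.mem_univ a))
  rw [B.certOf_val (hle b b.is_lt)]
  exact (hK b b.is_lt).trans h1

end Profile

end LiquidDemocracy

/-! ### Word size, and computation of the offsets -/

namespace LiquidDemocracy

open WordRAM

namespace Profile

variable {n d : ℕ} (B : Profile n d)

lemma numEdges_eq : B.numEdges = n + B.ballots.off n := by
  rw [numEdges, ← offset_n]; rfl

/-- Keeps a number of steps that is linear in `numEdges` polynomial in `n`, as the word size
requires. -/
lemma numEdges_le : B.numEdges ≤ n * n := by
  have h : ∑ a, B.size a ≤ ∑ _a : Fin n, (n - 1) :=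
    Finset.sum_le_sum fun a _ => by have := B.size_lt a; omega
  simp only [Finset.sum_const, Finset.card_univ, Fintype.card_fin, smul_eq_mul] at h
  rw [numEdges]
  cases n with
  | zero => simp at h ⊢
  | succ k => simp only [Nat.add_sub_cancel] at h; nlinarith

lemma input_bounded : B.input.Bounded (n + d) := by
  have key : ∀ (l : List ℕ) (V i : ℕ), (∀ x ∈ l, x ≤ V) → l.getD i 0 ≤ V := by
    intro l V i h
    by_cases hi : i < l.length
    · rw [List.getD_eq_getElem _ _ hi]; exact h _ (List.getElem_mem hi)
    · rw [List.getD_eq_default _ _ (by omega)]; omega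
  refine ⟨fun x => key _ _ _ ?_, fun A i => ?_⟩
  · simp
  · match A with
    | 0 =>
      refine key _ _ _ fun x hx => ?_
      obtain ⟨a, rfl⟩ := (List.mem_ofFn' _ _).1 hx
      have := B.size_lt a; omega
    | 1 =>
      refine key _ _ _ fun x hx => ?_
      obtain ⟨a, _, hx⟩ := List.mem_flatMap.1 hx
      obtain ⟨j, rfl⟩ := (List.mem_ofFn' _ _).1 hx
      have := (B.deleg a j).is_lt; simp only; omega
    | 2 =>
      refine key _ _ _ fun x hx => ?_
      obtain ⟨a, rfl⟩ := (List.mem_ofFn' _ _).1 hx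
      have := (B.direct a).is_lt; simp only; omega
    | _ + 3 => exact Nat.zero_le _

end Profile

/-- A tame program with a linear bound on the number of its steps runs without overflow. -/
theorem computableInTime_of_halts {Spec : ∀ {n d : ℕ} (B : Profile n d), B.Certificate → Prop}
    {T : ℕ → ℕ → ℝ} (hT : ∀ n m : ℕ, 0 < n → (m : ℝ) ≤ T n m) (p : Prog) (hp : p.tame = true)
    (C : ℕ) (h : ∀ (n d : ℕ) (B : Profile n d), 0 < n →
      Halts p B.input (C * B.numEdges) fun s _ => ∃ c, B.IsOutput s c ∧ Spec B c) :
    ComputableInTime Spec T := by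
  -- With `N = n + d + 2`, all values stay below `(C + 1) * N ^ 2`, and `C + 1 ≤ N ^ C` absorbs the
  -- constant; hence the exponent `C + 2`.
  refine ⟨p, C + 2, C, fun n d B hn => ?_⟩
  obtain ⟨t, s, h1, h2, c, h3, h4⟩ := h n d B hn
  refine ⟨t, s, c, (h1.run hp B.input_bounded ?_).1, ?_, h3, h4⟩
  · have h5 := B.numEdges_le
    have h6 : C < (n + d + 2) ^ C := Nat.lt_pow_self (by omega)
    have h7 : t ≤ C * (n * n) := h2.trans (Nat.mul_le_mul_left _ h5)
    have h8 : n * n ≤ (n + d + 2) ^ 2 := by rw [sq]; exact Nat.mul_le_mul (by omega) (by omega)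
    have h9 : n + d < (n + d + 2) ^ 2 := by nlinarith
    calc n + d + t < (n + d + 2) ^ 2 + C * (n + d + 2) ^ 2 := by
          have := Nat.mul_le_mul_left C h8
          omega
      _ = (C + 1) * (n + d + 2) ^ 2 := by ring
      _ ≤ (n + d + 2) ^ C * (n + d + 2) ^ 2 := Nat.mul_le_mul_right _ h6
      _ = _ := by rw [pow_add]
  · calc (t : ℝ) ≤ ((C * B.numEdges : ℕ) : ℝ) := by exact_mod_cast h2
      _ = C * B.numEdges := by push_cast; ring
      _ ≤ _ := mul_le_mul_of_nonneg_left (hT n _ hn) (Nat.cast_nonneg C)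

namespace Machine

abbrev lt (e₁ e₂ : Expr) : Expr := .op .lt e₁ e₂
abbrev eq (e₁ e₂ : Expr) : Expr := .op .eq e₁ e₂
abbrev sub (e₁ e₂ : Expr) : Expr := .op .sub e₁ e₂
abbrev succ (e : Expr) : Expr := .op .add e (.const 1)
abbrev inc (x : ℕ) : Prog := .assign x (succ (.reg x))
abbrev dec (x : ℕ) : Prog := .assign x (sub (.reg x) (.const 1))

def block : List Prog → Prog
  | [] => .skip
  | [p] => p
  | p :: ps => .seq p (block ps)

/-- Computes the offsets of the ballots in array `4`, and a copy of them in array `5`. -/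
def offsets : Prog :=
  .loop (lt (.reg 2) (.reg 0))
    (.ite (lt (.reg 4) (.read 0 (.reg 2)))
      (block [inc 3, inc 4])
      (block [inc 2, .store 4 (.reg 2) (.reg 3), .store 5 (.reg 2) (.reg 3), .assign 4 (.const 0)]))

lemma ite_one_zero_ne {P : Prop} [Decidable P] : (if P then 1 else 0) ≠ 0 ↔ P := by
  split_ifs <;> simp_all

lemma ite_one_zero_eq {P : Prop} [Decidable P] : (if P then 1 else 0) = 0 ↔ ¬ P := by
  split_ifs <;> simp_all

/-- The state after the computation of the offsets. -/
structure HasOffsets {n d : ℕ} (B : Profile n d) (s : State) : Prop where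
  n_eq : s.reg 0 = n
  reg_eq : ∀ x, 5 ≤ x → s.reg x = 0
  arr_eq : ∀ A, A ≠ 4 → A ≠ 5 → s.arr A = B.input.arr A
  off_eq : ∀ a ≤ n, s.arr 4 a = B.ballots.off a
  cur_eq : ∀ a < n, s.arr 5 a = B.ballots.off a

/-- Tame programs cannot add two registers, so the offsets are counted up by ones: register `4`
counts within a ballot and register `3` overall. Each pass counts a delegation or closes a ballot
and takes at most 21 steps. -/
lemma halts_offsets {n d : ℕ} (B : Profile n d) {c c₀ : ℕ} {Q : State → ℕ → Prop}
    (hc : 21 * B.numEdges + 4 + c₀ ≤ c)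
    (hQ : ∀ s c', HasOffsets B s → c₀ ≤ c' → Q s c') :
    Halts offsets B.input c Q := by
  let I : State → ℕ → Prop := fun s c =>
    s.reg 0 = n ∧ (∀ x, 5 ≤ x → s.reg x = 0) ∧
    (∀ A, A ≠ 4 → A ≠ 5 → s.arr A = B.input.arr A) ∧
    s.reg 2 ≤ n ∧ (s.reg 2 = n → s.reg 4 = 0) ∧
    (s.reg 2 < n → s.reg 4 ≤ B.ballots.size (s.reg 2)) ∧
    s.reg 3 = B.ballots.off (s.reg 2) + s.reg 4 ∧
    (∀ a ≤ s.reg 2, s.arr 4 a = B.ballots.off a) ∧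
    (∀ a ≤ s.reg 2, s.arr 5 a = B.ballots.off a) ∧
    21 * ((n - s.reg 2) + (B.ballots.off n - s.reg 3)) + 4 + c₀ ≤ c
  refine Halts.loop I ?_ ?_
  · rintro s c ⟨h0, hreg, harr, h2, h2n, h4, h3, ho, hcu, hc⟩
    refine ⟨by simp [Expr.cost]; omega, fun hb => ?_, fun hb => ?_⟩
    · simp only [Expr.eval, Op.eval, ite_one_zero_ne, h0] at hb
      have hsz : s.arr 0 (s.reg 2) = B.ballots.size (s.reg 2) := by
        rw [harr 0 (by omega) (by omega)]
        have h1 := B.input_size ⟨s.reg 2, hb⟩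
        have h2 := B.ballots_size ⟨s.reg 2, hb⟩
        simp only at h1 h2
        rw [h1, h2]
      have hos := B.ballots.off_add_size (s.reg 2)
      have hle : B.ballots.off (s.reg 2 + 1) ≤ B.ballots.off n := B.ballots.off_mono (by omega)
      have h4' := h4 hb
      refine Halts.ite (by simp [Expr.cost]; omega) (fun hb2 => ?_) (fun hb2 => ?_)
      · simp only [Expr.eval, Op.eval, ite_one_zero_ne, hsz] at hb2
        refine Halts.straight rfl (by simp [block, Prog.ticks, Expr.cost]; omega) ?_
        refine ⟨?_, ?_, ?_, ?_, ?_, ?_, ?_, ?_, ?_, ?_⟩ <;>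
          simp [block, Prog.result, Expr.eval, Op.eval, State.setReg, Prog.ticks, Expr.cost]
        · exact h0
        · intro x hx
          rw [Function.update_of_ne (by omega), Function.update_of_ne (by omega)]
          exact hreg x hx
        · exact harr
        · exact h2
        · omega
        · omega
        · omega
        · exact ho
        · exact hcu
        · omega
      · simp only [Expr.eval, Op.eval, ite_one_zero_eq, hsz] at hb2
        refine Halts.straight rfl (by simp [block, Prog.ticks, Expr.cost]; omega) ?_
        refine ⟨?_, ?_, ?_, ?_, ?_, ?_, ?_, ?_, ?_, ?_⟩ <;>
          simp [block, Prog.result, Expr.eval, Op.eval, State.setReg, State.setArr,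
            Prog.ticks, Expr.cost]
        · exact h0
        · intro x hx
          rw [Function.update_of_ne (by omega), Function.update_of_ne (by omega)]
          exact hreg x hx
        · intro A hA hA'
          rw [Function.update_of_ne (by omega), Function.update_of_ne (by omega)]
          exact harr A hA hA'
        · omega
        · omega
        · intro a ha
          rw [Function.update_apply]
          split_ifs with h
          · subst h; omega
          · exact ho a (by omega)
        · intro a ha
          rw [Function.update_apply]
          split_ifs with h
          · subst h; omega
          · exact hcu a (by omega)
        · omega
    · simp only [Expr.eval, Op.eval, ite_one_zero_eq, h0] at hb
      have : s.reg 2 = n := by omega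
      refine hQ _ _ ⟨h0, hreg, harr, fun a ha => ho a (by omega), fun a ha => hcu a (by omega)⟩ ?_
      simp [Expr.cost]; omega
  · have h0 := B.ballots.off_zero
    have hm := B.numEdges_eq
    refine ⟨rfl, ?_, fun _ _ _ => rfl, Nat.zero_le _, fun _ => rfl, fun _ => Nat.zero_le _, ?_,
      ?_, ?_, ?_⟩
    · intro x hx
      change List.getD _ _ _ = _
      rw [List.getD_eq_default _ _ (by simpa using by omega)]
    · change 0 = B.ballots.off 0 + 0; omega
    · intro a (ha : a ≤ 0)
      obtain rfl : a = 0 := by omega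
      exact h0.symm
    · intro a (ha : a ≤ 0)
      obtain rfl : a = 0 := by omega
      exact h0.symm
    · change 21 * ((n - 0) + (B.ballots.off n - 0)) + 4 + c₀ ≤ c
      omega

end Machine

end LiquidDemocracy

/-! ### The laminar family of contracted sets and the path -/

namespace LiquidDemocracy

/-- `u` lies in the interval `S`. -/
def InIcc (S : ℕ × ℕ) (u : ℕ) : Prop := S.1 ≤ u ∧ u ≤ S.2

instance (S : ℕ × ℕ) (u : ℕ) : Decidable (InIcc S u) := inferInstanceAs (Decidable (_ ∧ _))

/-- The history of the contractions. The sets `[lo j, hi j]` with `1 ≤ j < T` form a laminar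
family; for `j < t` an edge with head `w j` has been selected for the `j`-th set, and `par j ≠ 0`
is the index of the next set that is formed when the `j`-th set disappears from the path. -/
structure LogInv (lo hi par w : ℕ → ℕ) (t T vis base : ℕ) : Prop where
  bounds : ∀ j, 1 ≤ j → j < T → 1 ≤ lo j ∧ lo j ≤ hi j ∧ hi j ≤ vis
  par_lt : ∀ k, 1 ≤ k → par k ≠ 0 → k < par k ∧ par k ≤ t
  nest : ∀ k j u, 1 ≤ k → k < j → j < T → InIcc (lo k, hi k) u → InIcc (lo j, hi j) u →
    par k ≠ 0 ∧ par k ≤ j ∧ lo (par k) ≤ lo k ∧ hi k ≤ hi (par k)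
  -- Strong connectivity of a contracted set through the edges selected for its constituents, as an
  -- induction principle: a property of one member spreads to all if it fills the constituent of
  -- that member and passes backwards along selected edges.
  conn : ∀ j, 1 ≤ j → j < T → ∀ (X : ℕ → Prop) (v : ℕ), InIcc (lo j, hi j) v → X v →
    (∀ k, 1 ≤ k → k < t → par k = j → lo j ≤ lo k → hi k ≤ hi j → InIcc (lo k, hi k) v →
      ∀ u, InIcc (lo k, hi k) u → X u) →
    (∀ k, 1 ≤ k → k < t → par k = j → lo j ≤ lo k → hi k ≤ hi j → X (w k) →
      ∀ u, InIcc (lo k, hi k) u → X u) →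
    ∀ u, InIcc (lo j, hi j) u → X u
  head_mem : ∀ k, 1 ≤ k → k < t → par k ≠ 0 → par k < T → lo (par k) ≤ lo k →
    hi k ≤ hi (par k) → InIcc (lo (par k), hi (par k)) (w k)
  single : ∀ u, 1 ≤ u → u ≤ vis → ∃ j, 1 ≤ j ∧ j < T ∧ lo j = u ∧ hi j = u
  -- Likewise, the indices below `base` are those connected to the root `0` by selected edges.
  reach : ∀ X : ℕ → Prop, X 0 →
    (∀ k, 1 ≤ k → k < t → X (w k) → ∀ u, InIcc (lo k, hi k) u → X u) → ∀ u < base, X u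

namespace LogInv

variable {lo hi par w : ℕ → ℕ} {t T vis base : ℕ}

/-- Climbing from `k` along `par`, the sets increase and keep `u`, and by `nest` the climb does not
jump over `j`. -/
lemma subset (h : LogInv lo hi par w t T vis base) {k j u : ℕ} (hk : 1 ≤ k) (hkj : k ≤ j)
    (hj : j < T) (h₁ : InIcc (lo k, hi k) u) (h₂ : InIcc (lo j, hi j) u) :
    lo j ≤ lo k ∧ hi k ≤ hi j := by
  induction hm : j - k using Nat.strong_induction_on generalizing k with
  | _ m ih =>
    rcases Nat.eq_or_lt_of_le hkj with rfl | hlt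
    · exact ⟨le_rfl, le_rfl⟩
    · obtain ⟨h3, h4, h5, h6⟩ := h.nest k j u hk hlt hj h₁ h₂
      have h7 := h.par_lt k hk h3
      have h8 : InIcc (lo (par k), hi (par k)) u := ⟨h5.trans h₁.1, h₁.2.trans h6⟩
      have h9 := ih (j - par k) (by omega) (by omega) h4 h8 rfl
      exact ⟨h9.1.trans h5, h6.trans h9.2⟩

lemma select (h : LogInv lo hi par w t (t + 1) vis base) (x : ℕ) :
    LogInv lo hi par (Function.update w t x) (t + 1) (t + 1) vis base where
  bounds := h.bounds
  par_lt k hk hp := by have := h.par_lt k hk hp; omega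
  nest := h.nest
  conn j hj hjt X v hv hX h1 h2 := by
    refine h.conn j hj hjt X v hv hX (fun k hk hkt => h1 k hk (by omega)) ?_
    intro k hk hkt hp hl hh hw
    refine h2 k hk (by omega) hp hl hh ?_
    rwa [Function.update_of_ne (by omega)]
  head_mem k hk hkt hp hpt hl hh := by
    have h1 := h.par_lt k hk hp
    rw [Function.update_of_ne (by omega)]
    exact h.head_mem k hk (by omega) hp hpt hl hh
  single := h.single
  reach X hX h1 := h.reach X hX fun k hk hkt hw => h1 k hk (by omega) (by
    rwa [Function.update_of_ne (by omega)])

lemma visit (h : LogInv lo hi par w t t vis base) (ht : 1 ≤ t) :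
    LogInv (Function.update lo t (vis + 1)) (Function.update hi t (vis + 1)) par w t (t + 1)
      (vis + 1) base := by
  have hlo : ∀ k, k < t → Function.update lo t (vis + 1) k = lo k := fun k hk =>
    Function.update_of_ne (by omega) _ _
  have hhi : ∀ k, k < t → Function.update hi t (vis + 1) k = hi k := fun k hk =>
    Function.update_of_ne (by omega) _ _
  have hlot : Function.update lo t (vis + 1) t = vis + 1 := by simp
  have hhit : Function.update hi t (vis + 1) t = vis + 1 := by simp
  generalize Function.update lo t (vis + 1) = lo' at *
  generalize Function.update hi t (vis + 1) = hi' at *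
  constructor
  · intro j hj hjt
    rcases Nat.lt_or_ge j t with hlt | hge
    · rw [hlo j hlt, hhi j hlt]
      have := h.bounds j hj hlt; omega
    · obtain rfl : j = t := by omega
      omega
  · exact h.par_lt
  · intro k j u hk hkj hjt h1 h2
    rw [hlo k (by omega), hhi k (by omega)] at *
    rcases Nat.lt_or_ge j t with hlt | hge
    · rw [hlo j hlt, hhi j hlt] at h2
      obtain ⟨h3, h4, h5⟩ := h.nest k j u hk hkj hlt h1 h2
      refine ⟨h3, h4, ?_⟩
      rwa [hlo _ (by omega), hhi _ (by omega)]
    · obtain rfl : j = t := by omega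
      have := h.bounds k hk hkj
      simp only [InIcc] at h1 h2
      omega
  · intro j hj hjt X v hv hX h1 h2
    rcases Nat.lt_or_ge j t with hlt | hge
    · rw [hlo j hlt, hhi j hlt] at *
      refine h.conn j hj hlt X v hv hX ?_ ?_
      · intro k hk hkt hp hl hh
        have := h1 k hk hkt hp
        rw [hlo k hkt, hhi k hkt] at this
        exact this hl hh
      · intro k hk hkt hp hl hh
        have := h2 k hk hkt hp
        rw [hlo k hkt, hhi k hkt] at this
        exact this hl hh
    · obtain rfl : j = t := by omega
      intro u hu
      simp only [InIcc] at hv hu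
      obtain rfl : u = v := by omega
      exact hX
  · intro k hk hkt hp hpt hl hh
    rw [hlo k hkt, hhi k hkt] at *
    rcases Nat.lt_or_ge (par k) t with hlt | hge
    · rw [hlo _ hlt, hhi _ hlt] at *
      exact h.head_mem k hk hkt hp hlt hl hh
    · have h3 : par k = t := by omega
      have := h.bounds k hk hkt
      rw [h3] at hl
      omega
  · intro u hu huv
    rcases Nat.lt_or_ge vis u with hlt | hge
    · exact ⟨t, ht, by omega, by omega, by omega⟩
    · obtain ⟨j, h1, h2, h3, h4⟩ := h.single u hu hge
      exact ⟨j, h1, by omega, by rw [hlo j h2, h3], by rw [hhi j h2, h4]⟩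
  · intro X hX h1
    refine h.reach X hX fun k hk hkt hw => ?_
    have := h1 k hk hkt hw
    rwa [hlo k hkt, hhi k hkt] at this

end LogInv

/-- The sets `[lo (it i), hi (it i)] = [bnd i, bnd (i + 1) - 1]`, `1 ≤ i ≤ h`, form a path, in which
the edge selected for a set leads to the next set. -/
structure PathInv (lo hi par w it bnd : ℕ → ℕ) (h T vis base : ℕ) : Prop where
  bnd_zero : bnd 0 = 0
  bnd_lt : ∀ i < h, bnd i < bnd (i + 1)
  it_lt : ∀ i, 1 ≤ i → i < h → it i < it (i + 1)
  it_pos : ∀ i, 1 ≤ i → i ≤ h → 1 ≤ it i ∧ it i < T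
  lo_it : ∀ i, 1 ≤ i → i ≤ h → lo (it i) = bnd i
  hi_it : ∀ i, 1 ≤ i → i < h → hi (it i) + 1 = bnd (i + 1)
  hi_top : 1 ≤ h → hi (it h) = vis
  par_it : ∀ i, 1 ≤ i → i ≤ h → par (it i) = 0
  link : ∀ i, 1 ≤ i → i < h → InIcc (lo (it (i + 1)), hi (it (i + 1))) (w (it i))
  base_zero : h = 0 → base = vis + 1
  base_pos : 1 ≤ h → base = bnd 1

namespace PathInv

variable {lo hi par w it bnd : ℕ → ℕ} {h t T vis base : ℕ}

lemma it_mono (hP : PathInv lo hi par w it bnd h T vis base) {i j : ℕ} (hi' : 1 ≤ i) (hij : i < j)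
    (hj : j ≤ h) : it i < it j := by
  induction j, hij using Nat.le_induction with
  | base => exact hP.it_lt i hi' (by omega)
  | succ j hj' ih => exact (ih (by omega)).trans (hP.it_lt j (by omega) (by omega))

lemma bnd_mono (hP : PathInv lo hi par w it bnd h T vis base) {i j : ℕ} (hij : i ≤ j)
    (hj : j ≤ h) : bnd i ≤ bnd j := by
  induction j, hij using Nat.le_induction with
  | base => exact le_rfl
  | succ j hj' ih => exact (ih (by omega)).trans (hP.bnd_lt j (by omega)).le

lemma hi_le (hP : PathInv lo hi par w it bnd h T vis base) (hv : bnd h ≤ vis) {i : ℕ}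
    (h1 : 1 ≤ i) (hih : i ≤ h) : hi (it i) ≤ vis := by
  rcases Nat.lt_or_ge i h with hlt | hge
  · have := hP.hi_it i h1 hlt
    have := hP.bnd_mono (i := i + 1) hlt le_rfl
    omega
  · obtain rfl : i = h := by omega
    exact (hP.hi_top h1).le

lemma exists_item (hP : PathInv lo hi par w it bnd h T vis base) {m u : ℕ} (hm : 1 ≤ m)
    (hmh : m ≤ h) (hu : bnd m ≤ u) (huv : u ≤ vis) :
    ∃ i, m ≤ i ∧ i ≤ h ∧ InIcc (lo (it i), hi (it i)) u := by
  induction hd : h - m generalizing m with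
  | zero =>
    obtain rfl : m = h := by omega
    exact ⟨m, le_rfl, le_rfl, by rw [hP.lo_it m hm hmh, hP.hi_top hm]; exact ⟨hu, huv⟩⟩
  | succ k ih =>
    by_cases hc : u < bnd (m + 1)
    · refine ⟨m, le_rfl, hmh, ?_⟩
      have := hP.hi_it m hm (by omega)
      rw [hP.lo_it m hm hmh]
      exact ⟨hu, by simp only; omega⟩
    · obtain ⟨i, h1, h2, h3⟩ := ih (m := m + 1) (by omega) (by omega) (by omega) (by omega)
      exact ⟨i, by omega, h2, h3⟩

/-- A property that passes backwards along the selected edges spreads to the beginning of the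
path. -/
lemma spread (hP : PathInv lo hi par w it bnd h T vis base) {m : ℕ} (hm : 1 ≤ m) {X : ℕ → Prop}
    (hX : ∀ i, m ≤ i → i ≤ h → X (w (it i)) → ∀ u, InIcc (lo (it i), hi (it i)) u → X u)
    {i : ℕ} (hih : i ≤ h) (hi' : ∀ u, InIcc (lo (it i), hi (it i)) u → X u) {j : ℕ}
    (hmj : m ≤ j) (hji : j ≤ i) : ∀ u, InIcc (lo (it j), hi (it j)) u → X u := by
  induction hd : i - j generalizing j with
  | zero =>
    obtain rfl : j = i := by omega
    exact hi'
  | succ k ih =>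
    exact hX j hmj (by omega)
      (ih (j := j + 1) (by omega) (by omega) (by omega) _ (hP.link j (by omega) (by omega)))

end PathInv

namespace LogInv

variable {lo hi par w it bnd lo' hi' par' : ℕ → ℕ} {h m t vis base : ℕ}

/-- The sets `m, …, h` of the path are contracted. -/
lemma contract (hL : LogInv lo hi par w t t vis base)
    (hP : PathInv lo hi par w it bnd h t vis base) (ht : 1 ≤ t) (hm : 1 ≤ m) (hmh : m ≤ h)
    (hbnd : bnd h ≤ vis)
    (hw : InIcc (lo (it m), hi (it m)) (w (it h)))
    (hlo : ∀ k < t, lo' k = lo k) (hhi : ∀ k < t, hi' k = hi k) (hlot : lo' t = bnd m)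
    (hhit : hi' t = vis)
    (hpar₁ : ∀ i, m ≤ i → i ≤ h → par' (it i) = t)
    (hpar₂ : ∀ k, (∀ i, m ≤ i → i ≤ h → k ≠ it i) → par' k = par k) (hpt : ∀ k, 1 ≤ k → par k < t) :
    LogInv lo' hi' par' w t (t + 1) vis base := by
  have hpar : ∀ k, par' k < t → par' k = par k := by
    intro k hk
    refine hpar₂ k fun i h1 h2 h3 => ?_
    rw [h3, hpar₁ i h1 h2] at hk
    omega
  have hpar' : ∀ k, par k ≠ 0 → par' k = par k := by
    intro k hk
    refine hpar₂ k fun i h1 h2 h3 => ?_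
    rw [h3, hP.par_it i (by omega) h2] at hk
    omega
  have hchild : ∀ k, 1 ≤ k → par' k = t → ∃ i, m ≤ i ∧ i ≤ h ∧ k = it i := by
    intro k hk hkt
    by_contra! hcon
    have := hpar₂ k fun i h1 h2 => hcon i h1 h2
    have := hpt k hk
    omega
  have hitt : ∀ i, m ≤ i → i ≤ h → 1 ≤ it i ∧ it i < t := fun i h1 h2 =>
    hP.it_pos i (by omega) h2
  have hitlo : ∀ i, m ≤ i → i ≤ h → bnd m ≤ lo (it i) := fun i h1 h2 => by
    rw [hP.lo_it i (by omega) h2]; exact hP.bnd_mono h1 h2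
  have hithi : ∀ i, m ≤ i → i ≤ h → hi (it i) ≤ vis := fun i h1 h2 =>
    hP.hi_le hbnd (by omega) h2
  have hb1 : 1 ≤ bnd m := by
    have := hL.bounds _ (hitt m le_rfl hmh).1 (hitt m le_rfl hmh).2
    rw [hP.lo_it m hm hmh] at this; omega
  constructor
  · intro j hj hjt
    rcases Nat.lt_or_ge j t with hlt | hge
    · rw [hlo j hlt, hhi j hlt]
      exact hL.bounds j hj hlt
    · obtain rfl : j = t := by omega
      have := hP.bnd_mono hmh le_rfl
      omega
  · intro k hk hp
    by_cases hlt : par' k < t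
    · rw [hpar k hlt] at hp ⊢; exact hL.par_lt k hk hp
    · by_cases hp0 : par k = 0
      · have : par' k = t := by
          by_contra hcon
          have : par' k ≠ par k := by omega
          exact this (hpar₂ k fun i h1 h2 h3 => hcon (by rw [h3]; exact hpar₁ i h1 h2))
        obtain ⟨i, h1, h2, rfl⟩ := hchild k hk this
        have := hitt i h1 h2
        omega
      · rw [hpar' k hp0]; exact hL.par_lt k hk hp0
  · intro k j u hk hkj hjt h1 h2
    have hkt : k < t := by omega
    rw [hlo k hkt, hhi k hkt] at *
    rcases Nat.lt_or_ge j t with hlt | hge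
    · rw [hlo j hlt, hhi j hlt] at h2
      obtain ⟨h3, h4, h5⟩ := hL.nest k j u hk hkj hlt h1 h2
      rw [hpar' k h3, hlo _ (by omega), hhi _ (by omega)]
      exact ⟨h3, h4, h5⟩
    · obtain rfl : j = t := by omega
      rw [hlot, hhit] at h2
      by_cases hit : ∃ i, m ≤ i ∧ i ≤ h ∧ k = it i
      · obtain ⟨i, h3, h4, rfl⟩ := hit
        rw [hpar₁ i h3 h4, hlot, hhit]
        exact ⟨by omega, le_rfl, hitlo i h3 h4, hithi i h3 h4⟩
      · push Not at hit
        obtain ⟨i, h3, h4, h5⟩ := hP.exists_item hm hmh h2.1 h2.2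
        rcases Nat.lt_or_ge k (it i) with hlt | hge
        · obtain ⟨h6, h7, h8⟩ := hL.nest k (it i) u hk hlt (hitt i h3 h4).2 h1 h5
          have := (hitt i h3 h4).2
          rw [hpar' k h6, hlo _ (by omega), hhi _ (by omega)]
          exact ⟨h6, by omega, h8⟩
        -- A later set that meets a path set would give the path set a parent, but sets on the path
        -- have parent `0`.
        · have h6 : it i < k := lt_of_le_of_ne hge fun h => hit i h3 h4 h.symm
          have := (hL.nest (it i) k u (hitt i h3 h4).1 h6 hkt h5 h1).1
          exact absurd (hP.par_it i (by omega) h4) this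
  · intro j hj hjt X v hv hX h1 h2
    rcases Nat.lt_or_ge j t with hlt | hge
    · rw [hlo j hlt, hhi j hlt] at *
      refine hL.conn j hj hlt X v hv hX ?_ ?_
      · intro k hk hkt hp hl hh
        have := h1 k hk hkt (by rw [hpar' k (by omega), hp])
        rw [hlo k hkt, hhi k hkt] at this
        exact this hl hh
      · intro k hk hkt hp hl hh
        have := h2 k hk hkt (by rw [hpar' k (by omega), hp])
        rw [hlo k hkt, hhi k hkt] at this
        exact this hl hh
    · obtain rfl : j = t := by omega
      rw [hlot, hhit] at hv h1 h2 ⊢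
      have h1' : ∀ i, m ≤ i → i ≤ h → InIcc (lo (it i), hi (it i)) v →
          ∀ u, InIcc (lo (it i), hi (it i)) u → X u := by
        intro i h3 h4
        have := h1 (it i) (hitt i h3 h4).1 (hitt i h3 h4).2 (hpar₁ i h3 h4)
        rw [hlo _ (hitt i h3 h4).2, hhi _ (hitt i h3 h4).2] at this
        exact this (hitlo i h3 h4) (hithi i h3 h4)
      have h2' : ∀ i, m ≤ i → i ≤ h → X (w (it i)) →
          ∀ u, InIcc (lo (it i), hi (it i)) u → X u := by
        intro i h3 h4
        have := h2 (it i) (hitt i h3 h4).1 (hitt i h3 h4).2 (hpar₁ i h3 h4)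
        rw [hlo _ (hitt i h3 h4).2, hhi _ (hitt i h3 h4).2] at this
        exact this (hitlo i h3 h4) (hithi i h3 h4)
      -- The merged sets form a cycle. The property spreads from the set of `v` back to the first
      -- set, through the closing edge to the last set, and from there back to all of them.
      obtain ⟨i, h3, h4, h5⟩ := hP.exists_item hm hmh hv.1 hv.2
      have h6 := hP.spread hm h2' h4 (h1' i h3 h4 h5) le_rfl h3
      have h7 := h2' h hmh le_rfl (h6 _ hw)
      intro u hu
      obtain ⟨i', h8, h9, h10⟩ := hP.exists_item hm hmh hu.1 hu.2
      exact hP.spread hm h2' le_rfl h7 h8 h9 u h10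
  · intro k hk hkt hp hpt' hl hh
    rw [hlo k hkt, hhi k hkt] at *
    rcases Nat.lt_or_ge (par' k) t with hlt | hge
    · rw [hlo _ hlt, hhi _ hlt] at *
      have hpk := hpar k hlt
      rw [hpk] at hp hlt hl hh ⊢
      exact hL.head_mem k hk hkt hp hlt hl hh
    · have h3 : par' k = t := by omega
      obtain ⟨i, h4, h5, rfl⟩ := hchild k hk h3
      rw [h3, hlot, hhit]
      rcases Nat.lt_or_ge i h with hlt' | hge'
      · have h6 := hP.link i (by omega) hlt'
        exact ⟨(hitlo (i + 1) (by omega) (by omega)).trans h6.1,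
          h6.2.trans (hithi (i + 1) (by omega) (by omega))⟩
      · obtain rfl : i = h := by omega
        exact ⟨(hitlo m le_rfl hmh).trans hw.1, hw.2.trans (hithi m le_rfl hmh)⟩
  · intro u hu huv
    obtain ⟨j, h1, h2, h3, h4⟩ := hL.single u hu huv
    exact ⟨j, h1, by omega, by rw [hlo j h2, h3], by rw [hhi j h2, h4]⟩
  · intro X hX h1
    refine hL.reach X hX fun k hk hkt hw => ?_
    have := h1 k hk hkt hw
    rwa [hlo k hkt, hhi k hkt] at this

/-- The whole path is attached to the root. -/
lemma finish (hL : LogInv lo hi par w t t vis base)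
    (hP : PathInv lo hi par w it bnd h t vis base) (hh : 1 ≤ h)
    (hw : w (it h) < base)
    (hpar₁ : ∀ i, 1 ≤ i → i ≤ h → par' (it i) = t)
    (hpar₂ : ∀ k, (∀ i, 1 ≤ i → i ≤ h → k ≠ it i) → par' k = par k) :
    LogInv lo hi par' w t t vis (vis + 1) := by
  have hpar' : ∀ k, par k ≠ 0 → par' k = par k := by
    intro k hk
    refine hpar₂ k fun i h1 h2 h3 => ?_
    rw [h3, hP.par_it i h1 h2] at hk
    omega
  have hpar : ∀ k, par' k < t → par' k = par k := by
    intro k hk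
    refine hpar₂ k fun i h1 h2 h3 => ?_
    rw [h3, hpar₁ i h1 h2] at hk
    omega
  -- The parent `t` is an index not in use yet. If it is used later, then for a fresh singleton
  -- outside the path; otherwise its exit is `0`. In both cases no exit is inherited from it.
  refine ⟨hL.bounds, ?_, ?_, ?_, ?_, hL.single, ?_⟩
  · intro k hk hp
    by_cases hp0 : par k = 0
    · by_cases hit : ∃ i, 1 ≤ i ∧ i ≤ h ∧ k = it i
      · obtain ⟨i, h3, h4, rfl⟩ := hit
        rw [hpar₁ i h3 h4]
        exact ⟨(hP.it_pos i h3 h4).2, le_rfl⟩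
      · push Not at hit
        exact absurd (by rw [hpar₂ k hit, hp0]) hp
    · rw [hpar' k hp0]; exact hL.par_lt k hk hp0
  · intro k j u hk hkj hjt h1 h2
    obtain ⟨h3, h4⟩ := hL.nest k j u hk hkj hjt h1 h2
    rw [hpar' k h3]; exact ⟨h3, h4⟩
  · intro j hj hjt X v hv hX h1 h2
    exact hL.conn j hj hjt X v hv hX
      (fun k hk hkt hp => h1 k hk hkt (by rw [hpar' k (by omega), hp]))
      (fun k hk hkt hp => h2 k hk hkt (by rw [hpar' k (by omega), hp]))
  · intro k hk hkt hp hpt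
    rw [hpar k hpt] at hp ⊢
    rw [hpar k hpt] at hpt
    exact hL.head_mem k hk hkt hp hpt
  · intro X hX h1 u hu
    have h2 := hL.reach X hX h1
    rcases Nat.lt_or_ge u base with hlt | hge
    · exact h2 u hlt
    · rw [hP.base_pos hh] at hge
      have h3 : ∀ i, 1 ≤ i → i ≤ h → X (w (it i)) → ∀ u, InIcc (lo (it i), hi (it i)) u → X u :=
        fun i h4 h5 => h1 (it i) (hP.it_pos i h4 h5).1 (hP.it_pos i h4 h5).2
      obtain ⟨i, h6, h7, h8⟩ := hP.exists_item le_rfl hh hge (by omega)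
      exact hP.spread le_rfl h3 le_rfl (h3 h hh le_rfl (h2 _ hw)) h6 h7 u h8

end LogInv

end LiquidDemocracy

/-! ### Expansion: exits of the contracted sets -/

namespace LiquidDemocracy

/-- Each set of the laminar family, from the `j₀`-th on, gets an exit: the exit of its parent if
this lies in the set, and otherwise the tail `tl j` of the edge selected for the set. -/
structure ExitInv (lo hi par tl ex : ℕ → ℕ) (t j₀ : ℕ) : Prop where
  zero : ∀ j, t ≤ j → ex j = 0
  inherit : ∀ j, j₀ ≤ j → j < t → InIcc (lo j, hi j) (ex (par j)) → ex j = ex (par j)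
  source : ∀ j, j₀ ≤ j → j < t → ¬ InIcc (lo j, hi j) (ex (par j)) → ex j = tl j

namespace ExitInv

variable {lo hi par w tl ex f : ℕ → ℕ} {t vis base j₀ : ℕ}

lemma mem (hE : ExitInv lo hi par tl ex t j₀)
    (htl : ∀ j, 1 ≤ j → j < t → InIcc (lo j, hi j) (tl j)) {j : ℕ} (h1 : 1 ≤ j) (hj : j₀ ≤ j)
    (hjt : j < t) : InIcc (lo j, hi j) (ex j) := by
  by_cases h : InIcc (lo j, hi j) (ex (par j))
  · rw [hE.inherit j hj hjt h]; exact h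
  · rw [hE.source j hj hjt h]; exact htl j h1 hjt

/-- All sets met when climbing from `k` to `j` contain the exit of `j`, so it is inherited all the
way down. -/
lemma eq_of_mem (hL : LogInv lo hi par w t t vis base) (hE : ExitInv lo hi par tl ex t j₀)
    (htl : ∀ j, 1 ≤ j → j < t → InIcc (lo j, hi j) (tl j)) {k j : ℕ} (h1 : 1 ≤ k) (hk : j₀ ≤ k)
    (hkj : k < j) (hjt : j < t) (h : InIcc (lo k, hi k) (ex j)) :
    ex k = ex j ∧ InIcc (lo k, hi k) (ex (par k)) := by
  induction hm : j - k using Nat.strong_induction_on generalizing k with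
  | _ m ih =>
    have h2 := hE.mem htl (by omega) (by omega : j₀ ≤ j) hjt
    obtain ⟨h3, h4, h5, h6⟩ := hL.nest k j _ h1 hkj hjt h h2
    have h7 := hL.par_lt k h1 h3
    have h8 : ex (par k) = ex j := by
      rcases Nat.lt_or_ge (par k) j with hlt | hge
      · exact (ih (j - par k) (by omega) (by omega) (by omega) hlt
          ⟨h5.trans h.1, h.2.trans h6⟩ rfl).1
      · rw [show par k = j by omega]
    rw [h8, and_iff_left h, hE.inherit k hk (by omega) (by rwa [h8]), h8]

/-- Different sets without an inherited exit have different exits. -/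
lemma source_unique (hL : LogInv lo hi par w t t vis base) (hE : ExitInv lo hi par tl ex t j₀)
    (htl : ∀ j, 1 ≤ j → j < t → InIcc (lo j, hi j) (tl j)) {k j : ℕ} (h1 : 1 ≤ k) (hk : j₀ ≤ k)
    (hkj : k < j) (hjt : j < t) (hks : ¬ InIcc (lo k, hi k) (ex (par k)))
    (hjs : ¬ InIcc (lo j, hi j) (ex (par j))) : tl k ≠ tl j := by
  intro he
  have h2 := hE.source j (by omega) hjt hjs
  exact hks (eq_of_mem hL hE htl h1 hk hkj hjt (by
    rw [h2, ← he]; exact htl k h1 (by omega))).2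

/-- Start at the singleton of `u`, whose exit is `u`, and climb while the exit is inherited. The
climb stops below `t`, since larger indices have exit `0`. -/
lemma exists_source (hL : LogInv lo hi par w t t vis base) (hE : ExitInv lo hi par tl ex t 1)
    (htl : ∀ j, 1 ≤ j → j < t → InIcc (lo j, hi j) (tl j))
    (hpar : ∀ j, 1 ≤ j → j < t → par j ≠ 0) {u : ℕ} (hu : 1 ≤ u) (huv : u ≤ vis) :
    ∃ j, 1 ≤ j ∧ j < t ∧ ¬ InIcc (lo j, hi j) (ex (par j)) ∧ ex j = u ∧ tl j = u := by
  obtain ⟨j, h1, h2, h3, h4⟩ := hL.single u hu huv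
  have h5 : ex j = u := by
    have := hE.mem htl h1 h1 h2
    simp only [InIcc] at this; omega
  clear h3 h4
  induction hm : t - j using Nat.strong_induction_on generalizing j with
  | _ m ih =>
    by_cases h : InIcc (lo j, hi j) (ex (par j))
    · have h6 := hE.inherit j h1 h2 h
      have h7 : par j < t := by
        by_contra hcon
        have := hE.zero (par j) (by omega)
        omega
      have h9 := hL.par_lt j h1 (hpar j h1 h2)
      exact ih (t - par j) (by omega) (par j) (by omega) h7 (by omega) rfl
    · exact ⟨j, h1, h2, h, h5, by rw [← h5, hE.source j h1 h2 h]⟩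

/-- Only the exit of a set leaves it. -/
lemma next_mem (hL : LogInv lo hi par w t t vis base) (hE : ExitInv lo hi par tl ex t 1)
    (htl : ∀ j, 1 ≤ j → j < t → InIcc (lo j, hi j) (tl j))
    (hpar : ∀ j, 1 ≤ j → j < t → par j ≠ 0)
    (hf : ∀ j, 1 ≤ j → j < t → ¬ InIcc (lo j, hi j) (ex (par j)) → f (tl j) = w j)
    {j u : ℕ} (h1 : 1 ≤ j) (hjt : j < t) (hu : InIcc (lo j, hi j) u) (hne : u ≠ ex j) :
    InIcc (lo j, hi j) (f u) := by
  have hb := hL.bounds j h1 hjt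
  obtain ⟨k, h2, h3, h4, h5, h6⟩ := exists_source hL hE htl hpar (hb.1.trans hu.1)
    (hu.2.trans hb.2.2)
  rcases Nat.lt_trichotomy k j with hlt | rfl | hgt
  · have h7 : InIcc (lo k, hi k) u := h6 ▸ htl k h2 h3
    obtain ⟨h8, h9, h10, h11⟩ := hL.nest k j u h2 hlt hjt h7 hu
    have h12 := hL.par_lt k h2 h8
    have h13 := hL.head_mem k h2 h3 h8 (by omega) h10 h11
    have h14 := hL.subset (by omega) h9 hjt
      (⟨h10.trans h7.1, h7.2.trans h11⟩ : InIcc (lo (par k), hi (par k)) u) hu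
    have h15 := hf k h2 h3 h4
    rw [h6] at h15
    rw [h15]
    exact ⟨h14.1.trans h13.1, h13.2.trans h14.2⟩
  · exact absurd h5.symm hne
  · exact absurd ((eq_of_mem hL hE htl h1 h1 hgt h3 (by rwa [h5])).1.trans h5).symm hne

/-- Induction over the sets by `conn`: the constituent that contains the exit of `j` inherits it,
and the others are left through the edges that they keep. -/
lemma reach_exit (hL : LogInv lo hi par w t t vis base) (hE : ExitInv lo hi par tl ex t 1)
    (htl : ∀ j, 1 ≤ j → j < t → InIcc (lo j, hi j) (tl j))
    (hf : ∀ j, 1 ≤ j → j < t → ¬ InIcc (lo j, hi j) (ex (par j)) → f (tl j) = w j)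
    {j : ℕ} (h1 : 1 ≤ j) (hjt : j < t) : ∀ u, InIcc (lo j, hi j) u → ∃ r, f^[r] u = ex j := by
  induction j using Nat.strong_induction_on with
  | _ j ih =>
    have key : ∀ k, 1 ≤ k → k < t → par k = j → k < j := fun k hk _ hp => by
      have := hL.par_lt k hk (by omega); omega
    refine hL.conn j h1 hjt (fun u => ∃ r, f^[r] u = ex j) (ex j) (hE.mem htl h1 h1 hjt) ⟨0, rfl⟩
      ?_ ?_
    · intro k hk hkt hp _ _ hv
      have := hE.inherit k hk hkt (by rwa [hp])
      rw [hp] at this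
      rw [← this]
      exact ih k (key k hk hkt hp) hk hkt
    · intro k hk hkt hp _ _ hw u hu
      obtain ⟨r, hr⟩ := ih k (key k hk hkt hp) hk hkt u hu
      by_cases h : InIcc (lo k, hi k) (ex (par k))
      · have := hE.inherit k hk hkt h
        exact ⟨r, by rw [hr, this, hp]⟩
      · obtain ⟨r', hr'⟩ := hw
        have h2 := hE.source k hk hkt h
        refine ⟨r' + 1 + r, ?_⟩
        rw [Function.iterate_add_apply, hr, h2, Function.iterate_add_apply,
          Function.iterate_one, hf k hk hkt h, hr']

lemma reach_zero (hL : LogInv lo hi par w t t vis base) (hE : ExitInv lo hi par tl ex t 1)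
    (htl : ∀ j, 1 ≤ j → j < t → InIcc (lo j, hi j) (tl j))
    (hpar : ∀ j, 1 ≤ j → j < t → par j ≠ 0)
    (hf : ∀ j, 1 ≤ j → j < t → ¬ InIcc (lo j, hi j) (ex (par j)) → f (tl j) = w j)
    (hf0 : f 0 = 0) : ∀ u < base, ∃ r, f^[r] u = 0 := by
  refine hL.reach (fun u => ∃ r, f^[r] u = 0) ⟨0, rfl⟩ fun k hk hkt ⟨s, hs⟩ u hu => ?_
  obtain ⟨r, hr⟩ := reach_exit hL hE htl hf hk hkt u hu
  suffices h : ∃ r', f^[r'] (ex k) = 0 by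
    obtain ⟨r', hr'⟩ := h
    exact ⟨r' + r, by rw [Function.iterate_add_apply, hr, hr']⟩
  by_cases h : InIcc (lo k, hi k) (ex (par k))
  · have h1 := hE.inherit k hk hkt h
    have hb := hL.bounds k hk hkt
    have h2 : par k < t := by
      by_contra hcon
      have := hE.zero (par k) (by omega)
      simp only [InIcc] at h
      omega
    have h3 := hpar k hk hkt
    have h4 := hL.par_lt k hk h3
    have h5 := hL.subset hk h4.1.le h2 h (hE.mem htl (by omega) (by omega) h2)
    obtain ⟨r', hr'⟩ := reach_exit hL hE htl hf (by omega) h2 _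
      (hL.head_mem k hk hkt h3 h2 h5.1 h5.2)
    -- The discarded edge of `k` ends in the parent, so its head `w k` also leads to the inherited
    -- exit. The orbit of `w k` hits the fixed point `0`, hence so does the orbit of the exit.
    refine ⟨s, ?_⟩
    rw [h1, ← hr', ← Function.iterate_add_apply, add_comm, Function.iterate_add_apply, hs]
    exact Function.iterate_fixed hf0 r'
  · have h2 := hE.source k hk hkt h
    exact ⟨s + 1, by rw [Function.iterate_add_apply, Function.iterate_one, h2, hf k hk hkt h, hs]⟩

end ExitInv

/-! ### Dual solution and optimality of the expanded certificate -/

/-- The index of the head of the edge at position `e` of agent `a`; the root has index `0`. -/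
def Ballots.headIdx (g : Ballots) (idx : ℕ → ℕ) (a e : ℕ) : ℕ :=
  if e < g.off (a + 1) then idx (g.del e) else 0

/-- The list `l` of cuts is a dual solution. -/
structure CutInv (g : Ballots) (idx cur sa sp w lo hi : ℕ → ℕ) (t T : ℕ) (l : List (ℕ × ℕ)) :
    Prop where
  mem : ∀ S ∈ l, ∃ j, 1 ≤ j ∧ j < T ∧ S = (lo j, hi j)
  count : ∀ a < g.n, (l.countP fun S => decide (InIcc S (idx a))) = cur a - g.off a
  pack : ∀ a < g.n, ∀ e, g.off a ≤ e → e ≤ g.off (a + 1) →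
    (l.countP fun S => decide (InIcc S (idx a) ∧ ¬ InIcc S (g.headIdx idx a e))) ≤ e - g.off a
  tight : ∀ j, 1 ≤ j → j < t → sp j - g.off (sa j) ≤
    l.countP fun S => decide (InIcc S (idx (sa j)) ∧ ¬ InIcc S (w j))

/-- Numbering of the visited agents by `1, …, vis`. -/
structure IdxInv (n : ℕ) (idx vert : ℕ → ℕ) (vis : ℕ) : Prop where
  le : ∀ a, idx a ≤ vis
  vert_idx : ∀ a, idx a ≠ 0 → a < n ∧ vert (idx a) = a
  idx_vert : ∀ u, 1 ≤ u → u ≤ vis → idx (vert u) = u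

/-- The edges selected for the sets of the laminar family. -/
structure SelInv (g : Ballots) (idx sa sp w lo hi : ℕ → ℕ) (t : ℕ) : Prop where
  mem : ∀ j, 1 ≤ j → j < t → InIcc (lo j, hi j) (idx (sa j))
  le : ∀ j, 1 ≤ j → j < t → g.off (sa j) ≤ sp j ∧ sp j ≤ g.off (sa j + 1)
  head : ∀ j, 1 ≤ j → j < t → w j = g.headIdx idx (sa j) (sp j) ∧
    (sp j < g.off (sa j + 1) → w j ≠ 0)

open Classical in
-- Complementary slackness: kept edges are tight by `CutInv.tight`, each cut is left only by its
-- exit by `ExitInv.next_mem`, and consistency is `ExitInv.reach_zero`.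
theorem isMinSum_of_inv {n d : ℕ} (B : Profile n d)
    {idx vert cur sa sp w lo hi par ex out : ℕ → ℕ} {t vis : ℕ} {l : List (ℕ × ℕ)}
    (hI : IdxInv n idx vert vis) (hvis : ∀ a < n, idx a ≠ 0)
    (hL : LogInv lo hi par w t t vis (vis + 1)) (hpar : ∀ j, 1 ≤ j → j < t → par j ≠ 0)
    (hS : SelInv B.ballots idx sa sp w lo hi t)
    (hC : CutInv B.ballots idx cur sa sp w lo hi t t l)
    (hE : ExitInv lo hi par (fun j => idx (sa j)) ex t 1)
    (hout : ∀ j, 1 ≤ j → j < t → ¬ InIcc (lo j, hi j) (ex (par j)) →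
      out (sa j) = sp j - B.ballots.off (sa j)) :
    (∀ a < n, out a ≤ B.ballots.size a) ∧ B.IsMinSum (B.certOf out) := by
  set g := B.ballots with hg
  -- On indices, `f` follows the chosen option; the root is a fixed point.
  let f : ℕ → ℕ := fun u => if u = 0 then 0 else
    g.headIdx idx (vert u) (g.off (vert u) + out (vert u))
  have hsrc : ∀ a < n, ∃ j, 1 ≤ j ∧ j < t ∧ ¬ InIcc (lo j, hi j) (ex (par j)) ∧
      ex j = idx a ∧ sa j = a ∧ out a = sp j - g.off a := by
    intro a ha
    obtain ⟨j, h1, h2, h3, h4, h5⟩ := ExitInv.exists_source hL hE hS.mem hpar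
      (Nat.one_le_iff_ne_zero.2 (hvis a ha)) (hI.le a)
    have h6 : sa j = a := by
      have hb := hL.bounds j h1 h2
      have hm := hS.mem j h1 h2
      have h7 := (hI.vert_idx (sa j) (by simp only [InIcc] at hm; omega)).2
      rw [← h7, h5, (hI.vert_idx a (hvis a ha)).2]
    have h7 := hout j h1 h2 h3
    rw [h6] at h7
    exact ⟨j, h1, h2, h3, h4, h6, h7⟩
  have hf : ∀ j, 1 ≤ j → j < t → ¬ InIcc (lo j, hi j) (ex (par j)) → f (idx (sa j)) = w j := by
    intro j h1 h2 h3
    have hb := hL.bounds j h1 h2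
    have hm := hS.mem j h1 h2
    have h0 : idx (sa j) ≠ 0 := by simp only [InIcc] at hm; omega
    have h4 := hS.le j h1 h2
    simp only [f, h0, if_false, (hI.vert_idx _ h0).2]
    rw [(hS.head j h1 h2).1, hout j h1 h2 h3]
    congr 1; omega
  have hle : ∀ a < n, out a ≤ g.size a := by
    intro a ha
    obtain ⟨j, h1, h2, h3, h4, rfl, h6⟩ := hsrc a ha
    have := hS.le j h1 h2
    rw [h6, Ballots.size]; omega
  have hfa : ∀ a < n, f (idx a) = g.headIdx idx a (g.off a + out a) := by
    intro a ha
    simp only [f, hvis a ha, if_false, (hI.vert_idx _ (hvis a ha)).2]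
  have hlt : ∀ a, a < n → out a < g.size a → g.del (g.off a + out a) < n := by
    intro a ha h
    refine g.del_lt _ ?_
    have h1 := g.off_add_size a
    have h2 : g.off (a + 1) ≤ g.off g.n := g.off_mono ha
    omega
  have hcross : ∀ S ∈ l, ∀ a p, g.Crosses (fun a => InIcc S (idx a)) a p ↔
      InIcc S (idx a) ∧ ¬ InIcc S (g.headIdx idx a (g.off a + p)) := by
    intro S hSl a p
    obtain ⟨j, h1, h2, rfl⟩ := hC.mem S hSl
    have hb := hL.bounds j h1 h2
    have h3 := g.off_add_size a
    unfold Ballots.Crosses Ballots.headIdx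
    by_cases hp : p < g.size a
    · rw [if_pos (by omega)]; simp [hp]
    · rw [if_neg (by omega)]
      simp only [hp, false_and, not_false_eq_true, and_true, InIcc]
      omega
  refine ⟨hle, B.isMinSum_certOf l (fun S a => InIcc S (idx a)) hle ?_ ?_ ?_ ?_ ?_⟩
  · intro a ha
    have h1 := ExitInv.reach_zero hL hE hS.mem hpar hf (by simp [f]) (idx a)
      (by have := hI.le a; omega)
    obtain ⟨r, hr⟩ := h1
    induction r generalizing a with
    | zero => exact absurd hr (hvis a ha)
    | succ r ih =>
      rw [Function.iterate_succ_apply, hfa a ha] at hr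
      rcases Nat.lt_or_ge (out a) (g.size a) with h | h
      · refine .deleg a h (ih _ (hlt a ha h) ?_)
        have := g.off_add_size a
        rwa [Ballots.headIdx, if_pos (by omega)] at hr
      · exact .direct a (le_antisymm (hle a ha) h)
  · intro S hSl
    obtain ⟨j, h1, h2, rfl⟩ := hC.mem S hSl
    have hb := hL.bounds j h1 h2
    have hm := hS.mem j h1 h2
    exact ⟨sa j, (hI.vert_idx (sa j) (by simp only [InIcc] at hm; omega)).1, hm⟩
  · intro a ha p hp
    rw [← hg] at hp
    have h1 := g.off_add_size a
    have h2 := hC.pack a ha (g.off a + p) (by omega) (by omega)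
    rw [Nat.add_sub_cancel_left] at h2
    refine le_trans (List.countP_mono_left fun S hSl h => ?_) h2
    rw [decide_eq_true_eq] at h ⊢
    exact (hcross S hSl a p).1 h
  · intro a ha
    obtain ⟨j, h1, h2, h3, h4, h5, h6⟩ := hsrc a ha
    have h7 := hC.tight j h1 h2
    have h8 := hf j h1 h2 h3
    rw [h5] at h7 h8
    conv_lhs => rw [h6]
    refine le_trans h7 (List.countP_mono_left fun S hSl h => ?_)
    rw [decide_eq_true_eq] at h ⊢
    rw [hcross S hSl, ← hfa a ha, h8]
    exact h
  · intro S hSl a ha b hb hca hcb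
    rw [hcross S hSl, ← hfa _ (by assumption)] at hca hcb
    obtain ⟨j, h1, h2, rfl⟩ := hC.mem S hSl
    have key : ∀ a < n, InIcc (lo j, hi j) (idx a) ∧ ¬ InIcc (lo j, hi j) (f (idx a)) →
        idx a = ex j := by
      intro a ha h
      by_contra hne
      exact h.2 (ExitInv.next_mem hL hE hS.mem hpar hf h1 h2 h.1 hne)
    rw [← (hI.vert_idx a (hvis a ha)).2, ← (hI.vert_idx b (hvis b hb)).2, key a ha hca,
      key b hb hcb]

end LiquidDemocracy

/-! ### Invariants of the path-growing algorithm -/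

namespace LiquidDemocracy

/-- The data of the path-growing algorithm. -/
structure PathState where
  vis : ℕ
  h : ℕ
  t : ℕ
  q : ℕ
  cur : ℕ → ℕ
  idx : ℕ → ℕ
  vert : ℕ → ℕ
  lo : ℕ → ℕ
  hi : ℕ → ℕ
  par : ℕ → ℕ
  sa : ℕ → ℕ
  sp : ℕ → ℕ
  it : ℕ → ℕ
  bnd : ℕ → ℕ
  cb : ℕ → ℕ
  cand : ℕ → ℕ

/-- The invariant of the path-growing algorithm. For `p = 1`, no edge has been selected yet for the
last set of the path; for `p = 0`, edges have been selected for all sets of the path. -/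
structure GrowthInv (g : Ballots) (m : PathState) (w : ℕ → ℕ) (l : List (ℕ × ℕ)) (base p : ℕ) :
    Prop where
  t_pos : 1 ≤ m.t
  idx : IdxInv g.n m.idx m.vert m.vis
  log : LogInv m.lo m.hi m.par w m.t (m.t + p) m.vis base
  path : PathInv m.lo m.hi m.par w m.it m.bnd m.h (m.t + p) m.vis base
  cut : CutInv g m.idx m.cur m.sa m.sp w m.lo m.hi m.t (m.t + p) l
  cur_le : ∀ a < g.n, g.off a ≤ m.cur a ∧ m.cur a ≤ g.off (a + 1)
  top : p = 1 → 1 ≤ m.h ∧ m.it m.h = m.t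
  bnd_le : m.bnd m.h ≤ m.vis
  cb_le : ∀ i, 1 ≤ i → i < m.h → m.cb i ≤ m.cb (i + 1)
  cb_top : 1 ≤ m.h → m.cb m.h ≤ m.q
  -- From `cb i` on, the stack holds only candidates from the `i`-th and later sets of the path.
  cand_mem : ∀ i, 1 ≤ i → i ≤ m.h → ∀ z, m.cb i ≤ z → z < m.q → m.bnd i ≤ m.idx (m.cand z)
  -- Among the options up to the current one, only the current one may leave the set; then its agent
  -- is still a candidate, or it is the edge selected for the set.
  explored : ∀ i, 1 ≤ i → i ≤ m.h → ∀ a < g.n, InIcc (m.bnd i, m.hi (m.it i)) (m.idx a) →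
    ∀ e, g.off a ≤ e → e ≤ m.cur a →
      InIcc (m.bnd i, m.hi (m.it i)) (g.headIdx m.idx a e) ∨
      e = m.cur a ∧ ((∃ z, m.cb i ≤ z ∧ z < m.q ∧ m.cand z = a) ∨
        (i + p ≤ m.h ∧ m.sa (m.it i) = a))
  sel_cur : ∀ i, 1 ≤ i → i + p ≤ m.h → m.sp (m.it i) = m.cur (m.sa (m.it i))
  logged : ∀ k, 1 ≤ k → k < m.t → m.par k ≠ 0 ∨ ∃ i, 1 ≤ i ∧ i ≤ m.h ∧ k = m.it i

namespace SelInv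

variable {g : Ballots} {idx sa sp w lo hi lo' hi' : ℕ → ℕ} {t : ℕ}

lemma congr_bounds (hS : SelInv g idx sa sp w lo hi t) (hlo : ∀ k < t, lo' k = lo k)
    (hhi : ∀ k < t, hi' k = hi k) : SelInv g idx sa sp w lo' hi' t :=
  ⟨fun j h1 h2 => by rw [hlo j h2, hhi j h2]; exact hS.mem j h1 h2, hS.le, hS.head⟩

/-- Recorded heads of delegations and recorded tails have nonzero indices, so numbering an unvisited
agent changes none of them. -/
lemma update_idx (hS : SelInv g idx sa sp w lo hi t) (hlo : ∀ j, 1 ≤ j → j < t → 1 ≤ lo j)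
    {b v : ℕ} (hb : idx b = 0) : SelInv g (Function.update idx b v) sa sp w lo hi t := by
  refine ⟨fun j h1 h2 => ?_, hS.le, fun j h1 h2 => ?_⟩
  · have h3 := hS.mem j h1 h2
    have h4 := hlo j h1 h2
    rw [Function.update_of_ne]
    · exact h3
    · rintro rfl
      simp only [InIcc] at h3; omega
  · obtain ⟨h3, h4⟩ := hS.head j h1 h2
    refine ⟨?_, h4⟩
    rw [h3]
    unfold Ballots.headIdx at h3 ⊢
    split_ifs with h
    · rw [if_pos h] at h3
      rw [Function.update_of_ne]
      intro h5
      exact h4 h (by rw [h3, h5, hb])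
    · rfl

lemma select (hS : SelInv g idx sa sp w lo hi t) {a e x : ℕ} (hmem : InIcc (lo t, hi t) (idx a))
    (he : g.off a ≤ e ∧ e ≤ g.off (a + 1)) (hx : x = g.headIdx idx a e)
    (hx0 : e < g.off (a + 1) → x ≠ 0) :
    SelInv g idx (Function.update sa t a) (Function.update sp t e) (Function.update w t x)
      lo hi (t + 1) := by
  refine ⟨fun j h1 h2 => ?_, fun j h1 h2 => ?_, fun j h1 h2 => ?_⟩ <;> by_cases hj : j = t
  · simpa [hj] using hmem
  · simpa only [Function.update_of_ne hj] using hS.mem j h1 (by omega)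
  · simpa [hj] using he
  · simpa only [Function.update_of_ne hj] using hS.le j h1 (by omega)
  · simpa [hj] using ⟨hx, hx0⟩
  · simpa only [Function.update_of_ne hj] using hS.head j h1 (by omega)

end SelInv

namespace CutInv

variable {g : Ballots} {idx cur sa sp w lo hi lo' hi' idx' : ℕ → ℕ} {t T T' : ℕ} {l : List (ℕ × ℕ)}

lemma congr_bounds (hC : CutInv g idx cur sa sp w lo hi t T l) (hlo : ∀ k < T, lo' k = lo k)
    (hhi : ∀ k < T, hi' k = hi k) (hT : T ≤ T') : CutInv g idx cur sa sp w lo' hi' t T' l :=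
  ⟨fun S hS => by
    obtain ⟨j, h1, h2, h3⟩ := hC.mem S hS
    exact ⟨j, h1, by omega, by rw [hlo j h2, hhi j h2, h3]⟩, hC.count, hC.pack, hC.tight⟩

lemma congr_idx (hC : CutInv g idx cur sa sp w lo hi t T l)
    (h : ∀ S ∈ l, ¬ InIcc S 0 ∧ ∀ a, InIcc S (idx' a) ↔ InIcc S (idx a)) :
    CutInv g idx' cur sa sp w lo hi t T l := by
  refine ⟨hC.mem, fun a ha => ?_, fun a ha e h1 h2 => ?_, fun j h1 h2 => ?_⟩
  · rw [← hC.count a ha]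
    exact List.countP_congr fun S hS => by simp [(h S hS).2]
  · refine le_trans (le_of_eq (List.countP_congr fun S hS => ?_)) (hC.pack a ha e h1 h2)
    unfold Ballots.headIdx
    split_ifs <;> simp [(h S hS).2]
  · refine le_trans (hC.tight j h1 h2) (le_of_eq (List.countP_congr fun S hS => ?_))
    simp [(h S hS).2]

end CutInv

namespace PathState

/-- The edge at the current position of agent `a` is selected for the last set of the path. -/
def select (m : PathState) (a : ℕ) : PathState :=
  { m with
    q := m.q - 1
    t := m.t + 1
    sa := Function.update m.sa m.t a
    sp := Function.update m.sp m.t (m.cur a) }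

/-- The agent `b` is appended to the path. -/
def visit (m : PathState) (b : ℕ) : PathState :=
  { m with
    vis := m.vis + 1
    h := m.h + 1
    q := m.q + 1
    idx := Function.update m.idx b (m.vis + 1)
    vert := Function.update m.vert (m.vis + 1) b
    lo := Function.update m.lo m.t (m.vis + 1)
    hi := Function.update m.hi m.t (m.vis + 1)
    it := Function.update m.it (m.h + 1) m.t
    bnd := Function.update m.bnd (m.h + 1) (m.vis + 1)
    cb := Function.update m.cb (m.h + 1) m.q
    cand := Function.update m.cand m.q b }

/-- The sets `k, …, h` of the path are replaced by their union. -/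
def contract (m : PathState) (par : ℕ → ℕ) (k : ℕ) : PathState :=
  { m with
    h := k
    par := par
    lo := Function.update m.lo m.t (m.bnd k)
    hi := Function.update m.hi m.t m.vis
    it := Function.update m.it k m.t }

/-- The whole path is attached to the root. -/
def finish (m : PathState) (par : ℕ → ℕ) : PathState :=
  { m with
    h := 0
    par := par }

def discard (m : PathState) : PathState := { m with q := m.q - 1 }

/-- All agents in the last set of the path move on in their ballots. -/
def grow (m : PathState) (cur cand : ℕ → ℕ) : PathState :=
  { m with
    q := m.q + (m.vis + 1 - m.bnd m.h)
    cur := cur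
    cand := cand }

end PathState

namespace GrowthInv

variable {g : Ballots} {m : PathState} {w : ℕ → ℕ} {l : List (ℕ × ℕ)} {base : ℕ}

lemma hi_lt_bnd {p : ℕ} (hG : GrowthInv g m w l base p) {i j : ℕ} (hi : 1 ≤ i) (hij : i < j)
    (hj : j ≤ m.h) : m.hi (m.it i) < m.bnd j := by
  have h1 := hG.path.hi_it i hi (by omega)
  have h2 := hG.path.bnd_mono (i := i + 1) hij hj
  omega

lemma cb_mono {p : ℕ} (hG : GrowthInv g m w l base p) {i j : ℕ} (h1 : 1 ≤ i) (hij : i ≤ j)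
    (hj : j ≤ m.h) : m.cb i ≤ m.cb j := by
  induction j, hij using Nat.le_induction with
  | base => exact le_rfl
  | succ j hj' ih => exact (ih (by omega)).trans (hG.cb_le j (by omega) (by omega))

lemma bnd_pos {p : ℕ} (hG : GrowthInv g m w l base p) {i : ℕ} (h1 : 1 ≤ i) (hi : i ≤ m.h) :
    1 ≤ m.bnd i := by
  have : m.bnd 0 < m.bnd 1 := hG.path.bnd_lt 0 (by omega)
  have := hG.path.bnd_mono h1 hi
  omega

lemma cand_lt {p : ℕ} (hG : GrowthInv g m w l base p) (hh : 1 ≤ m.h) {z : ℕ}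
    (hz : m.cb m.h ≤ z) (hzq : z < m.q) : m.cand z < g.n ∧
      InIcc (m.bnd m.h, m.vis) (m.idx (m.cand z)) := by
  have h1 := hG.cand_mem m.h hh le_rfl z hz hzq
  have h2 := hG.bnd_pos hh le_rfl
  exact ⟨(hG.idx.vert_idx _ (by omega)).1, h1, hG.idx.le _⟩

lemma select (hG : GrowthInv g m w l base 1) (hq : m.cb m.h < m.q) {a x : ℕ}
    (ha : a = m.cand (m.q - 1)) (hx : ¬ InIcc (m.bnd m.h, m.vis) x) :
    GrowthInv g (m.select a) (Function.update w m.t x) l base 0 := by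
  obtain ⟨hh, htop⟩ := hG.top rfl
  have hmem := hG.cand_lt hh (z := m.q - 1) (by omega) (by omega)
  rw [← ha] at hmem
  have hitlt : ∀ i, 1 ≤ i → i < m.h → m.it i < m.t := fun i h1 h2 => by
    rw [← htop]; exact hG.path.it_mono h1 h2 le_rfl
  have hne : ∀ i, 1 ≤ i → i < m.h → m.it i ≠ m.t := fun i h1 h2 => (hitlt i h1 h2).ne
  have hlot : m.lo m.t = m.bnd m.h := by rw [← htop]; exact hG.path.lo_it _ hh le_rfl
  have hhit : m.hi m.t = m.vis := by rw [← htop]; exact hG.path.hi_top hh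
  constructor
  · simp [PathState.select]
  · exact hG.idx
  · exact hG.log.select x
  · have hP := hG.path
    refine ⟨hP.bnd_zero, hP.bnd_lt, hP.it_lt, hP.it_pos, hP.lo_it, hP.hi_it, hP.hi_top,
      hP.par_it, ?_, hP.base_zero, hP.base_pos⟩
    intro i h1 h2
    have := hP.link i h1 h2
    simp only [PathState.select]
    rwa [Function.update_of_ne (hne i h1 h2)]
  · have hC := hG.cut
    refine ⟨hC.mem, hC.count, hC.pack, ?_⟩
    intro j h1 h2
    simp only [PathState.select] at h2 ⊢
    rcases Nat.lt_or_ge j m.t with hlt | hge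
    · simp only [Function.update_of_ne (show j ≠ m.t by omega)]
      exact hC.tight j h1 hlt
    · obtain rfl : j = m.t := by omega
      simp only [Function.update_self]
      -- Tightness: there are `cur a - off a` cuts that contain the tail. By laminarity they all lie
      -- in the last set, which the edge leaves, so it leaves all of them.
      rw [← hC.count a hmem.1]
      refine List.countP_mono_left fun S hS h => ?_
      rw [decide_eq_true_eq] at h ⊢
      refine ⟨h, fun hxS => hx ?_⟩
      obtain ⟨j, h3, h4, rfl⟩ := hC.mem S hS
      have h5 := hG.log.subset h3 (by omega : j ≤ m.t) (by omega) h
        (by rw [hlot, hhit]; exact hmem.2)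
      rw [hlot, hhit] at h5
      exact ⟨h5.1.trans hxS.1, hxS.2.trans h5.2⟩
  · exact hG.cur_le
  · intro h; omega
  · exact hG.bnd_le
  · exact hG.cb_le
  · intro _; simp only [PathState.select]; omega
  · intro i h1 h2 z h3 h4
    simp only [PathState.select] at *
    exact hG.cand_mem i h1 h2 z h3 (by omega)
  · intro i h1 h2 b hb hbi e he1 he2
    simp only [PathState.select] at *
    rcases hG.explored i h1 h2 b hb hbi e he1 he2 with h3 | ⟨h3, h4⟩
    · exact Or.inl h3
    · refine Or.inr ⟨h3, ?_⟩
      rcases h4 with ⟨z, h5, h6, h7⟩ | ⟨h5, h6⟩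
      · rcases Nat.lt_or_ge z (m.q - 1) with hlt | hge
        · exact Or.inl ⟨z, h5, hlt, h7⟩
        · obtain rfl : z = m.q - 1 := by omega
          rw [← ha] at h7
          subst h7
          right
          rcases Nat.lt_or_ge i m.h with hlt | hge
          · have := hG.hi_lt_bnd h1 hlt le_rfl
            have h8 := hmem.2
            simp only [InIcc] at h8 hbi
            omega
          · obtain rfl : i = m.h := by omega
            exact ⟨by omega, by rw [htop]; simp⟩
      · right
        refine ⟨by omega, ?_⟩
        rwa [Function.update_of_ne (hne i h1 (by omega))]
  · intro i h1 h2
    simp only [PathState.select] at *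
    rcases Nat.lt_or_ge i m.h with hlt | hge
    · simp only [Function.update_of_ne (hne i h1 hlt)]
      exact hG.sel_cur i h1 (by omega)
    · obtain rfl : i = m.h := by omega
      rw [htop]; simp
  · intro k h1 h2
    simp only [PathState.select] at *
    rcases Nat.lt_or_ge k m.t with hlt | hge
    · exact hG.logged k h1 hlt
    · exact Or.inr ⟨m.h, hh, le_rfl, by omega⟩

/-- If the path is nonempty, its last selected edge already records as head the number `vis + 1`
that `b` receives here. -/
lemma visit (hG : GrowthInv g m w l base 0) {b : ℕ} (hb : b < g.n) (hb0 : m.idx b = 0)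
    (hw : 1 ≤ m.h → w (m.it m.h) = m.vis + 1) : GrowthInv g (m.visit b) w l base 1 := by
  have hitlt : ∀ i, 1 ≤ i → i ≤ m.h → m.it i < m.t := fun i h1 h2 => (hG.path.it_pos i h1 h2).2
  have hbounds := hG.log.bounds
  -- No cut contains the index `0` of an unvisited agent, so `b` is still at its first option.
  have hcurb : m.cur b = g.off b := by
    have h1 := hG.cut.count b hb
    have h2 : (l.countP fun S => decide (InIcc S (m.idx b))) = 0 := by
      rw [List.countP_eq_zero]
      intro S hS
      obtain ⟨j, h3, h4, rfl⟩ := hG.cut.mem S hS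
      have := hbounds j h3 h4
      rw [decide_eq_true_eq, hb0]
      simp only [InIcc]; omega
    have := hG.cur_le b hb
    omega
  have hidx : ∀ a, m.idx a ≠ 0 → Function.update m.idx b (m.vis + 1) a = m.idx a := by
    intro a ha
    rw [Function.update_of_ne]
    rintro rfl; exact ha hb0
  have hidx' : ∀ a, Function.update m.idx b (m.vis + 1) a ≤ m.vis →
      Function.update m.idx b (m.vis + 1) a = m.idx a := by
    intro a ha
    rw [Function.update_of_ne]
    rintro rfl; simp at ha
  have hlt : m.bnd m.h < m.vis + 1 := by have := hG.bnd_le; omega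
  have hP := hG.path
  have hit : ∀ i, i ≤ m.h → Function.update m.it (m.h + 1) m.t i = m.it i := fun i h =>
    Function.update_of_ne (by omega) _ _
  have hbnd : ∀ i, i ≤ m.h → Function.update m.bnd (m.h + 1) (m.vis + 1) i = m.bnd i := fun i h =>
    Function.update_of_ne (by omega) _ _
  have hcb : ∀ i, i ≤ m.h → Function.update m.cb (m.h + 1) m.q i = m.cb i := fun i h =>
    Function.update_of_ne (by omega) _ _
  have hlo : ∀ i, i < m.t → Function.update m.lo m.t (m.vis + 1) i = m.lo i := fun i h =>
    Function.update_of_ne (by omega) _ _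
  have hhi : ∀ i, i < m.t → Function.update m.hi m.t (m.vis + 1) i = m.hi i := fun i h =>
    Function.update_of_ne (by omega) _ _
  constructor
  · exact hG.t_pos
  · have hI := hG.idx
    refine ⟨fun a => ?_, fun a ha => ?_, fun u h1 h2 => ?_⟩ <;> simp only [PathState.visit] at *
    · rw [Function.update_apply]
      have := hI.le a
      split_ifs <;> omega
    · by_cases hab : a = b
      · subst hab; simp [hb]
      · rw [Function.update_of_ne hab] at ha ⊢
        have h3 := hI.vert_idx a ha
        have h4 := hI.le a
        rw [Function.update_of_ne (by omega)]
        exact h3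
    · by_cases huv : u = m.vis + 1
      · subst huv; simp
      · rw [Function.update_of_ne huv]
        have := hI.idx_vert u h1 (by omega)
        rw [hidx _ (by omega), this]
  · exact hG.log.visit hG.t_pos
  · refine ⟨?_, ?_, ?_, ?_, ?_, ?_, ?_, ?_, ?_, ?_, ?_⟩ <;> simp only [PathState.visit]
    · rw [hbnd 0 (by omega)]; exact hP.bnd_zero
    · intro i hi
      rw [hbnd i (by omega)]
      rcases Nat.lt_or_ge i m.h with h | h
      · rw [hbnd _ (by omega)]; exact hP.bnd_lt i h
      · obtain rfl : i = m.h := by omega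
        simpa using hlt
    · intro i h1 hi
      rw [hit i (by omega)]
      rcases Nat.lt_or_ge i m.h with h | h
      · rw [hit _ (by omega)]; exact hP.it_lt i h1 h
      · obtain rfl : i = m.h := by omega
        simpa using hitlt _ h1 le_rfl
    · intro i h1 hi
      rcases Nat.lt_or_ge m.h i with h | h
      · obtain rfl : i = m.h + 1 := by omega
        simpa using hG.t_pos
      · rw [hit _ h]
        have := hP.it_pos i h1 h
        omega
    · intro i h1 hi
      rcases Nat.lt_or_ge m.h i with h | h
      · obtain rfl : i = m.h + 1 := by omega
        simp
      · rw [hit _ h, hbnd _ h, hlo _ (hitlt i h1 h)]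
        exact hP.lo_it i h1 h
    · intro i h1 hi
      rw [hit _ (by omega), hhi _ (hitlt i h1 (by omega))]
      rcases Nat.lt_or_ge i m.h with h | h
      · rw [hbnd _ (by omega)]; exact hP.hi_it i h1 h
      · obtain rfl : i = m.h := by omega
        simpa using hP.hi_top h1
    · intro _; simp
    · intro i h1 hi
      rcases Nat.lt_or_ge m.h i with h | h
      · obtain rfl : i = m.h + 1 := by omega
        rw [Function.update_self]
        by_contra hcon
        have := hG.log.par_lt m.t hG.t_pos hcon
        omega
      · rw [hit _ h]; exact hP.par_it i h1 h
    · intro i h1 hi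
      rw [hit _ (by omega : i ≤ m.h)]
      rcases Nat.lt_or_ge i m.h with h | h
      · rw [hit _ (by omega : i + 1 ≤ m.h), hlo _ (hitlt _ (by omega) (by omega)),
          hhi _ (hitlt _ (by omega) (by omega))]
        exact hP.link i h1 h
      · obtain rfl : i = m.h := by omega
        rw [hw h1]
        simp [InIcc]
    · intro h; omega
    · intro _
      rcases Nat.eq_zero_or_pos m.h with h | h
      · rw [h]; simpa using hP.base_zero h
      · rw [hbnd _ h]; exact hP.base_pos h
  · refine (hG.cut.congr_idx fun S hS => ?_).congr_bounds hlo hhi (by simp [PathState.visit])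
    obtain ⟨j, h1, h2, rfl⟩ := hG.cut.mem S hS
    have h3 := hbounds j h1 h2
    refine ⟨by simp only [InIcc]; omega, fun a => ?_⟩
    simp only [PathState.visit]
    by_cases hab : a = b
    · subst hab
      rw [Function.update_self, hb0]
      simp only [InIcc]; omega
    · rw [Function.update_of_ne hab]
  · exact hG.cur_le
  · intro _; simp [PathState.visit]
  · simp [PathState.visit]
  · intro i h1 hi
    simp only [PathState.visit] at *
    rw [hcb i (by omega)]
    rcases Nat.lt_or_ge i m.h with h | h
    · rw [hcb _ (by omega)]; exact hG.cb_le i h1 h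
    · obtain rfl : i = m.h := by omega
      simpa using hG.cb_top h1
  · intro _; simp [PathState.visit]
  · intro i h1 hi z h2 h3
    simp only [PathState.visit] at *
    have h4 : m.vis + 1 ≥ Function.update m.bnd (m.h + 1) (m.vis + 1) i := by
      rcases Nat.lt_or_ge m.h i with h | h
      · obtain rfl : i = m.h + 1 := by omega
        simp
      · rw [hbnd i h]
        have := hP.bnd_mono h le_rfl
        omega
    by_cases hz : z = m.q
    · subst hz; simpa using h4
    · rw [Function.update_of_ne hz]
      rcases Nat.lt_or_ge m.h i with h | h
      · obtain rfl : i = m.h + 1 := by omega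
        rw [Function.update_self] at h2
        omega
      · rw [hcb _ h] at h2
        rw [hbnd _ h]
        have h5 := hG.cand_mem i h1 h z h2 (by omega)
        have h6 := hG.bnd_pos h1 h
        rwa [hidx _ (by omega)]
  · intro i h1 hi a ha hai e he1 he2
    simp only [PathState.visit] at *
    rcases Nat.lt_or_ge m.h i with h | h
    · obtain rfl : i = m.h + 1 := by omega
      simp only [Function.update_self] at *
      have hab : a = b := by
        by_contra hab
        rw [Function.update_of_ne hab] at hai
        have := hG.idx.le a
        simp only [InIcc] at hai; omega
      subst hab
      exact Or.inr ⟨by omega, Or.inl ⟨m.q, le_rfl, by omega, by simp⟩⟩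
    · have hvis := hP.hi_le hG.bnd_le h1 h
      rw [hit i h, hbnd i h, hcb i h, hhi _ (hitlt i h1 h)] at *
      rw [hidx' a (hai.2.trans hvis)] at hai
      rcases hG.explored i h1 h a ha hai e he1 he2 with h3 | ⟨h3, h4⟩
      · left
        have h4 : g.headIdx (Function.update m.idx b (m.vis + 1)) a e = g.headIdx m.idx a e := by
          have h5 := hG.bnd_pos h1 h
          unfold Ballots.headIdx at h3 ⊢
          split_ifs with h6
          · rw [if_pos h6] at h3
            refine hidx _ ?_
            simp only [InIcc] at h3; omega
          · rfl
        rwa [h4]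
      · refine Or.inr ⟨h3, ?_⟩
        rcases h4 with ⟨z, h5, h6, h7⟩ | ⟨h5, h6⟩
        · exact Or.inl ⟨z, h5, by omega, by rwa [Function.update_of_ne (by omega)]⟩
        · exact Or.inr ⟨by omega, h6⟩
  · intro i h1 hi
    simp only [PathState.visit] at *
    rw [hit i (by omega)]
    exact hG.sel_cur i h1 (by omega)
  · intro k h1 h2
    simp only [PathState.visit] at *
    rcases hG.logged k h1 h2 with h3 | ⟨i, h3, h4, h5⟩
    · exact Or.inl h3
    · exact Or.inr ⟨i, h3, by omega, by rw [hit i h4, h5]⟩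

end GrowthInv

end LiquidDemocracy

namespace LiquidDemocracy

namespace GrowthInv

variable {g : Ballots} {m : PathState} {w par' : ℕ → ℕ} {l : List (ℕ × ℕ)} {base : ℕ}

lemma contract (hG : GrowthInv g m w l base 0)
    (hS : SelInv g m.idx m.sa m.sp w m.lo m.hi m.t) {k : ℕ} (hk : 1 ≤ k) (hkh : k ≤ m.h)
    (hw : InIcc (m.lo (m.it k), m.hi (m.it k)) (w (m.it m.h)))
    (hpt : ∀ j, 1 ≤ j → m.par j < m.t)
    (hpar₁ : ∀ i, k ≤ i → i ≤ m.h → par' (m.it i) = m.t)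
    (hpar₂ : ∀ j, (∀ i, k ≤ i → i ≤ m.h → j ≠ m.it i) → par' j = m.par j) :
    GrowthInv g (m.contract par' k) w l base 1 := by
  have hP := hG.path
  have hitlt : ∀ i, 1 ≤ i → i ≤ m.h → m.it i < m.t := fun i h1 h2 => (hP.it_pos i h1 h2).2
  have hit : ∀ i, i < k → Function.update m.it k m.t i = m.it i := fun i h =>
    Function.update_of_ne (by omega) _ _
  have hitk : Function.update m.it k m.t k = m.t := Function.update_self ..
  have hlo : ∀ i, i < m.t → Function.update m.lo m.t (m.bnd k) i = m.lo i := fun i h =>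
    Function.update_of_ne (by omega) _ _
  have hhi : ∀ i, i < m.t → Function.update m.hi m.t m.vis i = m.hi i := fun i h =>
    Function.update_of_ne (by omega) _ _
  have hlot : Function.update m.lo m.t (m.bnd k) m.t = m.bnd k := Function.update_self ..
  have hhit : Function.update m.hi m.t m.vis m.t = m.vis := Function.update_self ..
  have hbndk : m.bnd k ≤ m.vis := (hP.bnd_mono hkh le_rfl).trans hG.bnd_le
  have hsub : ∀ i u, k ≤ i → i ≤ m.h → InIcc (m.lo (m.it i), m.hi (m.it i)) u →
      InIcc (m.bnd k, m.vis) u := by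
    intro i u h1 h2 hu
    rw [hP.lo_it i (by omega) h2] at hu
    exact ⟨(hP.bnd_mono h1 h2).trans hu.1, hu.2.trans (hP.hi_le hG.bnd_le (by omega) h2)⟩
  have hlink : ∀ i, k ≤ i → i ≤ m.h → InIcc (m.bnd k, m.vis) (w (m.it i)) := by
    intro i h1 h2
    rcases Nat.lt_or_ge i m.h with h | h
    · exact hsub (i + 1) _ (by omega) (by omega) (hP.link i (by omega) h)
    · obtain rfl : i = m.h := by omega
      exact hsub k _ le_rfl hkh hw
  have hpar0 : ∀ j, (∀ i, k ≤ i → i ≤ m.h → j ≠ m.it i) → m.par j = 0 → par' j = 0 :=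
    fun j h1 h2 => by rw [hpar₂ j h1, h2]
  constructor
  · exact hG.t_pos
  · exact hG.idx
  · exact hG.log.contract hP hG.t_pos hk hkh hG.bnd_le hw hlo hhi hlot hhit hpar₁ hpar₂ hpt
  · refine ⟨?_, ?_, ?_, ?_, ?_, ?_, ?_, ?_, ?_, ?_, ?_⟩ <;> simp only [PathState.contract]
    · exact hP.bnd_zero
    · intro i hi; exact hP.bnd_lt i (by omega)
    · intro i h1 h2
      rw [hit i h2]
      rcases Nat.lt_or_ge (i + 1) k with h | h
      · rw [hit _ h]; exact hP.it_lt i h1 (by omega)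
      · obtain rfl : k = i + 1 := by omega
        rw [hitk]; exact hitlt i h1 (by omega)
    · intro i h1 h2
      rcases Nat.lt_or_ge i k with h | h
      · rw [hit _ h]
        have := hP.it_pos i h1 (by omega)
        omega
      · obtain rfl : k = i := by omega
        rw [hitk]
        have := hG.t_pos
        omega
    · intro i h1 h2
      rcases Nat.lt_or_ge i k with h | h
      · rw [hit _ h, hlo _ (hitlt i h1 (by omega))]
        exact hP.lo_it i h1 (by omega)
      · obtain rfl : k = i := by omega
        rw [hitk, hlot]
    · intro i h1 h2
      rw [hit _ h2, hhi _ (hitlt i h1 (by omega))]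
      exact hP.hi_it i h1 (by omega)
    · intro _; rw [hitk, hhit]
    · intro i h1 h2
      rcases Nat.lt_or_ge i k with h | h
      · rw [hit _ h]
        refine hpar0 _ (fun i' h3 h4 => ?_) (hP.par_it i h1 (by omega))
        exact (hP.it_mono h1 (by omega) h4).ne
      · obtain rfl : k = i := by omega
        rw [hitk]
        refine hpar0 _ (fun i' h3 h4 => (hitlt i' (by omega) h4).ne') ?_
        by_contra hcon
        have := hG.log.par_lt m.t hG.t_pos hcon
        omega
    · intro i h1 h2
      rw [hit _ h2]
      rcases Nat.lt_or_ge (i + 1) k with h | h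
      · rw [hit _ h, hlo _ (hitlt _ (by omega) (by omega)), hhi _ (hitlt _ (by omega) (by omega))]
        exact hP.link i h1 (by omega)
      · obtain rfl : k = i + 1 := by omega
        rw [hitk, hlot, hhit]
        exact hsub (i + 1) _ le_rfl (by omega) (hP.link i h1 (by omega))
    · intro h; omega
    · intro _; exact hP.base_pos (by omega)
  · exact hG.cut.congr_bounds hlo hhi (by simp [PathState.contract])
  · exact hG.cur_le
  · intro _; simpa [PathState.contract] using hk
  · exact hbndk
  · intro i h1 h2; exact hG.cb_le i h1 (by simp only [PathState.contract] at h2; omega)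
  · intro _; exact (hG.cb_mono hk hkh le_rfl).trans (hG.cb_top (by omega))
  · intro i h1 h2; exact hG.cand_mem i h1 (by simp only [PathState.contract] at h2; omega)
  · intro i h1 h2 a ha hai e he1 he2
    simp only [PathState.contract] at *
    rcases Nat.lt_or_ge i k with h | h
    · rw [hit _ h, hhi _ (hitlt i h1 (by omega))] at *
      rcases hG.explored i h1 (by omega) a ha hai e he1 he2 with h3 | ⟨h3, h4 | ⟨h5, h6⟩⟩
      · exact Or.inl h3
      · exact Or.inr ⟨h3, Or.inl h4⟩
      · exact Or.inr ⟨h3, Or.inr ⟨by omega, h6⟩⟩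
    · obtain rfl : k = i := by omega
      rw [hitk, hhit] at *
      obtain ⟨j, h3, h4, h5⟩ := hP.exists_item h1 hkh hai.1 hai.2
      have h5' := h5
      rw [hP.lo_it j (by omega) h4] at h5'
      rcases hG.explored j (by omega) h4 a ha h5' e he1 he2 with h6 | ⟨h6, ⟨z, h7, h8⟩ | ⟨h7, h8⟩⟩
      · rw [← hP.lo_it j (by omega) h4] at h6
        exact Or.inl (hsub j _ h3 h4 h6)
      · exact Or.inr ⟨h6, Or.inl ⟨z, (hG.cb_mono h1 h3 h4).trans h7, h8⟩⟩
      · left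
        -- A current option that was selected for one of the merged sets has become internal to the
        -- union.
        have h9 := (hS.head (m.it j) (hP.it_pos j (by omega) h4).1 (hitlt j (by omega) h4)).1
        rw [hG.sel_cur j (by omega) h7, h8, ← h6] at h9
        rw [← h9]
        exact hlink j h3 h4
  · intro i h1 h2
    simp only [PathState.contract] at *
    rw [hit i (by omega)]
    exact hG.sel_cur i h1 (by omega)
  · intro j h1 h2
    simp only [PathState.contract] at *
    have ht := hG.t_pos
    by_cases hj : ∃ i, k ≤ i ∧ i ≤ m.h ∧ j = m.it i
    · obtain ⟨i, h3, h4, rfl⟩ := hj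
      left; rw [hpar₁ i h3 h4]; omega
    · push Not at hj
      rw [hpar₂ j hj]
      rcases hG.logged j h1 h2 with h3 | ⟨i, h3, h4, h5⟩
      · exact Or.inl h3
      · have h6 : i < k := by
          by_contra hcon
          exact hj i (by omega) h4 h5
        exact Or.inr ⟨i, h3, h6.le, by rw [hit i h6, h5]⟩

lemma finish (hG : GrowthInv g m w l base 0) (hh : 1 ≤ m.h)
    (hw : w (m.it m.h) < base)
    (hpar₁ : ∀ i, 1 ≤ i → i ≤ m.h → par' (m.it i) = m.t)
    (hpar₂ : ∀ j, (∀ i, 1 ≤ i → i ≤ m.h → j ≠ m.it i) → par' j = m.par j) :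
    GrowthInv g (m.finish par') w l (m.vis + 1) 0 := by
  have hP := hG.path
  refine ⟨hG.t_pos, hG.idx, hG.log.finish hP hh hw hpar₁ hpar₂, ?_, hG.cut, hG.cur_le,
    fun h => by omega, ?_, ?_, fun h => ?_, ?_, ?_, ?_, ?_⟩
  · refine ⟨hP.bnd_zero, ?_, ?_, ?_, ?_, ?_, ?_, ?_, ?_, fun _ => rfl, ?_⟩ <;>
      simp only [PathState.finish] <;> intros <;> omega
  · simp only [PathState.finish]; rw [hP.bnd_zero]; omega
  · intro i h1 h2; simp only [PathState.finish] at h2; omega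
  · simp only [PathState.finish] at h; omega
  · intro i h1 h2; simp only [PathState.finish] at h2; omega
  · intro i h1 h2; simp only [PathState.finish] at h2; omega
  · intro i h1 h2; simp only [PathState.finish] at h2; omega
  · intro j h1 h2
    simp only [PathState.finish] at *
    left
    by_cases hj : ∃ i, 1 ≤ i ∧ i ≤ m.h ∧ j = m.it i
    · obtain ⟨i, h3, h4, rfl⟩ := hj
      have ht := hG.t_pos
      rw [hpar₁ i h3 h4]; omega
    · push Not at hj
      rw [hpar₂ j hj]
      rcases hG.logged j h1 h2 with h3 | ⟨i, h3, h4, h5⟩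
      · exact h3
      · exact absurd h5 (hj i h3 h4)

lemma discard (hG : GrowthInv g m w l base 1) (hq : m.cb m.h < m.q) {a : ℕ}
    (ha : a = m.cand (m.q - 1)) (hint : InIcc (m.bnd m.h, m.vis) (g.headIdx m.idx a (m.cur a))) :
    GrowthInv g m.discard w l base 1 := by
  obtain ⟨hh, htop⟩ := hG.top rfl
  have hmem := hG.cand_lt hh (z := m.q - 1) (by omega) (by omega)
  rw [← ha] at hmem
  refine ⟨hG.t_pos, hG.idx, hG.log, hG.path, hG.cut, hG.cur_le, hG.top, hG.bnd_le, hG.cb_le,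
    fun _ => ?_, ?_, ?_, hG.sel_cur, hG.logged⟩
  · simp only [PathState.discard]; omega
  · intro i h1 h2 z h3 h4
    simp only [PathState.discard] at *
    exact hG.cand_mem i h1 h2 z h3 (by omega)
  · intro i h1 h2 b hb hbi e he1 he2
    simp only [PathState.discard] at *
    rcases hG.explored i h1 h2 b hb hbi e he1 he2 with h3 | ⟨h3, ⟨z, h5, h6, h7⟩ | h4⟩
    · exact Or.inl h3
    · rcases Nat.lt_or_ge z (m.q - 1) with hlt | hge
      · exact Or.inr ⟨h3, Or.inl ⟨z, h5, hlt, h7⟩⟩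
      · obtain rfl : z = m.q - 1 := by omega
        rw [← ha] at h7
        subst h7
        left
        rcases Nat.lt_or_ge i m.h with hlt | hge
        · have := hG.hi_lt_bnd h1 hlt le_rfl
          have h8 := hmem.2
          simp only [InIcc] at h8 hbi
          omega
        · obtain rfl : i = m.h := by omega
          rw [hG.path.hi_top hh, h3]
          exact hint
    · exact Or.inr ⟨h3, Or.inr h4⟩

/-- If no edge is left to be explored, all edges up to the current positions stay in the last set
of the path. -/
lemma internal (hG : GrowthInv g m w l base 1) (hq : m.q = m.cb m.h) {a e : ℕ} (ha : a < g.n)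
    (hai : m.bnd m.h ≤ m.idx a) (he1 : g.off a ≤ e) (he2 : e ≤ m.cur a) :
    InIcc (m.bnd m.h, m.vis) (g.headIdx m.idx a e) := by
  obtain ⟨hh, htop⟩ := hG.top rfl
  have hhi := hG.path.hi_top hh
  have := hG.explored m.h hh le_rfl a ha (by rw [hhi]; exact ⟨hai, hG.idx.le a⟩) e he1 he2
  rw [hhi] at this
  rcases this with h3 | ⟨h3, ⟨z, h5, h6, h7⟩ | h4⟩
  · exact h3
  · omega
  · omega

/-- A direct vote leads to the root and leaves every set. So an agent whose current option stays
inside has a further option to advance to. -/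
lemma cur_lt (hG : GrowthInv g m w l base 1) (hq : m.q = m.cb m.h) {a : ℕ} (ha : a < g.n)
    (hai : m.bnd m.h ≤ m.idx a) : m.cur a < g.off (a + 1) := by
  obtain ⟨hh, htop⟩ := hG.top rfl
  have h1 := hG.cur_le a ha
  have h2 := hG.internal hq ha hai h1.1 le_rfl
  have h3 := hG.bnd_pos hh le_rfl
  unfold Ballots.headIdx at h2
  split_ifs at h2 with h4
  · exact h4
  · simp only [InIcc] at h2; omega

lemma grow (hG : GrowthInv g m w l base 1) (hS : SelInv g m.idx m.sa m.sp w m.lo m.hi m.t)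
    (hq : m.q = m.cb m.h) {cur' cand' : ℕ → ℕ}
    (hcur : ∀ a, cur' a = m.cur a + if m.bnd m.h ≤ m.idx a then 1 else 0)
    (hcand₁ : ∀ z < m.q, cand' z = m.cand z)
    (hcand₂ : ∀ u, m.bnd m.h ≤ u → u ≤ m.vis → cand' (m.q + (u - m.bnd m.h)) = m.vert u) :
    GrowthInv g (m.grow cur' cand') w ((m.bnd m.h, m.vis) :: l) base 1 := by
  obtain ⟨hh, htop⟩ := hG.top rfl
  have hb := hG.bnd_pos hh le_rfl
  have hbv := hG.bnd_le
  refine ⟨hG.t_pos, hG.idx, hG.log, hG.path, ?_, ?_, hG.top, hG.bnd_le, hG.cb_le, ?_, ?_, ?_, ?_,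
    hG.logged⟩
  · have hC := hG.cut
    change CutInv g m.idx cur' m.sa m.sp w m.lo m.hi m.t (m.t + 1) _
    refine ⟨?_, ?_, ?_, ?_⟩
    · intro S hSl
      rcases List.mem_cons.1 hSl with rfl | hSl
      · refine ⟨m.t, hG.t_pos, by omega, ?_⟩
        rw [← htop, hG.path.lo_it _ hh le_rfl, hG.path.hi_top hh]
      · exact hC.mem S hSl
    · intro a ha
      have h1 := hC.count a ha
      have h2 := hG.cur_le a ha
      have h3 := hG.idx.le a
      rw [List.countP_cons, h1, hcur a]
      simp only [decide_eq_true_eq, InIcc, h3, and_true]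
      split_ifs <;> omega
    · intro a ha e he1 he2
      have h1 := hC.pack a ha e he1 he2
      have h2 := hC.count a ha
      rw [List.countP_cons]
      split_ifs with hc
      · rw [decide_eq_true_eq] at hc
        -- Only options beyond the current position can leave the new cut. For these the old count
        -- is at most `cur a - off a`, which is smaller than `e - off a`, so there is room for one
        -- more cut.
        have h3 : m.cur a < e := by
          by_contra hcon
          exact hc.2 (hG.internal hq ha hc.1.1 he1 (by omega))
        have h4 : (l.countP fun S => decide (InIcc S (m.idx a) ∧
            ¬ InIcc S (g.headIdx m.idx a e))) ≤
            l.countP fun S => decide (InIcc S (m.idx a)) := by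
          refine List.countP_mono_left fun S _ h => ?_
          rw [decide_eq_true_eq] at h ⊢
          exact h.1
        have := hG.cur_le a ha
        omega
      · omega
    · intro j h1 h2
      rw [List.countP_cons]
      exact (hC.tight j h1 h2).trans (by omega)
  · intro a ha
    simp only [PathState.grow]
    have h1 := hG.cur_le a ha
    rw [hcur a]
    split_ifs with h
    · have := hG.cur_lt hq ha h
      omega
    · omega
  · intro _; simp only [PathState.grow]; omega
  · intro i h1 h2 z h3 h4
    simp only [PathState.grow] at *
    rcases Nat.lt_or_ge z m.q with h | h
    · rw [hcand₁ z h]; exact hG.cand_mem i h1 h2 z h3 h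
    · have h5 := hcand₂ (m.bnd m.h + (z - m.q)) (by omega) (by omega)
      rw [show m.q + (m.bnd m.h + (z - m.q) - m.bnd m.h) = z by omega] at h5
      rw [h5, hG.idx.idx_vert _ (by omega) (by omega)]
      have := hG.path.bnd_mono h2 le_rfl
      omega
  · intro i h1 h2 a ha hai e he1 he2
    simp only [PathState.grow] at *
    rcases Nat.lt_or_ge i m.h with h | h
    · have h3 := hG.hi_lt_bnd h1 h le_rfl
      have h4 : cur' a = m.cur a := by
        rw [hcur a, if_neg]; · omega
        · simp only [InIcc] at hai; omega
      rw [h4] at he2 ⊢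
      rcases hG.explored i h1 h2 a ha hai e he1 he2 with h3 | ⟨h3, ⟨z, h5, h6, h7⟩ | h4⟩
      · exact Or.inl h3
      · exact Or.inr ⟨h3, Or.inl ⟨z, h5, by omega, by rwa [hcand₁ z h6]⟩⟩
      · exact Or.inr ⟨h3, Or.inr h4⟩
    · obtain rfl : i = m.h := by omega
      have h4 : cur' a = m.cur a + 1 := by rw [hcur a, if_pos hai.1]
      rw [hG.path.hi_top hh] at *
      rcases Nat.lt_or_ge (m.cur a) e with h5 | h5
      · refine Or.inr ⟨by omega, Or.inl ⟨m.q + (m.idx a - m.bnd m.h), by omega, ?_, ?_⟩⟩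
        · simp only [InIcc] at hai; omega
        · rw [hcand₂ _ hai.1 hai.2]
          refine (hG.idx.vert_idx a ?_).2
          simp only [InIcc] at hai; omega
      · exact Or.inl (hG.internal hq ha hai.1 he1 h5)
  · intro i h1 h2
    simp only [PathState.grow] at *
    rw [hG.sel_cur i h1 h2, hcur, if_neg, add_zero]
    have h3 := hG.hi_lt_bnd h1 (by omega : i < m.h) le_rfl
    have h4 := hG.path.it_mono h1 (by omega : i < m.h) le_rfl
    have h5 := hS.mem (m.it i) (hG.path.it_pos i h1 (by omega)).1 (by omega)
    simp only [InIcc] at h5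
    omega

end GrowthInv

/-! ### The work that remains -/

/-- The number of pairs of an agent and an option that are still to be explored. -/
def Ballots.remaining (g : Ballots) (cur idx : ℕ → ℕ) : ℕ :=
  ∑ a ∈ Finset.range g.n, ((g.off (a + 1) - cur a) + if idx a = 0 then 1 else 0)

lemma Ballots.remaining_visit (g : Ballots) {cur idx : ℕ → ℕ} {b v : ℕ} (hb : b < g.n)
    (hb0 : idx b = 0) (hv : v ≠ 0) :
    g.remaining cur (Function.update idx b v) + 1 = g.remaining cur idx := by
  unfold Ballots.remaining
  rw [← Finset.add_sum_erase _ _ (Finset.mem_range.2 hb),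
    ← Finset.add_sum_erase (a := b) (Finset.range g.n) (fun a => (g.off (a + 1) - cur a) +
      if idx a = 0 then 1 else 0) (Finset.mem_range.2 hb)]
  have : ∑ a ∈ (Finset.range g.n).erase b, ((g.off (a + 1) - cur a) +
      if Function.update idx b v a = 0 then 1 else 0) =
      ∑ a ∈ (Finset.range g.n).erase b, ((g.off (a + 1) - cur a) + if idx a = 0 then 1 else 0) := by
    refine Finset.sum_congr rfl fun a ha => ?_
    rw [Function.update_of_ne (Finset.ne_of_mem_erase ha)]
  rw [this]
  simp [hb0, hv]
  omega

/-- The numbering is a bijection from the indices of the last set to the agents that advance, and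
each advance uses up one option. -/
lemma GrowthInv.remaining_grow {g : Ballots} {m : PathState} {w : ℕ → ℕ} {l : List (ℕ × ℕ)}
    {base : ℕ} (hG : GrowthInv g m w l base 1) (hq : m.q = m.cb m.h) {cur' : ℕ → ℕ}
    (hcur : ∀ a, cur' a = m.cur a + if m.bnd m.h ≤ m.idx a then 1 else 0) :
    g.remaining cur' m.idx + (m.vis + 1 - m.bnd m.h) = g.remaining m.cur m.idx := by
  obtain ⟨hh, htop⟩ := hG.top rfl
  have hb := hG.bnd_pos hh le_rfl
  have h1 : m.vis + 1 - m.bnd m.h =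
      ∑ a ∈ Finset.range g.n, if m.bnd m.h ≤ m.idx a then 1 else 0 := by
    rw [Finset.sum_boole, Nat.cast_id, ← Nat.card_Icc]
    refine Finset.card_bij (fun u _ => m.vert u) ?_ ?_ ?_
    · intro u hu
      rw [Finset.mem_Icc] at hu
      have := hG.idx.idx_vert u (by omega) hu.2
      simp only [Finset.mem_filter, Finset.mem_range]
      exact ⟨(hG.idx.vert_idx (m.vert u) (by omega)).1, by omega⟩
    · intro u hu v hv huv
      rw [Finset.mem_Icc] at hu hv
      rw [← hG.idx.idx_vert u (by omega) hu.2, huv, hG.idx.idx_vert v (by omega) hv.2]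
    · intro a ha
      simp only [Finset.mem_filter, Finset.mem_range] at ha
      exact ⟨m.idx a, Finset.mem_Icc.2 ⟨ha.2, hG.idx.le a⟩, (hG.idx.vert_idx a (by omega)).2⟩
  rw [h1, Ballots.remaining, Ballots.remaining, ← Finset.sum_add_distrib]
  refine Finset.sum_congr rfl fun a ha => ?_
  rw [hcur a]
  by_cases h : m.bnd m.h ≤ m.idx a
  · have := hG.cur_lt hq (Finset.mem_range.1 ha) h
    simp only [h, if_true]
    omega
  · simp only [h, if_false]
    omega

end LiquidDemocracy

/-! ### The path-growing program and its running time -/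

namespace LiquidDemocracy

open WordRAM

namespace Machine

/-- The memory layout of the path-growing algorithm. -/
def toPath (s : State) : PathState where
  vis := s.reg 5
  h := s.reg 6
  t := s.reg 7
  q := s.reg 8
  cur := s.arr 5
  idx := s.arr 6
  vert := s.arr 7
  lo := s.arr 8
  hi := s.arr 9
  par := s.arr 10
  sa := s.arr 11
  sp := s.arr 12
  it := s.arr 13
  bnd := s.arr 14
  cb := s.arr 15
  cand := s.arr 16

/-- Appends the agent in register `10` to the path. -/
def visitProg : Prog := block [
  inc 5, .store 6 (.reg 10) (.reg 5), .store 7 (.reg 5) (.reg 10), inc 6,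
  .store 13 (.reg 6) (.reg 7), .store 14 (.reg 6) (.reg 5), .store 8 (.reg 7) (.reg 5),
  .store 9 (.reg 7) (.reg 5), .store 15 (.reg 6) (.reg 8), .store 16 (.reg 8) (.reg 10), inc 8]

/-- Takes the next agent from the stack of candidates. -/
def popProg : Prog := block [dec 8, .assign 9 (.read 16 (.reg 8))]

/-- Selects the current edge of the agent in register `9`. -/
def selectProg : Prog := block [
  .store 11 (.reg 7) (.reg 9), .store 12 (.reg 7) (.read 5 (.reg 9)), inc 7]

/-- Removes the sets from the path that begin after the index in register `11`. -/
def unwindProg : Prog :=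
  .loop (lt (.reg 11) (.read 14 (.reg 6))) (block [.store 10 (.read 13 (.reg 6)) (.reg 7), dec 6])

/-- Makes the union of the removed sets and of the last remaining set the new last set. -/
def mergeProg : Prog := block [
  .store 10 (.read 13 (.reg 6)) (.reg 7), .store 13 (.reg 6) (.reg 7),
  .store 8 (.reg 7) (.read 14 (.reg 6)), .store 9 (.reg 7) (.reg 5)]

def contractProg : Prog := .seq unwindProg (.ite (.reg 6) mergeProg .skip)

def advanceProg : Prog := block [
  .assign 9 (.read 7 (.reg 12)), .store 5 (.reg 9) (succ (.read 5 (.reg 9))),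
  .store 16 (.reg 8) (.reg 9), inc 8, inc 12]

/-- Advances all agents in the last set of the path. -/
def growProg : Prog :=
  .seq (.assign 12 (.read 14 (.reg 6))) (.loop (lt (.reg 12) (succ (.reg 5))) advanceProg)

def exploreProg : Prog :=
  .ite (lt (.read 5 (.reg 9)) (.read 4 (succ (.reg 9))))
    (.seq (block [.assign 10 (.read 1 (.read 5 (.reg 9))), .assign 11 (.read 6 (.reg 10))])
      (.ite (.reg 11)
        (.ite (lt (.reg 11) (.read 14 (.reg 6))) (.seq selectProg contractProg) .skip)
        (.seq selectProg visitProg)))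
    (.seq (.seq selectProg (.assign 11 (.const 0))) contractProg)

def stepProg : Prog :=
  .ite (eq (.reg 8) (.read 15 (.reg 6))) growProg (.seq popProg exploreProg)

def startProg : Prog :=
  .ite (.read 6 (.reg 13)) .skip (.seq (.assign 10 (.reg 13)) visitProg)

def growthProg : Prog :=
  .seq (inc 7) (.loop (lt (.reg 13) (.reg 0))
    (.seq startProg (.seq (.loop (.reg 6) stepProg) (inc 13))))

variable {n d : ℕ} {B : Profile n d}

/-- The parts of the memory that the path-growing algorithm does not change. -/
structure Frame (B : Profile n d) (r : ℕ) (s : State) : Prop where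
  n_eq : s.reg 0 = n
  r_eq : s.reg 13 = r
  del_eq : s.arr 1 = B.ballots.del
  off_eq : ∀ a ≤ n, s.arr 4 a = B.ballots.off a
  ex_eq : ∀ j, s.arr 17 j = 0

lemma toPath_visit (s : State) : toPath (visitProg.result s) = (toPath s).visit (s.reg 10) := rfl

lemma Frame.visit {r : ℕ} {s : State} (h : Frame B r s) : Frame B r (visitProg.result s) :=
  ⟨h.1, h.2, h.3, h.4, h.5⟩

lemma toPath_pop (s : State) : toPath (popProg.result s) = (toPath s).discard := rfl

lemma reg_pop (s : State) : (popProg.result s).reg 9 = (toPath s).cand ((toPath s).q - 1) := rfl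

lemma Frame.pop {r : ℕ} {s : State} (h : Frame B r s) : Frame B r (popProg.result s) :=
  ⟨h.1, h.2, h.3, h.4, h.5⟩

lemma Frame.select {r : ℕ} {s : State} (h : Frame B r s) : Frame B r (selectProg.result s) :=
  ⟨h.1, h.2, h.3, h.4, h.5⟩

/-- The candidate has already been popped from the stack, whereas `PathState.select` includes the
pop. -/
lemma toPath_select {m : PathState} {s : State} (h : toPath s = m.discard) :
    toPath (selectProg.result s) = m.select (s.reg 9) := by
  have h1 : toPath (selectProg.result s) =
      { toPath s with
        t := (toPath s).t + 1
        sa := Function.update (toPath s).sa (toPath s).t (s.reg 9)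
        sp := Function.update (toPath s).sp (toPath s).t ((toPath s).cur (s.reg 9)) } := rfl
  rw [h1, h]; rfl

lemma toPath_merge {m : PathState} {s : State} {k : ℕ} {par : ℕ → ℕ}
    (h : toPath s = { m with h := k, par := par }) :
    toPath (mergeProg.result s) = m.contract (Function.update par (m.it k) m.t) k := by
  have h1 : toPath (mergeProg.result s) =
      { toPath s with
        par := Function.update (toPath s).par ((toPath s).it (toPath s).h) (toPath s).t
        it := Function.update (toPath s).it (toPath s).h (toPath s).t
        lo := Function.update (toPath s).lo (toPath s).t ((toPath s).bnd (toPath s).h)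
        hi := Function.update (toPath s).hi (toPath s).t (toPath s).vis } := rfl
  rw [h1, h]; rfl

lemma Frame.merge {r : ℕ} {s : State} (h : Frame B r s) : Frame B r (mergeProg.result s) :=
  ⟨h.1, h.2, h.3, h.4, h.5⟩

/-- The sentinel `bnd 0 = 0` stops the loop at the latest when the path is empty. Each removed set
costs 13 steps, the weight of `h` in the potential. -/
lemma halts_unwind {m : PathState} {s : State} {x r c c₀ : ℕ} {Q : State → ℕ → Prop}
    (hF : Frame B r s) (hs : toPath s = m) (hx : s.reg 11 = x) (hb0 : m.bnd 0 = 0)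
    (hc : 13 * m.h + 5 + c₀ ≤ c)
    (hQ : ∀ s' c' k par, Frame B r s' → toPath s' = { m with h := k, par := par } →
      k ≤ m.h → m.bnd k ≤ x → (∀ i, k < i → i ≤ m.h → x < m.bnd i) →
      (∀ i, k < i → i ≤ m.h → par (m.it i) = m.t) →
      (∀ j, (∀ i, k < i → i ≤ m.h → j ≠ m.it i) → par j = m.par j) →
      13 * k + c₀ ≤ c' → Q s' c') :
    Halts unwindProg s c Q := by
  let I : State → ℕ → Prop := fun s' c' => ∃ k par, Frame B r s' ∧
    toPath s' = { m with h := k, par := par } ∧ s'.reg 11 = x ∧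
      k ≤ m.h ∧ (∀ i, k < i → i ≤ m.h → x < m.bnd i) ∧
      (∀ i, k < i → i ≤ m.h → par (m.it i) = m.t) ∧
      (∀ j, (∀ i, k < i → i ≤ m.h → j ≠ m.it i) → par j = m.par j) ∧ 13 * k + 5 + c₀ ≤ c'
  refine Halts.loop I ?_ ⟨m.h, m.par, hF, hs, hx, le_rfl, fun i h1 h2 => by omega,
    fun i h1 h2 => by omega, fun j _ => rfl, hc⟩
  rintro s' c' ⟨k, par, hF', hs', hx', hk, h1, h2, h3, hc'⟩
  have hbnd : s'.arr 14 = m.bnd := congrArg PathState.bnd hs'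
  have hh : s'.reg 6 = k := congrArg PathState.h hs'
  have hit : s'.arr 13 = m.it := congrArg PathState.it hs'
  refine ⟨by simp only [Expr.cost]; omega, fun hb => ?_, fun hb => ?_⟩
  · simp only [Expr.eval, Op.eval, ite_one_zero_ne, hbnd, hh, hx'] at hb
    have hk0 : k ≠ 0 := by rintro rfl; omega
    refine Halts.straight rfl (by simp [block, Prog.ticks, Expr.cost]; omega) ?_
    refine ⟨k - 1, Function.update par (m.it k) m.t,
      ⟨hF'.1, hF'.2, hF'.3, hF'.4, hF'.5⟩, ?_, hx', by omega, ?_, ?_, ?_, ?_⟩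
    · have h4 : toPath ((block [.store 10 (.read 13 (.reg 6)) (.reg 7), dec 6]).result s') =
        { toPath s' with
          h := (toPath s').h - 1
          par := Function.update (toPath s').par ((toPath s').it (toPath s').h)
            (toPath s').t } := rfl
      rw [h4, hs']
    · intro i h4 h5
      rcases Nat.lt_or_ge k i with h6 | h6
      · exact h1 i h6 h5
      · obtain rfl : i = k := by omega
        exact hb
    · intro i h4 h5
      by_cases h6 : m.it i = m.it k
      · rw [h6, Function.update_self]
      · rw [Function.update_of_ne h6]
        refine h2 i ?_ h5
        by_contra h7
        obtain rfl : i = k := by omega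
        exact h6 rfl
    · intro j h4
      rw [Function.update_of_ne (h4 k (by omega) hk)]
      exact h3 j fun i h5 h6 => h4 i (by omega) h6
    · simp only [block, Prog.ticks, Expr.cost]; omega
  · simp only [Expr.eval, Op.eval, ite_one_zero_eq, hbnd, hh, hx'] at hb
    exact hQ s' _ k par hF' hs' hk (by omega) h1 h2 h3 (by simp only [Expr.cost]; omega)

lemma halts_grow {m : PathState} {s : State} {r c c₀ : ℕ} {Q : State → ℕ → Prop}
    (hF : Frame B r s) (hs : toPath s = m) (hI : IdxInv n m.idx m.vert m.vis)
    (hb1 : 1 ≤ m.bnd m.h) (hbv : m.bnd m.h ≤ m.vis)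
    (hc : 26 * (m.vis + 1 - m.bnd m.h) + 9 + c₀ ≤ c)
    (hQ : ∀ s' c' cur cand, Frame B r s' → toPath s' = m.grow cur cand →
      (∀ a, cur a = m.cur a + if m.bnd m.h ≤ m.idx a then 1 else 0) →
      (∀ z < m.q, cand z = m.cand z) →
      (∀ u, m.bnd m.h ≤ u → u ≤ m.vis → cand (m.q + (u - m.bnd m.h)) = m.vert u) →
      c₀ ≤ c' → Q s' c') :
    Halts growProg s c Q := by
  let I : State → ℕ → Prop := fun s' c' => ∃ u cur cand, Frame B r s' ∧
    toPath s' = { m with q := m.q + (u - m.bnd m.h), cur := cur, cand := cand } ∧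
    s'.reg 12 = u ∧ m.bnd m.h ≤ u ∧ u ≤ m.vis + 1 ∧
    (∀ a, cur a = m.cur a + if m.bnd m.h ≤ m.idx a ∧ m.idx a < u then 1 else 0) ∧
    (∀ z < m.q, cand z = m.cand z) ∧
    (∀ v, m.bnd m.h ≤ v → v < u → cand (m.q + (v - m.bnd m.h)) = m.vert v) ∧
    26 * (m.vis + 1 - u) + 6 + c₀ ≤ c'
  refine Halts.seq (Halts.assign (by simp only [Expr.cost]; omega) (Halts.loop I ?_ ?_))
  · rintro s' c' ⟨u, cur, cand, hF', hs', hu, h1, h2, h3, h4, h5, hc'⟩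
    have hvis : s'.reg 5 = m.vis := congrArg PathState.vis hs'
    have hvert : s'.arr 7 = m.vert := congrArg PathState.vert hs'
    refine ⟨by simp only [Expr.cost]; omega, fun hb => ?_, fun hb => ?_⟩
    · simp only [Expr.eval, Op.eval, ite_one_zero_ne, hu, hvis] at hb
      refine Halts.straight rfl (by simp [advanceProg, block, Prog.ticks, Expr.cost]; omega) ?_
      refine ⟨u + 1, Function.update cur (m.vert u) (cur (m.vert u) + 1),
        Function.update cand (m.q + (u - m.bnd m.h)) (m.vert u),
        ⟨hF'.1, hF'.2, hF'.3, hF'.4, hF'.5⟩, ?_, ?_, by omega, by omega, ?_, ?_, ?_, ?_⟩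
      · have h6 : toPath (advanceProg.result s') =
          { toPath s' with
            q := (toPath s').q + 1
            cur := Function.update (toPath s').cur ((toPath s').vert (s'.reg 12))
              ((toPath s').cur ((toPath s').vert (s'.reg 12)) + 1)
            cand := Function.update (toPath s').cand (toPath s').q
              ((toPath s').vert (s'.reg 12)) } := rfl
        rw [h6, hs', hu]
        simp only [PathState.mk.injEq, true_and, and_true]
        omega
      · change s'.reg 12 + 1 = u + 1
        rw [hu]
      · intro a
        have h6 := hI.idx_vert u (by omega) (by omega)
        by_cases ha : a = m.vert u
        · subst ha
          rw [Function.update_self, h3, h6, if_neg (by omega), if_pos (by omega)]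
        · rw [Function.update_of_ne ha, h3]
          have : m.idx a ≠ u := by
            intro h7
            exact ha (by rw [← h7, (hI.vert_idx a (by omega)).2])
          congr 2
          simp only [eq_iff_iff]
          omega
      · intro z hz
        rw [Function.update_of_ne (by omega)]
        exact h4 z hz
      · intro v h6 h7
        rcases Nat.lt_or_ge v u with h8 | h8
        · rw [Function.update_of_ne (by omega)]
          exact h5 v h6 h8
        · obtain rfl : v = u := by omega
          simp
      · simp only [advanceProg, block, Prog.ticks, Expr.cost]; omega
    · simp only [Expr.eval, Op.eval, ite_one_zero_eq, hu, hvis] at hb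
      obtain rfl : u = m.vis + 1 := by omega
      refine hQ s' _ cur cand hF' hs' (fun a => ?_) h4 (fun v h6 h7 => h5 v h6 (by omega))
        (by simp only [Expr.cost]; omega)
      rw [h3]
      have := hI.le a
      congr 2
      simp only [eq_iff_iff]
      omega
  · have hbnd : s.arr 14 = m.bnd := congrArg PathState.bnd hs
    have hh : s.reg 6 = m.h := congrArg PathState.h hs
    refine ⟨m.bnd m.h, m.cur, m.cand, ⟨hF.1, hF.2, hF.3, hF.4, hF.5⟩, ?_, ?_, le_rfl, by omega,
      fun a => ?_, fun _ _ => rfl, fun v h1 h2 => by omega, ?_⟩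
    · change toPath s = _
      rw [hs, Nat.sub_self, Nat.add_zero]
    · change s.arr 14 (s.reg 6) = _
      rw [hbnd, hh]
    · rw [if_neg (by omega), add_zero]
    · simp only [Expr.cost]; omega

end Machine

end LiquidDemocracy

namespace LiquidDemocracy

open WordRAM

namespace Machine

variable {n d : ℕ} {B : Profile n d}

/-- The state of the path-growing algorithm between two steps; the first `k` agents have been
visited. -/
structure Valid (B : Profile n d) (k M : ℕ) (m : PathState) : Prop where
  visited : ∀ a < k, m.idx a ≠ 0
  inv : ∃ w l base p, GrowthInv B.ballots m w l base p ∧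
    SelInv B.ballots m.idx m.sa m.sp w m.lo m.hi m.t ∧ (p = 1 ∨ p = 0 ∧ m.h = 0)
  -- A selection turns a candidate into an increase of `t`, and a candidate comes from a visit or an
  -- advance. Hence the number of sets is linear in `m`, which bounds the time for the expansion.
  bound : m.t + m.q + B.ballots.remaining m.cur m.idx ≤ M

/-- The credits that pay for the remaining steps of the path-growing algorithm. -/
def potential (B : Profile n d) (m : PathState) : ℕ :=
  -- One remaining unit pays for the candidate it creates and, at a visit, for the new path set,
  -- besides the work itself; a candidate pays for being popped and explored.
  200 * B.ballots.remaining m.cur m.idx + 100 * m.q + 13 * m.h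

lemma halts_contract {m : PathState} {s : State} {x r k M c c₀ : ℕ} {w : ℕ → ℕ}
    {l : List (ℕ × ℕ)} {base : ℕ}
    (hF : Frame B r s) (hs : toPath s = m) (hx : s.reg 11 = x)
    (hG : GrowthInv B.ballots m w l base 0)
    (hS : SelInv B.ballots m.idx m.sa m.sp w m.lo m.hi m.t) (hh : 1 ≤ m.h)
    (hw : w (m.it m.h) = x) (hxv : x ≤ m.vis) (hpt : ∀ j, 1 ≤ j → m.par j < m.t)
    (hvis : ∀ a < k, m.idx a ≠ 0)
    (hM : m.t + m.q + B.ballots.remaining m.cur m.idx ≤ M)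
    (hc : potential B m + 21 + c₀ ≤ c) :
    Halts contractProg s c fun s' c' =>
      Frame B r s' ∧ Valid B k M (toPath s') ∧ potential B (toPath s') + c₀ ≤ c' := by
  have hP := hG.path
  refine Halts.seq (halts_unwind
    (c₀ := 200 * B.ballots.remaining m.cur m.idx + 100 * m.q + 16 + c₀) hF hs hx hP.bnd_zero
    (by unfold potential at hc; omega) ?_)
  intro s' c' i par hF' hs' hi h1 h2 h3 h4 hc'
  have hsh : s'.reg 6 = i := congrArg PathState.h hs'
  -- If a path set survives the unwinding, the head lies in the last survivor and closes a cycle.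
  -- Otherwise the head is below `base`, and the whole path becomes connected to the root.
  refine Halts.ite (by simp only [Expr.cost]; omega) (fun hb => ?_) (fun hb => ?_)
  · simp only [Expr.eval, hsh] at hb
    have hk1 : 1 ≤ i := by omega
    refine Halts.straight rfl
      (by simp only [mergeProg, block, Prog.ticks, Expr.cost]; omega) ?_
    rw [toPath_merge hs']
    refine ⟨hF'.merge, ⟨hvis, ⟨w, l, base, 1, ?_, ?_, Or.inl rfl⟩, ?_⟩, ?_⟩
    · refine hG.contract hS hk1 hi ?_ hpt ?_ ?_
      · rw [hw, hP.lo_it i hk1 hi]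
        refine ⟨h1, ?_⟩
        rcases Nat.lt_or_ge i m.h with h5 | h5
        · have := hP.hi_it i hk1 h5
          have := h2 (i + 1) (by omega) h5
          simp only; omega
        · obtain rfl : i = m.h := by omega
          rw [hP.hi_top hh]; exact hxv
      · intro j h5 h6
        by_cases h7 : m.it j = m.it i
        · rw [h7, Function.update_self]
        · rw [Function.update_of_ne h7]
          refine h3 j ?_ h6
          by_contra h8
          obtain rfl : i = j := by omega
          exact h7 rfl
      · intro j h5
        rw [Function.update_of_ne (h5 i le_rfl hi)]
        exact h4 j fun i' h6 h7 => h5 i' (by omega) h7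
    · exact hS.congr_bounds (fun k hk => Function.update_of_ne hk.ne _ _)
        (fun k hk => Function.update_of_ne hk.ne _ _)
    · exact hM
    · simp only [mergeProg, block, Prog.ticks, Expr.cost, potential, PathState.contract]
      omega
  · simp only [Expr.eval, hsh] at hb
    subst hb
    have hs'' : toPath s' = m.finish par := hs'
    refine Halts.skip (by simp only [Expr.cost]; omega) ?_
    rw [hs'']
    refine ⟨hF', ⟨hvis, ⟨w, l, m.vis + 1, 0, ?_, hS, Or.inr ⟨rfl, rfl⟩⟩, ?_⟩, ?_⟩
    · refine hG.finish hh ?_ (fun i h5 h6 => h3 i (by omega) h6)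
        fun j h5 => h4 j fun i h6 h7 => h5 i (by omega) h7
      rw [hw, hP.base_pos hh]
      exact h2 1 (by omega) hh
    · exact hM
    · simp only [Expr.cost, potential, PathState.finish]
      omega

lemma potential_visit {m : PathState} {b : ℕ} (hb : b < n) (hb0 : m.idx b = 0) :
    potential B (m.visit b) + 87 = potential B m := by
  have := B.ballots.remaining_visit (cur := m.cur) (v := m.vis + 1) hb hb0 (by omega)
  simp only [potential, PathState.visit]
  omega

lemma halts_explore {m : PathState} {s : State} {r k M c c₀ : ℕ} {w : ℕ → ℕ}
    {l : List (ℕ × ℕ)} {base : ℕ}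
    (hF : Frame B r s) (hs : toPath s = m.discard) (hq : m.cb m.h < m.q)
    (ha : s.reg 9 = m.cand (m.q - 1))
    (hG : GrowthInv B.ballots m w l base 1)
    (hS : SelInv B.ballots m.idx m.sa m.sp w m.lo m.hi m.t)
    (hvis : ∀ a < k, m.idx a ≠ 0)
    (hM : m.t + m.q + B.ballots.remaining m.cur m.idx ≤ M)
    (hc : potential B m + c₀ ≤ c + 20) :
    Halts exploreProg s c fun s' c' =>
      Frame B r s' ∧ Valid B k M (toPath s') ∧ potential B (toPath s') + c₀ ≤ c' := by
  obtain ⟨hh, htop⟩ := hG.top rfl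
  have hmem := hG.cand_lt hh (z := m.q - 1) (by omega) (by omega)
  rw [← ha] at hmem
  generalize haa : s.reg 9 = a at *
  have hcur : s.arr 5 = m.cur := congrArg PathState.cur hs
  have hidx : s.arr 6 = m.idx := congrArg PathState.idx hs
  have hbnd : s.arr 14 = m.bnd := congrArg PathState.bnd hs
  have hsh : s.reg 6 = m.h := congrArg PathState.h hs
  have hoff : s.arr 4 (a + 1) = B.ballots.off (a + 1) := hF.off_eq _ hmem.1
  have hcl := hG.cur_le a hmem.1
  have hbp := hG.bnd_pos hh le_rfl
  have hlot : m.lo m.t = m.bnd m.h := by rw [← htop]; exact hG.path.lo_it _ hh le_rfl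
  have hhit : m.hi m.t = m.vis := by rw [← htop]; exact hG.path.hi_top hh
  have hmem' : InIcc (m.lo m.t, m.hi m.t) (m.idx a) := by rw [hlot, hhit]; exact hmem.2
  have hpot : potential B (m.select a) + 100 = potential B m := by
    simp only [potential, PathState.select]; omega
  have hbound : (m.select a).t + (m.select a).q +
      B.ballots.remaining (m.select a).cur (m.select a).idx ≤ M := by
    simp only [PathState.select]; omega
  have hpt : ∀ j, 1 ≤ j → m.par j < m.t + 1 := by
    intro j hj
    by_cases h : m.par j = 0
    · omega
    · have := hG.log.par_lt j hj h; omega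
  have hpc : 100 ≤ potential B m := by simp only [potential]; omega
  refine Halts.ite (by simp only [Expr.cost]; omega) (fun hb => ?_) (fun hb => ?_)
  · simp only [Expr.eval, Op.eval, ite_one_zero_ne, haa, hcur, hoff] at hb
    refine Halts.seq (Halts.straight rfl
      (by simp only [block, Prog.ticks, Expr.cost]; omega) ?_)
    set s₁ := (block [.assign 10 (.read 1 (.read 5 (.reg 9))),
      .assign 11 (.read 6 (.reg 10))]).result s with hs₁
    set b := B.ballots.del (m.cur a) with hbdef
    have hF₁ : Frame B r s₁ := ⟨hF.1, hF.2, hF.3, hF.4, hF.5⟩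
    have hp₁ : toPath s₁ = m.discard := hs
    have h9 : s₁.reg 9 = a := haa
    have h10 : s₁.reg 10 = b := by
      change s.arr 1 (s.arr 5 (s.reg 9)) = b
      rw [hF.del_eq, hcur, haa]
    have h11 : s₁.reg 11 = m.idx b := by
      change s.arr 6 (s.arr 1 (s.arr 5 (s.reg 9))) = m.idx b
      rw [hF.del_eq, hcur, haa, hidx]
    have hbnd₁ : s₁.arr 14 (s₁.reg 6) = m.bnd m.h := by
      change s.arr 14 (s.reg 6) = _
      rw [hbnd, hsh]
    have hbn : b < n := by
      refine B.ballots.del_lt _ (lt_of_lt_of_le hb ?_)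
      exact B.ballots.off_mono hmem.1
    have hhead : B.ballots.headIdx m.idx a (m.cur a) = m.idx b := by
      rw [Ballots.headIdx, if_pos hb]
    refine Halts.ite (by simp only [block, Prog.ticks, Expr.cost]; omega) (fun hb1 => ?_)
      (fun hb1 => ?_)
    · simp only [Expr.eval, h11] at hb1
      refine Halts.ite (by simp only [block, Prog.ticks, Expr.cost]; omega) (fun hb2 => ?_)
        (fun hb2 => ?_)
      · simp only [Expr.eval, Op.eval, ite_one_zero_ne, h11, hbnd₁] at hb2
        refine Halts.seq (Halts.straight rfl
          (by simp only [selectProg, block, Prog.ticks, Expr.cost]; omega) ?_)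
        have hsel := toPath_select hp₁
        rw [h9] at hsel
        refine halts_contract hF₁.select hsel (show _ = m.idx b from h11)
          (hG.select hq ha (x := m.idx b) (by simp only [InIcc]; omega))
          (hS.select hmem' hcl hhead.symm fun _ => hb1) hh ?_ (hG.idx.le b) hpt hvis hbound ?_
        · change Function.update w m.t (m.idx b) (m.it m.h) = _
          rw [htop, Function.update_self]
        · simp only [selectProg, block, Prog.ticks, Expr.cost]; omega
      · simp only [Expr.eval, Op.eval, ite_one_zero_eq, h11, hbnd₁] at hb2
        refine Halts.skip (by simp only [block, Prog.ticks, Expr.cost]; omega) ?_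
        rw [hp₁]
        refine ⟨hF₁, ⟨hvis, ⟨w, l, base, 1, hG.discard hq ha ?_, hS, Or.inl rfl⟩, ?_⟩, ?_⟩
        · rw [hhead]; exact ⟨by simp only; omega, hG.idx.le b⟩
        · simp only [PathState.discard]; omega
        · have : potential B m.discard + 100 = potential B m := by
            simp only [potential, PathState.discard]; omega
          simp only [block, Prog.ticks, Expr.cost]; omega
    · simp only [Expr.eval, h11] at hb1
      refine Halts.seq (Halts.straight rfl
        (by simp only [selectProg, block, Prog.ticks, Expr.cost]; omega) ?_)
      have hsel := toPath_select hp₁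
      rw [h9] at hsel
      have hpv := potential_visit (B := B) (m := m.select a) hbn hb1
      refine Halts.straight rfl
        (by simp only [selectProg, visitProg, block, Prog.ticks, Expr.cost]; omega) ?_
      have hvisit : toPath (visitProg.result (selectProg.result s₁)) = (m.select a).visit b := by
        rw [toPath_visit, hsel]
        congr 1
      rw [hvisit]
      refine ⟨hF₁.select.visit, ⟨fun a' ha' => ?_,
        ⟨Function.update w m.t (m.vis + 1), l, base, 1, ?_, ?_, Or.inl rfl⟩, ?_⟩, ?_⟩
      · change Function.update m.idx b (m.vis + 1) a' ≠ 0
        rw [Function.update_apply]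
        split_ifs
        · omega
        · exact hvis a' ha'
      · refine (hG.select hq ha (x := m.vis + 1) (by simp only [InIcc]; omega)).visit hbn hb1 ?_
        intro _
        change Function.update w m.t (m.vis + 1) (m.it m.h) = _
        rw [htop, Function.update_self]; rfl
      · have h12 : m.idx a ≠ 0 := by
          have := hmem.2; simp only [InIcc] at this; omega
        have h13 : Function.update m.idx b (m.vis + 1) a = m.idx a := by
          rw [Function.update_of_ne]
          intro h14; rw [h14] at h12; exact h12 hb1
        -- The edge is recorded with the number its head is about to receive, so for `SelInv` the
        -- renumbering has to come before the selection.
        refine (((hS.update_idx (v := m.vis + 1) ?_ hb1).select (a := a) (e := m.cur a)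
          (x := m.vis + 1) (by rwa [h13]) hcl ?_ fun _ => by omega).congr_bounds ?_ ?_)
        · intro j h1 h2; exact (hG.log.bounds j h1 (by omega)).1
        · rw [Ballots.headIdx, if_pos hb, Function.update_self]
        · exact fun k hk => Function.update_of_ne (Nat.ne_of_lt hk) _ _
        · exact fun k hk => Function.update_of_ne (Nat.ne_of_lt hk) _ _
      · have := B.ballots.remaining_visit (cur := m.cur) (v := m.vis + 1) hbn hb1 (by omega)
        simp only [PathState.visit, PathState.select] at *
        omega
      · simp only [selectProg, visitProg, block, Prog.ticks, Expr.cost]; omega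
  · simp only [Expr.eval, Op.eval, ite_one_zero_eq, haa, hcur, hoff] at hb
    refine Halts.seq (Halts.straight rfl
      (by simp only [selectProg, block, Prog.ticks, Expr.cost]; omega) ?_)
    have hsel := toPath_select hs
    rw [haa] at hsel
    refine halts_contract (m := m.select a) ⟨hF.1, hF.2, hF.3, hF.4, hF.5⟩ hsel rfl
      (hG.select hq ha (x := 0) (by simp only [InIcc]; omega))
      (hS.select hmem' hcl ?_ fun h => absurd h hb) hh ?_ (Nat.zero_le _) hpt hvis hbound ?_
    · rw [Ballots.headIdx, if_neg hb]
    · change Function.update w m.t 0 (m.it m.h) = _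
      rw [htop, Function.update_self]; rfl
    · simp only [selectProg, block, Prog.ticks, Expr.cost]; omega

lemma halts_step {s : State} {r k M c c₀ : ℕ} (hF : Frame B r s) (hV : Valid B k M (toPath s))
    (hh : s.reg 6 ≠ 0) (hc : potential B (toPath s) + c₀ ≤ c + 2) :
    Halts stepProg s c fun s' c' =>
      Frame B r s' ∧ Valid B k M (toPath s') ∧ potential B (toPath s') + c₀ ≤ c' := by
  generalize hm : toPath s = m at *
  obtain ⟨hvis, ⟨w, l, base, p, hG, hS, hp⟩, hM⟩ := hV
  have hsh : s.reg 6 = m.h := congrArg PathState.h hm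
  have hsq : s.reg 8 = m.q := congrArg PathState.q hm
  have hcb : s.arr 15 = m.cb := congrArg PathState.cb hm
  obtain rfl : p = 1 := by
    rcases hp with h | h
    · exact h
    · omega
  obtain ⟨h1, htop⟩ := hG.top rfl
  have hq := hG.cb_top h1
  have hbp := hG.bnd_pos h1 le_rfl
  have hbv := hG.bnd_le
  have hgrow : ∀ {cur cand : ℕ → ℕ}, m.q = m.cb m.h →
      (∀ a, cur a = m.cur a + if m.bnd m.h ≤ m.idx a then 1 else 0) →
      potential B (m.grow cur cand) + 100 * (m.vis + 1 - m.bnd m.h) = potential B m := by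
    intro cur cand hqq hcur
    have := hG.remaining_grow hqq hcur
    simp only [potential, PathState.grow]
    omega
  -- Either a candidate is on the stack, or the last set, which is nonempty, can grow and release
  -- 100 credits per agent.
  have hpos : 100 ≤ potential B m := by
    rcases Nat.eq_or_lt_of_le hq with h | h
    · have := hgrow (cand := m.cand) h.symm (fun a => rfl)
      omega
    · simp only [potential]; omega
  refine Halts.ite (by simp only [Expr.cost]; omega) (fun hb => ?_) (fun hb => ?_)
  · simp only [Expr.eval, Op.eval, ite_one_zero_ne, hsq, hcb, hsh] at hb
    have h2 := hgrow (cand := m.cand) hb (fun a => rfl)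
    refine halts_grow (c₀ := potential B m + c₀ - 100 * (m.vis + 1 - m.bnd m.h)) hF hm hG.idx
      hbp hbv (by simp only [Expr.cost]; omega) ?_
    intro s' c' cur cand hF' hs' h3 h4 h5 hc'
    have h6 := hgrow (cand := cand) hb h3
    have h7 := hG.remaining_grow hb h3
    rw [hs']
    refine ⟨hF', ⟨hvis, ⟨w, _, base, 1, hG.grow hS hb h3 h4 h5, hS, Or.inl rfl⟩, ?_⟩, by omega⟩
    simp only [PathState.grow]; omega
  · simp only [Expr.eval, Op.eval, ite_one_zero_eq, hsq, hcb, hsh] at hb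
    refine Halts.seq (Halts.straight rfl
      (by simp only [popProg, block, Prog.ticks, Expr.cost]; omega) ?_)
    refine halts_explore (m := m) hF.pop ?_ (by omega) ?_ hG hS hvis hM ?_
    · rw [toPath_pop, hm]
    · rw [reg_pop, hm]
    · simp only [popProg, block, Prog.ticks, Expr.cost]; omega

end Machine

end LiquidDemocracy

namespace LiquidDemocracy

open WordRAM

lemma Ballots.sum_size (g : Ballots) :
    ∀ k, ∑ a ∈ Finset.range k, (g.off (a + 1) - g.off a) = g.off k := by
  intro k
  induction k with
  | zero => simp [g.off_zero]
  | succ k ih =>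
    have := g.off_le k
    rw [Finset.sum_range_succ, ih]; omega

namespace Machine

variable {n d : ℕ} {B : Profile n d}

lemma Valid.visit {k M : ℕ} {m : PathState} (hV : Valid B k M m) (hh : m.h = 0) (hk : k < n)
    (hk0 : m.idx k = 0) : Valid B (k + 1) M (m.visit k) := by
  obtain ⟨hvis, ⟨w, l, base, p, hG, hS, hp⟩, hM⟩ := hV
  obtain rfl : p = 0 := by
    rcases hp with rfl | h
    · have := hG.top rfl; omega
    · exact h.1
  refine ⟨fun a ha => ?_, ⟨w, l, base, 1, hG.visit hk hk0 fun h => by omega, ?_, Or.inl rfl⟩, ?_⟩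
  · change Function.update m.idx k (m.vis + 1) a ≠ 0
    rw [Function.update_apply]
    split_ifs
    · omega
    · exact hvis a (by omega)
  · refine (hS.update_idx (v := m.vis + 1) (fun j h1 h2 => (hG.log.bounds j h1 h2).1)
      hk0).congr_bounds ?_ ?_
    · exact fun k hk => Function.update_of_ne (Nat.ne_of_lt hk) _ _
    · exact fun k hk => Function.update_of_ne (Nat.ne_of_lt hk) _ _
  · have := B.ballots.remaining_visit (cur := m.cur) (v := m.vis + 1) hk hk0 (by omega)
    simp only [PathState.visit]
    omega

lemma valid_init {s : State} (hs : HasOffsets B s) :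
    Valid B 0 (B.numEdges + 1) (toPath ((inc 7).result s)) ∧
    potential B (toPath ((inc 7).result s)) = 200 * B.numEdges := by
  have harr : ∀ A i, A ≠ 0 → A ≠ 1 → A ≠ 2 → A ≠ 4 → A ≠ 5 → s.arr A i = 0 := by
    intro A i h0 h1 h2 h4 h5
    obtain ⟨A', rfl⟩ : ∃ A', A = A' + 3 := ⟨A - 3, by omega⟩
    rw [hs.arr_eq _ h4 h5]
    rfl
  have hrem : B.ballots.remaining (s.arr 5) (s.arr 6) = B.numEdges := by
    rw [Ballots.remaining, B.numEdges_eq, ← B.ballots.sum_size n]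
    have : B.ballots.n = n := rfl
    rw [this]
    have h1 : ∀ a ∈ Finset.range n, ((B.ballots.off (a + 1) - s.arr 5 a) +
        if s.arr 6 a = 0 then 1 else 0) = (B.ballots.off (a + 1) - B.ballots.off a) + 1 := by
      intro a ha
      rw [hs.cur_eq a (Finset.mem_range.1 ha), harr 6 a (by omega) (by omega) (by omega)
        (by omega) (by omega), if_pos rfl]
    rw [Finset.sum_congr rfl h1, Finset.sum_add_distrib]
    simp
    omega
  generalize hm : toPath ((inc 7).result s) = m
  have hvis : m.vis = 0 := by rw [← hm]; exact hs.reg_eq 5 (by omega)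
  have hh : m.h = 0 := by rw [← hm]; exact hs.reg_eq 6 (by omega)
  have ht : m.t = 1 := by
    rw [← hm]
    change s.reg 7 + 1 = 1
    rw [hs.reg_eq 7 (by omega)]
  have hq : m.q = 0 := by rw [← hm]; exact hs.reg_eq 8 (by omega)
  have hcur : m.cur = s.arr 5 := by rw [← hm]; rfl
  have hidx' : m.idx = s.arr 6 := by rw [← hm]; rfl
  have hidx : ∀ a, m.idx a = 0 := by
    intro a; rw [hidx']; exact harr 6 a (by omega) (by omega) (by omega) (by omega) (by omega)
  have hpar : ∀ a, m.par a = 0 := by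
    intro a; rw [← hm]
    exact harr 10 a (by omega) (by omega) (by omega) (by omega) (by omega)
  have hbnd : ∀ a, m.bnd a = 0 := by
    intro a; rw [← hm]
    exact harr 14 a (by omega) (by omega) (by omega) (by omega) (by omega)
  have hcur' : ∀ a < B.ballots.n, m.cur a = B.ballots.off a := fun a ha => by
    rw [hcur]; exact hs.cur_eq a ha
  have hlog : LogInv m.lo m.hi m.par (fun _ => 0) m.t (m.t + 0) m.vis 1 := by
    refine ⟨?_, fun k _ hk => absurd (hpar k) hk, ?_, ?_, ?_, ?_, fun X hX _ u hu => ?_⟩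
    · intro j h1 h2; omega
    · intro k j u h1 h2 h3; omega
    · intro j h1 h2; exact absurd h2 (by omega)
    · intro k h1 h2; omega
    · intro u h1 h2; omega
    · obtain rfl : u = 0 := by omega
      exact hX
  have hpath : PathInv m.lo m.hi m.par (fun _ => 0) m.it m.bnd m.h (m.t + 0) m.vis 1 := by
    refine ⟨hbnd 0, ?_, ?_, ?_, ?_, ?_, ?_, ?_, ?_, ?_, ?_⟩ <;> intros <;> omega
  have hcut : CutInv B.ballots m.idx m.cur m.sa m.sp (fun _ => 0) m.lo m.hi m.t (m.t + 0) [] := by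
    refine ⟨fun S hS => by simp at hS, fun a ha => ?_, fun a ha e _ _ => by simp, ?_⟩
    · rw [hcur' a ha]; simp
    · intro j h1 h2; omega
  have hIdx : IdxInv B.ballots.n m.idx m.vert m.vis := by
    refine ⟨fun a => ?_, fun a ha => absurd (hidx a) ha, ?_⟩
    · rw [hidx a]; omega
    · intro u h1 h2; omega
  refine ⟨⟨?_, ⟨fun _ => 0, [], 1, 0, ?_, ?_, Or.inr ⟨rfl, hh⟩⟩, ?_⟩, ?_⟩
  · intro a ha; omega
  · refine ⟨ht.ge, hIdx, hlog, hpath, hcut, fun a ha => ?_, ?_, ?_, ?_, ?_, ?_, ?_, ?_, ?_⟩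
    · rw [hcur' a ha]; exact ⟨le_rfl, B.ballots.off_le a⟩
    · intro h; omega
    · rw [hbnd]; omega
    all_goals intros; omega
  · refine ⟨?_, ?_, ?_⟩ <;> intro j h1 h2 <;> omega
  · rw [ht, hq, hcur, hidx', hrem]; omega
  · rw [potential, hh, hq, hcur, hidx', hrem]; omega

lemma halts_growth {s : State} {c c₀ : ℕ} {Q : State → ℕ → Prop} (hs : HasOffsets B s)
    (hc : 250 * B.numEdges + 8 + c₀ ≤ c)
    (hQ : ∀ s' c', Frame B n s' → Valid B n (B.numEdges + 1) (toPath s') → s'.reg 6 = 0 →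
      c₀ ≤ c' → Q s' c') :
    Halts growthProg s c Q := by
  have hn := B.numEdges_eq
  obtain ⟨hV, hpot⟩ := valid_init hs
  let I : State → ℕ → Prop := fun s' c' => ∃ r, Frame B r s' ∧
    Valid B r (B.numEdges + 1) (toPath s') ∧ s'.reg 6 = 0 ∧ r ≤ n ∧
    potential B (toPath s') + 50 * (n - r) + 4 + c₀ ≤ c'
  refine Halts.seq (Halts.straight rfl (by simp only [Prog.ticks, Expr.cost]; omega)
    (Halts.loop I ?_ ?_))
  · rintro s' c' ⟨r, hF, hV, hh, hr, hc'⟩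
    have hr13 := hF.r_eq
    have hr0 := hF.n_eq
    refine ⟨by simp only [Expr.cost]; omega, fun hb => ?_, fun hb => ?_⟩
    · simp only [Expr.eval, Op.eval, ite_one_zero_ne, hr13, hr0] at hb
      have inner : ∀ s'' c'', Frame B r s'' → Valid B (r + 1) (B.numEdges + 1) (toPath s'') →
          potential B (toPath s'') + (50 * (n - (r + 1)) + 10 + c₀) ≤ c'' →
          Halts (.seq (.loop (.reg 6) stepProg) (inc 13)) s'' c'' I := by
        intro s'' c'' hF'' hV'' hc''
        refine Halts.seq (Halts.loop (fun s₁ c₁ => Frame B r s₁ ∧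
          Valid B (r + 1) (B.numEdges + 1) (toPath s₁) ∧
          potential B (toPath s₁) + (50 * (n - (r + 1)) + 10 + c₀) ≤ c₁) ?_ ⟨hF'', hV'', hc''⟩)
        rintro s₁ c₁ ⟨hF₁, hV₁, hc₁⟩
        refine ⟨by simp only [Expr.cost]; omega, fun hb1 => ?_, fun hb1 => ?_⟩
        · exact halts_step hF₁ hV₁ hb1 (by simp only [Expr.cost]; omega)
        · refine Halts.straight rfl (by simp only [Prog.ticks, Expr.cost]; omega) ?_
          refine ⟨r + 1, ⟨hF₁.1, ?_, hF₁.3, hF₁.4, hF₁.5⟩, hV₁, hb1, hb, ?_⟩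
          · change s₁.reg 13 + 1 = r + 1
            rw [hF₁.r_eq]
          · change potential B (toPath s₁) + _ + 4 + c₀ ≤ _
            simp only [Prog.ticks, Expr.cost]; omega
      refine Halts.seq (Halts.ite (by simp only [Expr.cost]; omega) (fun hb1 => ?_)
        (fun hb1 => ?_))
      · simp only [Expr.eval, hr13] at hb1
        refine Halts.skip (by simp only [Expr.cost]; omega) (inner _ _ hF ⟨?_, hV.2, hV.3⟩ ?_)
        · intro a ha
          rcases Nat.lt_or_ge a r with h | h
          · exact hV.1 a h
          · obtain rfl : a = r := by omega
            exact hb1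
        · simp only [Expr.cost]; omega
      · simp only [Expr.eval, hr13] at hb1
        have h1 : (toPath s').idx r = 0 := hb1
        have h2 := hV.visit hh hb h1
        have h3 := potential_visit (B := B) hb h1
        have h4 : toPath ((Prog.seq (.assign 10 (.reg 13)) visitProg).result s') =
            (toPath s').visit r := by
          rw [← hr13]; rfl
        refine Halts.straight rfl
          (by simp only [visitProg, block, Prog.ticks, Expr.cost]; omega) (inner _ _ ?_ ?_ ?_)
        · exact ⟨hF.1, hF.2, hF.3, hF.4, hF.5⟩
        · rw [h4]; exact h2
        · rw [h4]
          simp only [visitProg, block, Prog.ticks, Expr.cost]; omega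
    · simp only [Expr.eval, Op.eval, ite_one_zero_eq, hr13, hr0] at hb
      obtain rfl : r = n := by omega
      exact hQ s' _ hF hV hh (by simp only [Expr.cost]; omega)
  · refine ⟨0, ⟨hs.n_eq, hs.reg_eq 13 (by omega), ?_, hs.off_eq, ?_⟩, hV,
      hs.reg_eq 6 (by omega), by omega, ?_⟩
    · exact hs.arr_eq 1 (by omega) (by omega)
    · intro j
      change s.arr 17 j = 0
      rw [hs.arr_eq 17 (by omega) (by omega)]; rfl
    · simp only [Prog.ticks, Expr.cost]; omega

/-! ### The expansion program and the MinSum bound -/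

/-- The set in register `14` gets the tail of its selected edge as exit. -/
def sourceProg : Prog := block [
  .assign 9 (.read 11 (.reg 14)), .store 17 (.reg 14) (.read 6 (.reg 9)),
  .store 3 (.reg 9) (sub (.read 12 (.reg 14)) (.read 4 (.reg 9)))]

/-- The set in register `14` inherits the exit in register `15`. -/
def inheritProg : Prog := .store 17 (.reg 14) (.reg 15)

def exitProg : Prog :=
  .ite (lt (.reg 15) (.read 8 (.reg 14))) sourceProg
    (.ite (lt (.read 9 (.reg 14)) (.reg 15)) sourceProg inheritProg)

/-- Computes the certificate from the selected edges. -/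
def expandProg : Prog :=
  .seq (.assign 14 (sub (.reg 7) (.const 1))) (.loop (.reg 14)
    (.seq (.assign 15 (.read 17 (.read 10 (.reg 14)))) (.seq exitProg (dec 14))))

lemma halts_exit {s : State} {c : ℕ} {Q : State → ℕ → Prop} (hc : 24 ≤ c)
    (h₁ : ∀ c', c ≤ c' + 24 → InIcc (s.arr 8 (s.reg 14), s.arr 9 (s.reg 14)) (s.reg 15) →
      Q (inheritProg.result s) c')
    (h₂ : ∀ c', c ≤ c' + 24 → ¬ InIcc (s.arr 8 (s.reg 14), s.arr 9 (s.reg 14)) (s.reg 15) →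
      Q (sourceProg.result s) c') : Halts exitProg s c Q := by
  refine Halts.ite (by simp only [Expr.cost]; omega) (fun hb => ?_) (fun hb => ?_)
  · replace hb : s.reg 15 < s.arr 8 (s.reg 14) := ite_one_zero_ne.1 hb
    refine Halts.straight rfl (by simp only [sourceProg, block, Prog.ticks, Expr.cost]; omega)
      (h₂ _ (by simp only [sourceProg, block, Prog.ticks, Expr.cost]; omega) ?_)
    simp only [InIcc]; omega
  · replace hb : ¬ s.reg 15 < s.arr 8 (s.reg 14) := ite_one_zero_eq.1 hb
    refine Halts.ite (by simp only [Expr.cost]; omega) (fun hb1 => ?_) (fun hb1 => ?_)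
    · replace hb1 : s.arr 9 (s.reg 14) < s.reg 15 := ite_one_zero_ne.1 hb1
      refine Halts.straight rfl (by simp only [sourceProg, block, Prog.ticks, Expr.cost]; omega)
        (h₂ _ (by simp only [sourceProg, block, Prog.ticks, Expr.cost]; omega) ?_)
      simp only [InIcc]; omega
    · replace hb1 : ¬ s.arr 9 (s.reg 14) < s.reg 15 := ite_one_zero_eq.1 hb1
      refine Halts.straight rfl (by simp only [inheritProg, Prog.ticks, Expr.cost]; omega)
        (h₁ _ (by simp only [inheritProg, Prog.ticks, Expr.cost]; omega) ?_)
      simp only [InIcc]; omega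

/-- Parents have larger indices than their children, so in a downward pass the exit of the parent is
known when a set is treated. -/
lemma halts_expand {s : State} {c : ℕ} (hF : Frame B n s)
    (hV : Valid B n (B.numEdges + 1) (toPath s)) (hh : s.reg 6 = 0)
    (hc : 36 * B.numEdges + 6 ≤ c) :
    Halts expandProg s c fun s' _ => ∃ c, B.IsOutput s' c ∧ B.IsMinSum c := by
  generalize hm : toPath s = m at *
  obtain ⟨hvis, ⟨w, l, base, p, hG, hS, hp⟩, hM⟩ := hV
  have hmh : m.h = 0 := by rw [← hm]; exact hh
  obtain rfl : p = 0 := by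
    rcases hp with rfl | h
    · have := hG.top rfl; omega
    · exact h.1
  have hL := hG.log
  rw [Nat.add_zero, hG.path.base_zero hmh] at hL
  have hC := hG.cut
  rw [Nat.add_zero] at hC
  have hpar : ∀ j, 1 ≤ j → j < m.t → m.par j ≠ 0 := by
    intro j h1 h2
    rcases hG.logged j h1 h2 with h | ⟨i, h3, h4, _⟩
    · exact h
    · omega
  have hst : s.reg 7 = m.t := by rw [← hm]; rfl
  have hsal : ∀ j, 1 ≤ j → j < m.t → m.sa j < n := by
    intro j h1 h2
    have h3 := hS.mem j h1 h2
    have h4 := hL.bounds j h1 h2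
    exact (hG.idx.vert_idx (m.sa j) (by simp only [InIcc] at h3; omega)).1
  let I : State → ℕ → Prop := fun s' c' => ∃ j, s'.reg 14 = j ∧ j < m.t ∧
    (∀ A, A ≠ 3 → A ≠ 17 → s'.arr A = s.arr A) ∧
    ExitInv m.lo m.hi m.par (fun j => m.idx (m.sa j)) (s'.arr 17) m.t (j + 1) ∧
    (∀ k, j < k → k < m.t → ¬ InIcc (m.lo k, m.hi k) (s'.arr 17 (m.par k)) →
      s'.arr 3 (m.sa k) = m.sp k - B.ballots.off (m.sa k)) ∧ 36 * j + 2 ≤ c'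
  refine Halts.seq (Halts.assign (by simp only [Expr.cost]; omega) (Halts.loop I ?_ ?_))
  · rintro s' c' ⟨j, hj, hjt, harr, hE, hout, hc'⟩
    refine ⟨by simp only [Expr.cost]; omega, fun hb => ?_, fun hb => ?_⟩
    · simp only [Expr.eval, hj] at hb
      have hj1 : 1 ≤ j := by omega
      have hpj := hL.par_lt j hj1 (hpar j hj1 hjt)
      have hpar' : s'.arr 10 = m.par := by rw [harr 10 (by omega) (by omega), ← hm]; rfl
      have hlo' : s'.arr 8 = m.lo := by rw [harr 8 (by omega) (by omega), ← hm]; rfl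
      have hhi' : s'.arr 9 = m.hi := by rw [harr 9 (by omega) (by omega), ← hm]; rfl
      have hsa' : s'.arr 11 = m.sa := by rw [harr 11 (by omega) (by omega), ← hm]; rfl
      have hsp' : s'.arr 12 = m.sp := by rw [harr 12 (by omega) (by omega), ← hm]; rfl
      have hidx' : s'.arr 6 = m.idx := by rw [harr 6 (by omega) (by omega), ← hm]; rfl
      have hoff' : s'.arr 4 (m.sa j) = B.ballots.off (m.sa j) := by
        rw [harr 4 (by omega) (by omega)]; exact hF.off_eq _ (hsal j hj1 hjt).le
      have key : ∀ v, (InIcc (m.lo j, m.hi j) (s'.arr 17 (m.par j)) → v = s'.arr 17 (m.par j)) →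
          (¬ InIcc (m.lo j, m.hi j) (s'.arr 17 (m.par j)) → v = m.idx (m.sa j)) →
          ExitInv m.lo m.hi m.par (fun j => m.idx (m.sa j)) (Function.update (s'.arr 17) j v)
            m.t j ∧ (∀ k, j ≤ k → k < m.t →
              Function.update (s'.arr 17) j v (m.par k) = s'.arr 17 (m.par k)) := by
        intro v hv1 hv2
        have h1 : ∀ k, j ≤ k → k < m.t →
            Function.update (s'.arr 17) j v (m.par k) = s'.arr 17 (m.par k) := by
          intro k h1 h2
          have := hL.par_lt k (by omega) (hpar k (by omega) h2)
          rw [Function.update_of_ne (by omega)]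
        refine ⟨⟨?_, ?_, ?_⟩, h1⟩
        · intro k hk
          rw [Function.update_of_ne (by omega)]
          exact hE.zero k hk
        · intro k h2 h3 h4
          rw [h1 k h2 h3] at h4 ⊢
          by_cases hkj : k = j
          · subst hkj; rw [Function.update_self]; exact hv1 h4
          · rw [Function.update_of_ne hkj]
            exact hE.inherit k (by omega) h3 h4
        · intro k h2 h3 h4
          rw [h1 k h2 h3] at h4
          by_cases hkj : k = j
          · subst hkj; rw [Function.update_self]; exact hv2 h4
          · rw [Function.update_of_ne hkj]
            exact hE.source k (by omega) h3 h4
      refine Halts.seq (Halts.assign (by simp only [Expr.cost]; omega) (Halts.seq ?_))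
      set s₁ := s'.setReg 15 ((Expr.read 17 (.read 10 (.reg 14))).eval s') with hs₁
      have h14 : s₁.reg 14 = j := hj
      have h15 : s₁.reg 15 = s'.arr 17 (m.par j) := by
        change s'.arr 17 (s'.arr 10 (s'.reg 14)) = _
        rw [hj, hpar']
      have h8 : s₁.arr 8 (s₁.reg 14) = m.lo j := by
        change s'.arr 8 (s'.reg 14) = _
        rw [hlo', hj]
      have h9 : s₁.arr 9 (s₁.reg 14) = m.hi j := by
        change s'.arr 9 (s'.reg 14) = _
        rw [hhi', hj]
      refine halts_exit (by simp only [Expr.cost]; omega) ?_ ?_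
      · intro c₂ hc₂ hin
        rw [h8, h9, h15] at hin
        obtain ⟨hE', h1⟩ := key (s'.arr 17 (m.par j)) (fun _ => rfl) (fun h => absurd hin h)
        refine Halts.straight rfl (by
          simp only [Prog.ticks, Expr.cost] at hc₂ ⊢; omega) ?_
        have h17 : ((dec 14).result (inheritProg.result s₁)).arr 17 =
            Function.update (s'.arr 17) j (s'.arr 17 (m.par j)) := by
          rw [← h15, ← h14]; rfl
        have h3 : ((dec 14).result (inheritProg.result s₁)).arr 3 = s'.arr 3 := rfl
        refine ⟨j - 1, ?_, by omega, ?_, ?_, ?_, ?_⟩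
        · change s₁.reg 14 - 1 = j - 1
          rw [h14]
        · intro A hA hA'
          rw [← harr A hA hA']
          change Function.update s'.arr 17 _ A = _
          rw [Function.update_of_ne hA']
        · rw [h17, show j - 1 + 1 = j by omega]; exact hE'
        · intro k hk hkt hns
          rw [h17, h1 k (by omega) hkt] at hns
          rw [h3]
          refine hout k ?_ hkt hns
          by_contra hcon
          obtain rfl : k = j := by omega
          exact hns hin
        · simp only [Prog.ticks, Expr.cost] at hc₂ ⊢; omega
      · intro c₂ hc₂ hnin
        rw [h8, h9, h15] at hnin
        obtain ⟨hE', h1⟩ := key (m.idx (m.sa j)) (fun h => absurd h hnin) (fun _ => rfl)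
        refine Halts.straight rfl (by
          simp only [Prog.ticks, Expr.cost] at hc₂ ⊢; omega) ?_
        have h17 : ((dec 14).result (sourceProg.result s₁)).arr 17 =
            Function.update (s'.arr 17) j (m.idx (m.sa j)) := by
          rw [← hidx', ← hsa', ← h14]; rfl
        have h3 : ((dec 14).result (sourceProg.result s₁)).arr 3 =
            Function.update (s'.arr 3) (m.sa j) (m.sp j - B.ballots.off (m.sa j)) := by
          rw [← hoff', ← hsp', ← hsa', ← h14]; rfl
        refine ⟨j - 1, ?_, by omega, ?_, ?_, ?_, ?_⟩
        · change s₁.reg 14 - 1 = j - 1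
          rw [h14]
        · intro A hA hA'
          rw [← harr A hA hA']
          change Function.update (Function.update s'.arr 17 _) 3 _ A = _
          rw [Function.update_of_ne hA, Function.update_of_ne hA']
        · rw [h17, show j - 1 + 1 = j by omega]; exact hE'
        · intro k hk hkt hns
          rw [h17] at hns
          rw [h3]
          by_cases hkj : k = j
          · subst hkj; rw [Function.update_self]
          -- Sets that keep their edges have different tails, so the position written for the later
          -- set `k` is not overwritten.
          · have h4 : m.sa k ≠ m.sa j := by
              intro h5
              refine ExitInv.source_unique hL hE' hS.mem hj1 le_rfl (by omega : j < k) hkt ?_ hns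
                (by simp only [h5])
              rw [h1 j le_rfl hjt]; exact hnin
            rw [Function.update_of_ne h4]
            rw [h1 k (by omega) hkt] at hns
            exact hout k (by omega) hkt hns
        · simp only [Prog.ticks, Expr.cost] at hc₂ ⊢; omega
    · simp only [Expr.eval, hj] at hb
      subst hb
      obtain ⟨h1, h2⟩ := isMinSum_of_inv B hG.idx hvis hL hpar hS hC hE
        (fun k hk => hout k (by omega))
      exact ⟨_, fun a => (B.certOf_val (h1 a a.is_lt)).symm, h2⟩
  · have ht := hG.t_pos
    refine ⟨m.t - 1, ?_, by omega, fun A _ _ => rfl, ⟨fun k _ => hF.ex_eq k, ?_, ?_⟩, ?_, ?_⟩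
    · change s.reg 7 - 1 = _
      rw [hst]
    · intro k h1 h2; omega
    · intro k h1 h2; omega
    · intro k h1 h2; omega
    · simp only [Expr.cost]; omega

def minSumProg : Prog := .seq offsets (.seq growthProg expandProg)

theorem halts_minSum (B : Profile n d) (hn : 0 < n) :
    Halts minSumProg B.input (400 * B.numEdges) fun s _ => ∃ c, B.IsOutput s c ∧ B.IsMinSum c := by
  have h1 := B.numEdges_eq
  refine Halts.seq (halts_offsets B (c₀ := 286 * B.numEdges + 14) (by omega) ?_)
  intro s c hs hc
  refine Halts.seq (halts_growth hs (c₀ := 36 * B.numEdges + 6) (by omega) ?_)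
  intro s' c' hF hV hh hc'
  exact halts_expand hF hV hh hc'

/-- The number of steps is linear in `m` alone; of the other term only the sign matters. -/
theorem computableInTime_minSum : ComputableInTime (fun B c => B.IsMinSum c)
    (fun n m => (n : ℝ) * Real.log n + m) := by
  refine computableInTime_of_halts (fun n m hn => ?_) minSumProg (by decide) 400
    fun n d B hn => halts_minSum B hn
  have : 0 ≤ (n : ℝ) * Real.log n :=
    mul_nonneg (Nat.cast_nonneg n) (Real.log_natCast_nonneg n)
  linarith

end Machine

end LiquidDemocracy

/-! ### Invariants of the bottleneck search -/

namespace LiquidDemocracy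

/-- The list `l` is stored in the array `nxt` as a linked list with head `h`; the entry `x` is
represented by `x + 1`, and `0` is the end of the list. -/
def Linked (nxt : ℕ → ℕ) : ℕ → List ℕ → Prop
  | h, [] => h = 0
  | h, x :: l => h = x + 1 ∧ Linked nxt (nxt x) l

lemma Linked.update {nxt : ℕ → ℕ} {i v : ℕ} :
    ∀ {h : ℕ} {l : List ℕ}, (∀ x ∈ l, x ≠ i) → Linked nxt h l →
      Linked (Function.update nxt i v) h l
  | _, [], _, h => h
  | _, x :: l, hl, h => by
    refine ⟨h.1, ?_⟩
    rw [Function.update_of_ne (hl x List.mem_cons_self)]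
    exact Linked.update (fun y hy => hl y (List.mem_cons_of_mem _ hy)) h.2

/-- The data of the bottleneck search. The queue of options to be examined consists of the agents
`fq z` with the positions `fe z`, `i ≤ z < tl`. The agents whose votes are settled are
`que 0, …, que (cnt - 1)`, and the first `f` of them have been propagated. -/
structure SearchState where
  i : ℕ
  tl : ℕ
  cnt : ℕ
  f : ℕ
  fe : ℕ → ℕ
  fq : ℕ → ℕ
  dn : ℕ → ℕ
  que : ℕ → ℕ
  head : ℕ → ℕ
  nxt : ℕ → ℕ
  out : ℕ → ℕ

namespace SearchState

/-- The rank of the `z`-th entry of the queue of options. -/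
def pos (g : Ballots) (m : SearchState) (z : ℕ) : ℕ := m.fe z - g.off (m.fq z)

/-- The vote of agent `a` is settled with the option `e`. -/
def settle (g : Ballots) (m : SearchState) (a e : ℕ) : SearchState :=
  { m with
    cnt := m.cnt + 1
    dn := Function.update m.dn a 1
    que := Function.update m.que m.cnt a
    out := Function.update m.out a (e - g.off a) }

def popNode (m : SearchState) (b x : ℕ) : SearchState :=
  { m with head := Function.update m.head b (m.nxt x) }

def nextSettled (m : SearchState) : SearchState := { m with f := m.f + 1 }

def nextOption (m : SearchState) : SearchState := { m with i := m.i + 1 }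

/-- The current option of the agent `a` is a delegation to the unsettled agent `b`. -/
def postpone (m : SearchState) (a b e : ℕ) : SearchState :=
  { m with
    i := m.i + 1
    tl := m.tl + 1
    fe := Function.update m.fe m.tl (e + 1)
    fq := Function.update m.fq m.tl a
    head := Function.update m.head b (m.i + 1)
    nxt := Function.update m.nxt m.i (m.head b) }

end SearchState

/-- The invariant of the bottleneck search. `L b` lists the examined options that delegate to `b`,
`cu a` is the position of `a` in the queue of options, and `K` is a lower bound. -/
structure SearchInv (g : Ballots) (m : SearchState) (L : ℕ → List ℕ) (cu : ℕ → ℕ) (K : ℕ) :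
    Prop where
  i_le : m.i ≤ m.tl
  fifo : ∀ z < m.tl, m.fq z < g.n ∧ g.off (m.fq z) ≤ m.fe z ∧ m.fe z ≤ g.off (m.fq z + 1)
  sorted : ∀ z z', m.i ≤ z → z ≤ z' → z' < m.tl → m.pos g z ≤ m.pos g z'
  -- The ranks in the queue differ by at most one, so the next option of the front agent can be
  -- appended at the end without sorting.
  spread : ∀ z z', m.i ≤ z → z < m.tl → m.i ≤ z' → z' < m.tl → m.pos g z' ≤ m.pos g z + 1
  K_le : ∀ z, m.i ≤ z → z < m.tl → K ≤ m.pos g z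
  wait : ∀ a < g.n, m.dn a = 0 → ∃ z, m.i ≤ z ∧ z < m.tl ∧ m.fq z = a ∧ m.fe z = cu a
  distinct : ∀ z z', m.i ≤ z → z < z' → z' < m.tl → m.fq z ≠ m.fq z'
  -- An option passed over by an unsettled agent delegates to an agent that is unsettled or awaits
  -- propagation, in whose list `a` is registered.
  seen : ∀ a < g.n, m.dn a = 0 → ∀ e, g.off a ≤ e → e < cu a → e < g.off (a + 1) ∧
    (∃ x ∈ L (g.del e), m.fq x = a) ∧
    (m.dn (g.del e) = 0 ∨ ∃ y, m.f ≤ y ∧ y < m.cnt ∧ m.que y = g.del e)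
  nodes : ∀ b, ∀ x ∈ L b, x < m.i ∧ m.pos g x ≤ K ∧ m.fe x < g.off (m.fq x + 1) ∧
    g.del (m.fe x) = b
  linked : ∀ b, Linked m.nxt (m.head b) (L b)
  -- A settled delegation leads to an earlier entry of `que`, which excludes cycles.
  settled : ∀ y < m.cnt, m.que y < g.n ∧ m.dn (m.que y) ≠ 0 ∧ m.out (m.que y) ≤ K ∧
    m.out (m.que y) ≤ g.size (m.que y) ∧ (m.out (m.que y) = g.size (m.que y) ∨
      ∃ y' < y, m.que y' = g.del (g.off (m.que y) + m.out (m.que y)))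
  exists_que : ∀ a < g.n, m.dn a ≠ 0 → ∃ y < m.cnt, m.que y = a
  f_le : m.f ≤ m.cnt
  lower : ∃ X : ℕ → Prop, (∃ a < g.n, X a) ∧
    ∀ a < g.n, ∀ p ≤ g.size a, g.Crosses X a p → K ≤ p

namespace SearchInv

variable {g : Ballots} {m : SearchState} {L : ℕ → List ℕ} {cu : ℕ → ℕ} {K : ℕ}

lemma settle (h : SearchInv g m L cu K) {a e : ℕ} (ha : a < g.n) (ha0 : m.dn a = 0)
    (he1 : g.off a ≤ e) (he2 : e ≤ g.off (a + 1)) (heK : e - g.off a ≤ K)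
    (hhead : e = g.off (a + 1) ∨ ∃ y < m.cnt, m.que y = g.del e) :
    SearchInv g (m.settle g a e) L cu K := by
  have hdn : ∀ b, (m.settle g a e).dn b = 0 → b ≠ a ∧ m.dn b = 0 := by
    intro b hb
    change Function.update m.dn a 1 b = 0 at hb
    by_cases hab : b = a
    · subst hab; simp at hb
    · rw [Function.update_of_ne hab] at hb
      exact ⟨hab, hb⟩
  have hdn' : ∀ b, m.dn b ≠ 0 → (m.settle g a e).dn b ≠ 0 := fun b hb hb' => hb (hdn b hb').2
  have hque : ∀ y, y < m.cnt → (m.settle g a e).que y = m.que y := fun y hy =>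
    Function.update_of_ne (by omega) _ _
  have hquec : (m.settle g a e).que m.cnt = a := Function.update_self ..
  have hout : ∀ b, m.dn b ≠ 0 → (m.settle g a e).out b = m.out b := fun b hb =>
    Function.update_of_ne (by rintro rfl; exact hb ha0) _ _
  have houta : (m.settle g a e).out a = e - g.off a := Function.update_self ..
  have hcnt : (m.settle g a e).cnt = m.cnt + 1 := rfl
  refine ⟨h.i_le, h.fifo, h.sorted, h.spread, h.K_le, ?_, h.distinct, ?_, h.nodes, h.linked, ?_, ?_, ?_,
    h.lower⟩
  · intro b hb hb0
    exact h.wait b hb (hdn b hb0).2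
  · intro b hb hb0 e' h1 h2
    obtain ⟨h3, h4, h5⟩ := h.seen b hb (hdn b hb0).2 e' h1 h2
    refine ⟨h3, h4, ?_⟩
    rw [hcnt]
    by_cases hd : g.del e' = a
    · exact Or.inr ⟨m.cnt, h.f_le, by omega, by rw [hquec, hd]⟩
    · rcases h5 with h5 | ⟨y, h5, h6, h7⟩
      · left
        change Function.update m.dn a 1 _ = 0
        rwa [Function.update_of_ne hd]
      · exact Or.inr ⟨y, h5, by omega, by rw [hque y h6, h7]⟩
  · intro y hy
    rw [hcnt] at hy
    rcases Nat.lt_or_ge y m.cnt with hlt | hge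
    · obtain ⟨h1, h2, h3, h4, h5⟩ := h.settled y hlt
      rw [hque y hlt, hout _ h2]
      refine ⟨h1, hdn' _ h2, h3, h4, h5.imp_right ?_⟩
      rintro ⟨y', h6, h7⟩
      exact ⟨y', h6, by rw [hque y' (by omega), h7]⟩
    · obtain rfl : y = m.cnt := by omega
      rw [hquec, houta]
      refine ⟨ha, fun h0 => (hdn a h0).1 rfl, heK, by unfold Ballots.size; omega, ?_⟩
      rcases hhead with h1 | ⟨y', h1, h2⟩
      · left; rw [h1]; rfl
      · exact Or.inr ⟨y', h1, by rw [hque y' h1, h2]; congr 1; omega⟩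
  · intro b hb hb0
    rw [hcnt]
    by_cases hab : b = a
    · exact ⟨m.cnt, by omega, by rw [hquec, hab]⟩
    · have : m.dn b ≠ 0 := by
        intro h0; apply hb0
        change Function.update m.dn a 1 b = 0
        rwa [Function.update_of_ne hab]
      obtain ⟨y, h1, h2⟩ := h.exists_que b hb this
      exact ⟨y, by omega, by rw [hque y h1, h2]⟩
  · have := h.f_le
    change m.f ≤ m.cnt + 1
    omega

/-- The node belongs to a settled agent, and `seen` needs list nodes only for unsettled ones. -/
lemma popNode (h : SearchInv g m L cu K) {b x : ℕ} {l : List ℕ} (hL : L b = x :: l)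
    (hx : m.dn (m.fq x) ≠ 0) : SearchInv g (m.popNode b x) (Function.update L b l) cu K := by
  refine ⟨h.i_le, h.fifo, h.sorted, h.spread, h.K_le, h.wait, h.distinct, ?_, ?_, ?_, h.settled,
    h.exists_que, h.f_le, h.lower⟩
  · intro a ha ha0 e h1 h2
    obtain ⟨h3, ⟨x', h4, h5⟩, h6⟩ := h.seen a ha ha0 e h1 h2
    refine ⟨h3, ⟨x', ?_, h5⟩, h6⟩
    by_cases hb : g.del e = b
    · rw [hb, Function.update_self]
      rw [hb, hL] at h4
      rcases List.mem_cons.1 h4 with rfl | h4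
      · exact absurd ha0 (by rw [← h5]; exact hx)
      · exact h4
    · rwa [Function.update_of_ne hb]
  · intro b' x' hx'
    by_cases hb : b' = b
    · subst hb
      rw [Function.update_self] at hx'
      exact h.nodes b' x' (by rw [hL]; exact List.mem_cons_of_mem _ hx')
    · rw [Function.update_of_ne hb] at hx'
      exact h.nodes b' x' hx'
  · intro b'
    change Linked m.nxt (Function.update m.head b (m.nxt x) b') _
    by_cases hb : b' = b
    · subst hb
      rw [Function.update_self, Function.update_self]
      have := h.linked b'
      rw [hL] at this
      exact this.2
    · rw [Function.update_of_ne hb, Function.update_of_ne hb]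
      exact h.linked b'

lemma nextSettled (h : SearchInv g m L cu K) (hf : m.f < m.cnt) (hL : L (m.que m.f) = []) :
    SearchInv g m.nextSettled L cu K := by
  refine ⟨h.i_le, h.fifo, h.sorted, h.spread, h.K_le, h.wait, h.distinct, ?_, h.nodes, h.linked, h.settled,
    h.exists_que, hf, h.lower⟩
  intro a ha ha0 e h1 h2
  obtain ⟨h3, h4, h5⟩ := h.seen a ha ha0 e h1 h2
  refine ⟨h3, h4, h5.imp_right ?_⟩
  rintro ⟨y, h6, h7, h8⟩
  refine ⟨y, ?_, h7, h8⟩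
  change m.f + 1 ≤ y
  rcases Nat.eq_or_lt_of_le h6 with h9 | h9
  -- An unsettled agent that had passed over an option leading to this settled agent would still be
  -- in its list, which is empty.
  · obtain ⟨x, h10, _⟩ := h4
    rw [← h8, ← h9, hL] at h10
    simp at h10
  · exact h9

lemma nextOption (h : SearchInv g m L cu K) (hi : m.i < m.tl) (ha : m.dn (m.fq m.i) ≠ 0) :
    SearchInv g m.nextOption L cu K := by
  have hi' : m.nextOption.i = m.i + 1 := rfl
  refine ⟨hi, h.fifo, ?_, ?_, ?_, ?_, ?_, h.seen, ?_, h.linked, h.settled, h.exists_que, h.f_le,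
    h.lower⟩
  · intro z z' h1 h2 h3
    exact h.sorted z z' (by omega) h2 h3
  · intro z z' h1 h2 h3 h4
    exact h.spread z z' (by omega) h2 (by omega) h4
  · intro z h1 h2
    exact h.K_le z (by omega) h2
  · intro a' ha' ha0
    obtain ⟨z, h1, h2, h3, h4⟩ := h.wait a' ha' ha0
    refine ⟨z, ?_, h2, h3, h4⟩
    rw [hi']
    rcases Nat.eq_or_lt_of_le h1 with h5 | h5
    · rw [← h3, ← h5] at ha0; exact absurd ha0 ha
    · exact h5
  · intro z z' h1 h2 h3
    exact h.distinct z z' (by omega) h2 h3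
  · intro b x hx
    obtain ⟨h1, h2⟩ := h.nodes b x hx
    exact ⟨by omega, h2⟩

/-- When all settled votes have been propagated, the rank of the current option of an unsettled
agent is a lower bound. -/
lemma raise (h : SearchInv g m L cu K) (hi : m.i < m.tl) (hf : m.f = m.cnt)
    (ha : m.dn (m.fq m.i) = 0) : SearchInv g m L cu (m.pos g m.i) := by
  have hK := h.K_le m.i le_rfl hi
  refine ⟨h.i_le, h.fifo, h.sorted, h.spread, ?_, h.wait, h.distinct, h.seen, ?_, h.linked, ?_, h.exists_que,
    h.f_le, fun a => m.dn a = 0, ⟨m.fq m.i, (h.fifo m.i hi).1, ha⟩, ?_⟩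
  · intro z h1 h2
    exact h.sorted m.i z le_rfl h1 h2
  · intro b x hx
    obtain ⟨h1, h2, h3⟩ := h.nodes b x hx
    exact ⟨h1, h2.trans hK, h3⟩
  · intro y hy
    obtain ⟨h1, h2, h3, h4⟩ := h.settled y hy
    exact ⟨h1, h2, h3.trans hK, h4⟩
  -- The cut consists of the unsettled agents. An option of lower rank than the front entry has been
  -- passed over; with no propagation pending, it delegates to an unsettled agent and stays in the
  -- cut.
  · rintro a han p hp ⟨ha0, hcr⟩
    by_contra! hlt
    obtain ⟨z, h1, h2, h3, h4⟩ := h.wait a han ha0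
    have h5 := h.sorted m.i z le_rfl h1 h2
    have h6 : g.off a + p < cu a := by
      simp only [SearchState.pos, h3, h4] at h5 hlt
      omega
    obtain ⟨h7, _, h8⟩ := h.seen a han ha0 (g.off a + p) (by omega) h6
    refine hcr ⟨by unfold Ballots.size; omega, ?_⟩
    rcases h8 with h8 | ⟨y, h9, h10, _⟩
    · exact h8
    · omega

lemma cu_eq (h : SearchInv g m L cu K) (hi : m.i < m.tl) (ha : m.dn (m.fq m.i) = 0) :
    cu (m.fq m.i) = m.fe m.i := by
  obtain ⟨z, h1, h2, h3, h4⟩ := h.wait _ (h.fifo m.i hi).1 ha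
  rcases Nat.eq_or_lt_of_le h1 with h5 | h5
  · rw [← h4, ← h5]
  · exact absurd h3.symm (h.distinct _ _ le_rfl h5 h2)

lemma postpone (h : SearchInv g m L cu K) (hi : m.i < m.tl) (hK : K = m.pos g m.i)
    {a b e : ℕ} (ha : m.fq m.i = a) (he : m.fe m.i = e) (hel : e < g.off (a + 1)) (hb : g.del e = b)
    (hb0 : m.dn b = 0) :
    SearchInv g (m.postpone a b e) (Function.update L b (m.i :: L b))
      (Function.update cu a (e + 1)) K := by
  obtain ⟨han, hea, _⟩ := h.fifo m.i hi
  rw [ha] at han hea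
  rw [he] at hea
  have hi' : (m.postpone a b e).i = m.i + 1 := rfl
  have htl : (m.postpone a b e).tl = m.tl + 1 := rfl
  have hfe : ∀ z, z < m.tl → (m.postpone a b e).fe z = m.fe z := fun z hz =>
    Function.update_of_ne (by omega) _ _
  have hfq : ∀ z, z < m.tl → (m.postpone a b e).fq z = m.fq z := fun z hz =>
    Function.update_of_ne (by omega) _ _
  have hfet : (m.postpone a b e).fe m.tl = e + 1 := Function.update_self ..
  have hfqt : (m.postpone a b e).fq m.tl = a := Function.update_self ..
  have hpos : ∀ z, z < m.tl → (m.postpone a b e).pos g z = m.pos g z := fun z hz => by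
    rw [SearchState.pos, SearchState.pos, hfe z hz, hfq z hz]
  have hpost : (m.postpone a b e).pos g m.tl = m.pos g m.i + 1 := by
    rw [SearchState.pos, SearchState.pos, hfet, hfqt, ha, he]; omega
  refine ⟨?_, ?_, ?_, ?_, ?_, ?_, ?_, ?_, ?_, ?_, h.settled, h.exists_que, h.f_le, h.lower⟩
  · rw [hi', htl]; omega
  · intro z hz
    rw [htl] at hz
    rcases Nat.lt_or_ge z m.tl with hlt | hge
    · rw [hfe z hlt, hfq z hlt]; exact h.fifo z hlt
    · obtain rfl : z = m.tl := by omega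
      rw [hfet, hfqt]; exact ⟨han, by omega, hel⟩
  · intro z z' h1 h2 h3
    rw [hi'] at h1
    rw [htl] at h3
    rcases Nat.lt_or_ge z' m.tl with hlt | hge
    · rw [hpos z (by omega), hpos z' hlt]
      exact h.sorted z z' (by omega) h2 hlt
    · obtain rfl : z' = m.tl := by omega
      rcases Nat.eq_or_lt_of_le h2 with rfl | h4
      · exact le_rfl
      · rw [hpost, hpos z h4]
        exact h.spread m.i z le_rfl hi (by omega) h4
  · intro z z' h1 h2 h3 h4
    rw [hi'] at h1 h3
    rw [htl] at h2 h4
    have h5 : ∀ u, m.i + 1 ≤ u → u < m.tl + 1 → m.pos g m.i ≤ (m.postpone a b e).pos g u ∧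
        (m.postpone a b e).pos g u ≤ m.pos g m.i + 1 := by
      intro u hu hut
      rcases Nat.lt_or_ge u m.tl with hlt | hge
      · rw [hpos u hlt]
        exact ⟨h.sorted m.i u le_rfl (by omega) hlt, h.spread m.i u le_rfl hi (by omega) hlt⟩
      · obtain rfl : u = m.tl := by omega
        omega
    have := h5 z h1 h2
    have := h5 z' h3 h4
    omega
  · intro z h1 h2
    rw [hi'] at h1
    rw [htl] at h2
    rcases Nat.lt_or_ge z m.tl with hlt | hge
    · rw [hpos z hlt]; exact h.K_le z (by omega) hlt
    · obtain rfl : z = m.tl := by omega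
      omega
  · intro a' ha' ha0
    by_cases haa : a' = a
    · subst haa
      exact ⟨m.tl, by omega, by omega, hfqt, by rw [hfet, Function.update_self]⟩
    · obtain ⟨z, h1, h2, h3, h4⟩ := h.wait a' ha' ha0
      refine ⟨z, ?_, by omega, by rw [hfq z h2, h3], ?_⟩
      · rcases Nat.eq_or_lt_of_le h1 with h5 | h5
        · rw [← h5, ha] at h3; exact absurd h3.symm haa
        · exact h5
      · rw [hfe z h2, h4, Function.update_of_ne haa]
  · intro z z' h1 h2 h3
    rw [hi'] at h1
    rw [htl] at h3
    rcases Nat.lt_or_ge z' m.tl with hlt | hge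
    · rw [hfq z (by omega), hfq z' hlt]
      exact h.distinct z z' (by omega) h2 hlt
    · obtain rfl : z' = m.tl := by omega
      rw [hfqt, hfq z h2, ← ha]
      exact (h.distinct m.i z le_rfl h1 h2).symm
  · intro a' ha' ha0 e' h1 h2
    have hmem : ∀ c x, x ∈ L c → x ∈ Function.update L b (m.i :: L b) c := by
      intro c x hx
      by_cases hc : c = b
      · subst hc; rw [Function.update_self]; exact List.mem_cons_of_mem _ hx
      · rwa [Function.update_of_ne hc]
    have hold : e' < cu a' → e' < g.off (a' + 1) ∧
        (∃ x ∈ Function.update L b (m.i :: L b) (g.del e'), (m.postpone a b e).fq x = a') ∧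
        (m.dn (g.del e') = 0 ∨ ∃ y, m.f ≤ y ∧ y < m.cnt ∧ m.que y = g.del e') := by
      intro h3
      obtain ⟨h4, ⟨x, h5, h6⟩, h7⟩ := h.seen a' ha' ha0 e' h1 h3
      refine ⟨h4, ⟨x, hmem _ x h5, ?_⟩, h7⟩
      have := (h.nodes _ x h5).1
      rw [hfq x (by omega), h6]
    by_cases haa : a' = a
    · subst haa
      rw [Function.update_self] at h2
      have h3 : e = cu a' := by
        have := h.cu_eq hi (by rw [ha]; exact ha0)
        rw [← ha, this, ← he]
      rcases Nat.lt_or_ge e' e with hlt | hge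
      · exact hold (by omega)
      · obtain rfl : e' = e := by omega
        refine ⟨hel, ⟨m.i, ?_, by rw [hfq m.i hi, ha]⟩, Or.inl (by rw [hb]; exact hb0)⟩
        rw [hb, Function.update_self]; exact List.mem_cons_self
    · rw [Function.update_of_ne haa] at h2
      exact hold h2
  · have hold : ∀ c, ∀ x ∈ L c, x < (m.postpone a b e).i ∧ (m.postpone a b e).pos g x ≤ K ∧
        (m.postpone a b e).fe x < g.off ((m.postpone a b e).fq x + 1) ∧
        g.del ((m.postpone a b e).fe x) = c := by
      intro c x hx
      obtain ⟨h1, h2⟩ := h.nodes c x hx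
      rw [hi', hpos x (by omega), hfe x (by omega), hfq x (by omega)]
      exact ⟨by omega, h2⟩
    intro c x hx
    by_cases hc : c = b
    · subst hc
      rw [Function.update_self] at hx
      rcases List.mem_cons.1 hx with rfl | hx
      · rw [hi', hpos _ hi, hfe _ hi, hfq _ hi, ha, he]
        exact ⟨by omega, hK.ge, hel, hb⟩
      · exact hold c x hx
    · rw [Function.update_of_ne hc] at hx
      exact hold c x hx
  · intro c
    have h1 : ∀ c, ∀ x ∈ L c, x ≠ m.i := fun c x hx => (h.nodes c x hx).1.ne
    change Linked (Function.update m.nxt m.i (m.head b)) (Function.update m.head b (m.i + 1) c) _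
    by_cases hc : c = b
    · subst hc
      rw [Function.update_self, Function.update_self]
      refine ⟨rfl, ?_⟩
      rw [Function.update_self]
      exact (h.linked c).update (h1 c)
    · rw [Function.update_of_ne hc, Function.update_of_ne hc]
      exact (h.linked c).update (h1 c)

end SearchInv

/-- The result of a completed bottleneck search is optimal. -/
theorem isMinMax_of_inv {n d : ℕ} (B : Profile n d) {m : SearchState} {L : ℕ → List ℕ}
    {cu : ℕ → ℕ} {K : ℕ} (h : SearchInv B.ballots m L cu K) (hi : m.tl ≤ m.i) :
    (∀ a < n, m.out a ≤ B.ballots.size a) ∧ B.IsMinMax (B.certOf m.out) := by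
  have hdone : ∀ a < n, ∃ y < m.cnt, m.que y = a := by
    intro a ha
    refine h.exists_que a ha fun h0 => ?_
    obtain ⟨z, h1, h2, _⟩ := h.wait a ha h0
    omega
  have hle : ∀ a < n, m.out a ≤ B.ballots.size a := by
    intro a ha
    obtain ⟨y, hy, rfl⟩ := hdone a ha
    exact (h.settled y hy).2.2.2.1
  obtain ⟨X, hX, hX'⟩ := h.lower
  refine ⟨hle, B.isMinMax_certOf K X hle ?_ ?_ hX hX'⟩
  · intro a ha
    obtain ⟨y, hy, rfl⟩ := hdone a ha
    clear ha
    induction y using Nat.strong_induction_on with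
    | _ y ih =>
      obtain ⟨h1, h2, h3, h4, h5⟩ := h.settled y hy
      rcases Nat.eq_or_lt_of_le h4 with h6 | h6
      · exact .direct _ h6
      · rcases h5 with h5 | ⟨y', h7, h8⟩
        · omega
        · exact .deleg _ h6 (by rw [← h8]; exact ih y' h7 (by omega))
  · intro a ha
    obtain ⟨y, hy, rfl⟩ := hdone a ha
    exact (h.settled y hy).2.2.1

end LiquidDemocracy

/-! ### The bottleneck search program and the MinMax bound -/

namespace LiquidDemocracy

open WordRAM

lemma sum_range_update {α : Type*} (n : ℕ) (F : ℕ → α → ℕ) (u : ℕ → α) {b : ℕ} (hb : b < n)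
    (v : α) : ∑ x ∈ Finset.range n, F x (Function.update u b v x) + F b (u b) =
      ∑ x ∈ Finset.range n, F x (u x) + F b v := by
  have hb' := Finset.mem_range.2 hb
  rw [← Finset.add_sum_erase _ _ hb', ← Finset.add_sum_erase _ (fun x => F x (u x)) hb',
    Function.update_self,
    Finset.sum_congr rfl fun x hx => by rw [Function.update_of_ne (Finset.ne_of_mem_erase hx)]]
  omega

/-- An upper bound for the number of steps that remain. -/
def SearchState.potential (g : Ballots) (m : SearchState) (L : ℕ → List ℕ) (cu : ℕ → ℕ) : ℕ :=
  -- Postponing an agent trades a future option for a list node and releases 70 credits; settling an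
  -- agent sets aside 20 for closing its list.
  140 * (∑ a ∈ Finset.range g.n, (g.off (a + 1) - cu a) + (m.tl - m.i)) +
    70 * ∑ b ∈ Finset.range g.n, (L b).length + 20 * (m.cnt - m.f)

namespace SearchInv

variable {g : Ballots} {m : SearchState} {L : ℕ → List ℕ} {cu : ℕ → ℕ} {K : ℕ}

lemma potential_settle (h : SearchInv g m L cu K) (a e : ℕ) :
    (m.settle g a e).potential g L cu = m.potential g L cu + 20 := by
  have := h.f_le
  simp only [SearchState.potential, SearchState.settle]
  omega

lemma potential_popNode {b x : ℕ} {l : List ℕ} (hL : L b = x :: l) (hb : b < g.n) :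
    (m.popNode b x).potential g (Function.update L b l) cu + 70 = m.potential g L cu := by
  have := sum_range_update g.n (fun _ => List.length) L hb l
  rw [hL, List.length_cons] at this
  simp only [SearchState.potential, SearchState.popNode]
  omega

lemma potential_nextSettled (hf : m.f < m.cnt) :
    m.nextSettled.potential g L cu + 20 = m.potential g L cu := by
  simp only [SearchState.potential, SearchState.nextSettled]
  omega

lemma potential_nextOption (hi : m.i < m.tl) :
    m.nextOption.potential g L cu + 140 = m.potential g L cu := by
  simp only [SearchState.potential, SearchState.nextOption]
  omega

lemma potential_postpone (hi : m.i < m.tl) {a b e : ℕ} (ha : a < g.n) (hb : b < g.n)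
    (he : cu a = e) (hel : e < g.off (a + 1)) :
    (m.postpone a b e).potential g (Function.update L b (m.i :: L b))
      (Function.update cu a (e + 1)) + 70 = m.potential g L cu := by
  have h1 := sum_range_update g.n (fun _ => List.length) L hb (m.i :: L b)
  have h2 := sum_range_update g.n (fun a v => g.off (a + 1) - v) cu ha (e + 1)
  rw [List.length_cons] at h1
  simp only [he] at h2
  simp only [SearchState.potential, SearchState.postpone]
  omega

/-- An examined option that delegates to a settled agent can be settled. -/
lemma settle_node (h : SearchInv g m L cu K) (hf : m.f < m.cnt) {x : ℕ}
    (hx : x ∈ L (m.que m.f)) (h0 : m.dn (m.fq x) = 0) :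
    SearchInv g (m.settle g (m.fq x) (m.fe x)) L cu K := by
  obtain ⟨h1, h2, h3, h4⟩ := h.nodes _ x hx
  obtain ⟨h5, h6, _⟩ := h.fifo x (h1.trans_le h.i_le)
  exact h.settle h5 h0 h6 h3.le h2 (Or.inr ⟨m.f, hf, h4.symm⟩)

lemma settle_option (h : SearchInv g m L cu K) (hi : m.i < m.tl) (hK : K = m.pos g m.i)
    (h0 : m.dn (m.fq m.i) = 0)
    (hh : m.fe m.i = g.off (m.fq m.i + 1) ∨ ∃ y < m.cnt, m.que y = g.del (m.fe m.i)) :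
    SearchInv g (m.settle g (m.fq m.i) (m.fe m.i)).nextOption L cu K := by
  obtain ⟨h1, h2, h3⟩ := h.fifo m.i hi
  refine (h.settle h1 h0 h2 h3 hK.ge hh).nextOption hi ?_
  change Function.update m.dn (m.fq m.i) 1 (m.fq m.i) ≠ 0
  rw [Function.update_self]
  exact one_ne_zero

end SearchInv

namespace Machine

/-- Settles the vote of the agent in register `9` with the option in register `11`. -/
def settleProg : Prog := block [
  .store 7 (.reg 9) (.const 1),
  .store 3 (.reg 9) (sub (.reg 11) (.read 4 (.reg 9))),
  .store 8 (.reg 7) (.reg 9),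
  inc 7]

def popNodeProg : Prog := block [
  dec 12,
  .store 9 (.reg 10) (.read 10 (.reg 12)),
  .assign 9 (.read 6 (.reg 12)),
  .assign 11 (.read 5 (.reg 12))]

def postponeProg : Prog := block [
  .store 10 (.reg 5) (.read 9 (.reg 10)),
  .store 9 (.reg 10) (succ (.reg 5)),
  .store 6 (.reg 6) (.reg 9),
  .store 5 (.reg 6) (succ (.reg 11)),
  inc 6,
  inc 5]

/-- Propagates the settled votes. -/
def propagateProg : Prog :=
  .seq (block [.assign 10 (.read 8 (.reg 8)), .assign 12 (.read 9 (.reg 10))])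
    (.ite (.reg 12) (.seq popNodeProg (.ite (.read 7 (.reg 9)) .skip settleProg)) (inc 8))

/-- Examines the next option. -/
def examineProg : Prog :=
  .seq (block [.assign 9 (.read 6 (.reg 5)), .assign 11 (.read 5 (.reg 5))])
    (.ite (.read 7 (.reg 9)) (inc 5)
      (.ite (lt (.reg 11) (.read 4 (succ (.reg 9))))
        (.seq (.assign 10 (.read 1 (.reg 11)))
          (.ite (.read 7 (.reg 10)) (.seq settleProg (inc 5)) postponeProg))
        (.seq settleProg (inc 5))))

def queueProg : Prog := .loop (lt (.reg 6) (.reg 0)) (block [.store 6 (.reg 6) (.reg 6), inc 6])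

def searchProg : Prog :=
  .loop (lt (.reg 5) (.reg 6)) (.ite (lt (.reg 8) (.reg 7)) propagateProg examineProg)

def minMaxProg : Prog := .seq offsets (.seq queueProg searchProg)

def toSearch (s : State) : SearchState where
  i := s.reg 5
  tl := s.reg 6
  cnt := s.reg 7
  f := s.reg 8
  fe := s.arr 5
  fq := s.arr 6
  dn := s.arr 7
  que := s.arr 8
  head := s.arr 9
  nxt := s.arr 10
  out := s.arr 3

variable {n d : ℕ} {B : Profile n d}

/-- The part of the memory that the search does not change. -/
def SearchFrame (B : Profile n d) (s : State) : Prop :=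
  s.arr 1 = B.ballots.del ∧ ∀ a ≤ n, s.arr 4 a = B.ballots.off a

/-- The invariant of the main loop of the search, with `c` credits. -/
def Searching (B : Profile n d) (s : State) (c : ℕ) : Prop :=
  SearchFrame B s ∧ ∃ L cu K, SearchInv B.ballots (toSearch s) L cu K ∧
    (toSearch s).potential B.ballots L cu + 4 ≤ c

lemma toSearch_settle {s : State} (hF : SearchFrame B s) (h : s.reg 9 < n) :
    toSearch (settleProg.result s) =
      (toSearch s).settle B.ballots (s.reg 9) (s.reg 11) := by
  rw [SearchState.settle, ← hF.2 _ h.le]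
  rfl

lemma halts_propagate {s : State} {c : ℕ} {L : ℕ → List ℕ} {cu : ℕ → ℕ} {K : ℕ}
    (hF : SearchFrame B s) (h : SearchInv B.ballots (toSearch s) L cu K)
    (hf : s.reg 8 < s.reg 7) (hc : (toSearch s).potential B.ballots L cu ≤ c + 4) :
    Halts propagateProg s c (Searching B) := by
  set m := toSearch s with hm
  have hf' : m.f < m.cnt := hf
  have hpot := SearchInv.potential_nextSettled (g := B.ballots) (L := L) (cu := cu) hf'
  have hbn := (h.settled m.f hf').1
  refine Halts.seq (Halts.straight rfl (by simp only [block, Prog.ticks, Expr.cost]; omega) ?_)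
  refine Halts.ite (by simp only [block, Prog.ticks, Expr.cost]; omega) (fun hb => ?_)
    (fun hb => ?_)
  · replace hb : m.head (m.que m.f) ≠ 0 := hb
    have hl := h.linked (m.que m.f)
    match hL : L (m.que m.f) with
    | [] => rw [hL] at hl; exact absurd hl hb
    | x :: l =>
      rw [hL] at hl
      have hx : m.head (m.que m.f) - 1 = x := by have := hl.1; omega
      have hpot' := SearchInv.potential_popNode (m := m) (cu := cu) hL hbn
      refine Halts.seq (Halts.straight rfl (by
        simp only [popNodeProg, block, Prog.ticks, Expr.cost]; omega) ?_)
      set s₁ := popNodeProg.result ((block [.assign 10 (.read 8 (.reg 8)),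
        .assign 12 (.read 9 (.reg 10))]).result s) with hs₁
      have hF₁ : SearchFrame B s₁ := hF
      have hm₁ : toSearch s₁ = m.popNode (m.que m.f) x := by rw [← hx]; rfl
      have h9 : s₁.reg 9 = m.fq x := by rw [← hx]; rfl
      have h11 : s₁.reg 11 = m.fe x := by rw [← hx]; rfl
      have hxL : x ∈ L (m.que m.f) := by rw [hL]; exact List.mem_cons_self
      refine Halts.ite (by
        simp only [popNodeProg, block, Prog.ticks, Expr.cost]; omega) (fun hb => ?_) (fun hb => ?_)
      · replace hb : m.dn (m.fq x) ≠ 0 := by rw [← h9]; exact hb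
        refine Halts.skip (by
          simp only [popNodeProg, block, Prog.ticks, Expr.cost]; omega)
          ⟨hF₁, _, cu, K, hm₁ ▸ h.popNode hL hb, ?_⟩
        rw [hm₁]
        simp only [popNodeProg, block, Prog.ticks, Expr.cost]; omega
      · replace hb : m.dn (m.fq x) = 0 := by rw [← h9]; exact hb
        -- The program unlinks the node before it settles the agent, but the invariant allows
        -- unlinking only for settled agents. The two updates commute, so the invariant is followed
        -- in the other order.
        have hinv := h.settle_node hf' hxL hb
        have hpot'' := SearchInv.potential_popNode
          (m := m.settle B.ballots (m.fq x) (m.fe x)) (cu := cu) hL hbn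
        rw [h.potential_settle] at hpot''
        have hm₂ : toSearch (settleProg.result s₁) =
            (m.settle B.ballots (m.fq x) (m.fe x)).popNode (m.que m.f) x := by
          have := (h.nodes _ x hxL).1
          rw [toSearch_settle hF₁ (by
            rw [h9]; exact (h.fifo x (this.trans_le h.i_le)).1), hm₁, h9, h11]
          rfl
        refine Halts.straight rfl (by
          simp only [settleProg, popNodeProg, block, Prog.ticks, Expr.cost]; omega)
          ⟨hF₁, _, cu, K, hm₂ ▸ hinv.popNode hL ?_, ?_⟩
        · rw [hm₂]
          simp only [settleProg, popNodeProg, block, Prog.ticks, Expr.cost]; omega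
        · change Function.update m.dn (m.fq x) 1 (m.fq x) ≠ 0
          rw [Function.update_self]
          exact one_ne_zero
  · replace hb : m.head (m.que m.f) = 0 := hb
    have hl := h.linked (m.que m.f)
    have hL : L (m.que m.f) = [] := by
      match hL : L (m.que m.f) with
      | [] => rfl
      | x :: l =>
        rw [hL] at hl
        have := hl.1
        omega
    refine Halts.straight rfl (by simp only [block, Prog.ticks, Expr.cost]; omega)
      ⟨hF, L, cu, K, h.nextSettled hf' hL, ?_⟩
    change m.nextSettled.potential B.ballots L cu + 4 ≤ _
    simp only [block, Prog.ticks, Expr.cost]; omega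

lemma halts_examine {s : State} {c : ℕ} {L : ℕ → List ℕ} {cu : ℕ → ℕ} {K : ℕ}
    (hF : SearchFrame B s) (h : SearchInv B.ballots (toSearch s) L cu K)
    (hi : s.reg 5 < s.reg 6) (hf : s.reg 8 = s.reg 7)
    (hc : (toSearch s).potential B.ballots L cu ≤ c + 4) :
    Halts examineProg s c (Searching B) := by
  set m := toSearch s with hm
  have hi' : m.i < m.tl := hi
  have hpot := SearchInv.potential_nextOption (g := B.ballots) (L := L) (cu := cu) hi'
  obtain ⟨han, hae, hea⟩ := h.fifo m.i hi'
  refine Halts.seq (Halts.straight rfl (by simp only [block, Prog.ticks, Expr.cost]; omega) ?_)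
  set s₁ := (block [.assign 9 (.read 6 (.reg 5)), .assign 11 (.read 5 (.reg 5))]).result s with hs₁
  have hF₁ : SearchFrame B s₁ := hF
  have hm₁ : toSearch s₁ = m := rfl
  have h9 : s₁.reg 9 = m.fq m.i := rfl
  have h11 : s₁.reg 11 = m.fe m.i := rfl
  refine Halts.ite (by simp only [block, Prog.ticks, Expr.cost]; omega) (fun hb => ?_)
    (fun ha0 => ?_)
  · replace hb : m.dn (m.fq m.i) ≠ 0 := hb
    refine Halts.straight rfl (by simp only [block, Prog.ticks, Expr.cost]; omega)
      ⟨hF, L, cu, K, h.nextOption hi' hb, ?_⟩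
    change m.nextOption.potential B.ballots L cu + 4 ≤ _
    simp only [block, Prog.ticks, Expr.cost]; omega
  replace ha0 : m.dn (m.fq m.i) = 0 := ha0
  -- No propagation is pending here, so the rank of the front option may become the lower bound `K`,
  -- and settling with this option does not exceed it.
  replace h := h.raise hi' hf ha0
  have hpot' := SearchInv.potential_nextOption (g := B.ballots) (L := L) (cu := cu)
    (m := m.settle B.ballots (m.fq m.i) (m.fe m.i)) hi'
  rw [h.potential_settle] at hpot'
  have hm₂ : ∀ s', SearchFrame B s' → toSearch s' = m → s'.reg 9 = m.fq m.i →
      s'.reg 11 = m.fe m.i → toSearch ((Prog.seq settleProg (inc 5)).result s') =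
        (m.settle B.ballots (m.fq m.i) (m.fe m.i)).nextOption := by
    intro s' h1 h2 h3 h4
    rw [← h4, ← h3, ← h2, ← toSearch_settle h1 (by rw [h3]; exact han)]
    rfl
  have h4 : s₁.arr 4 (m.fq m.i + 1) = B.ballots.off (m.fq m.i + 1) := hF.2 _ han
  refine Halts.ite (by simp only [block, Prog.ticks, Expr.cost]; omega) (fun hb => ?_)
    (fun hb => ?_)
  · replace hb : s₁.reg 11 < s₁.arr 4 (m.fq m.i + 1) := ite_one_zero_ne.1 hb
    rw [h4, h11] at hb
    refine Halts.seq (Halts.assign (by simp only [block, Prog.ticks, Expr.cost]; omega) ?_)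
    set s₂ := s₁.setReg 10 ((Expr.read 1 (.reg 11)).eval s₁) with hs₂
    have h10 : s₂.reg 10 = B.ballots.del (m.fe m.i) := by rw [← hF.1]; rfl
    have hbn : B.ballots.del (m.fe m.i) < n :=
      B.ballots.del_lt _ (hb.trans_le (B.ballots.off_mono han))
    refine Halts.ite (by simp only [block, Prog.ticks, Expr.cost]; omega) (fun hb0 => ?_)
      (fun hb0 => ?_)
    · replace hb0 : m.dn (B.ballots.del (m.fe m.i)) ≠ 0 := by rw [← h10]; exact hb0
      have hm' := hm₂ s₂ hF rfl rfl rfl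
      refine Halts.straight rfl (by
        simp only [settleProg, block, Prog.ticks, Expr.cost]; omega)
        ⟨hF, L, cu, _, hm' ▸ h.settle_option hi' rfl ha0
          (Or.inr (h.exists_que _ hbn hb0)), ?_⟩
      rw [hm']
      simp only [settleProg, block, Prog.ticks, Expr.cost]; omega
    · replace hb0 : m.dn (B.ballots.del (m.fe m.i)) = 0 := by rw [← h10]; exact hb0
      have hpost := SearchInv.potential_postpone (L := L) hi' han hbn (h.cu_eq hi' ha0) hb
      have hm' : toSearch (postponeProg.result s₂) =
          m.postpone (m.fq m.i) (B.ballots.del (m.fe m.i)) (m.fe m.i) := by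
        rw [← h10]; rfl
      refine Halts.straight rfl (by
        simp only [postponeProg, block, Prog.ticks, Expr.cost]; omega)
        ⟨hF, _, _, _, hm' ▸ h.postpone hi' rfl rfl rfl hb rfl hb0, ?_⟩
      rw [hm']
      simp only [postponeProg, block, Prog.ticks, Expr.cost]; omega
  · replace hb : ¬ s₁.reg 11 < s₁.arr 4 (m.fq m.i + 1) := ite_one_zero_eq.1 hb
    rw [h4, h11] at hb
    have hm' := hm₂ s₁ hF rfl rfl rfl
    refine Halts.straight rfl (by
      simp only [settleProg, block, Prog.ticks, Expr.cost]; omega)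
      ⟨hF, L, cu, _, hm' ▸ h.settle_option hi' rfl ha0 (Or.inl (by omega)), ?_⟩
    rw [hm']
    simp only [settleProg, block, Prog.ticks, Expr.cost]; omega

lemma halts_search {s : State} {c : ℕ} (h : Searching B s c) :
    Halts searchProg s c fun s _ => ∃ c, B.IsOutput s c ∧ B.IsMinMax c := by
  refine Halts.loop (Searching B) ?_ h
  rintro s c ⟨hF, L, cu, K, hI, hc⟩
  refine ⟨by simp only [Expr.cost]; omega, fun hb => ?_, fun hb => ?_⟩
  · replace hb : s.reg 5 < s.reg 6 := ite_one_zero_ne.1 hb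
    have := SearchInv.potential_nextOption (g := B.ballots) (L := L) (cu := cu)
      (m := toSearch s) hb
    refine Halts.ite (by simp only [Expr.cost]; omega) (fun hf => ?_) (fun hf => ?_)
    · exact halts_propagate hF hI (ite_one_zero_ne.1 hf) (by simp only [Expr.cost]; omega)
    · replace hf : ¬ s.reg 8 < s.reg 7 := ite_one_zero_eq.1 hf
      have hle : s.reg 8 ≤ s.reg 7 := hI.f_le
      exact halts_examine hF hI hb (by omega) (by simp only [Expr.cost]; omega)
  · replace hb : ¬ s.reg 5 < s.reg 6 := ite_one_zero_eq.1 hb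
    obtain ⟨h1, h2⟩ := isMinMax_of_inv B hI (not_lt.1 hb)
    exact ⟨_, fun a => (B.certOf_val (h1 a a.is_lt)).symm, h2⟩

/-- The queue of options initially holds the first option of each agent. -/
lemma searchInv_init (hn : 0 < n) {m : SearchState} (hi : m.i = 0) (htl : m.tl = n)
    (hcnt : m.cnt = 0) (hf : m.f = 0) (hfq : ∀ a < n, m.fq a = a)
    (hfe : ∀ a < n, m.fe a = B.ballots.off a) (hdn : ∀ a, m.dn a = 0)
    (hhead : ∀ a, m.head a = 0) :
    SearchInv B.ballots m (fun _ => []) B.ballots.off 0 := by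
  have hpos : ∀ z < n, m.pos B.ballots z = 0 := by
    intro z hz
    rw [SearchState.pos, hfq z hz, hfe z hz, Nat.sub_self]
  refine ⟨by omega, ?_, ?_, ?_, fun _ _ _ => Nat.zero_le _, ?_, ?_, ?_, ?_, hhead, ?_, ?_,
    by omega, fun _ => True, ⟨0, hn, trivial⟩, fun _ _ _ _ _ => Nat.zero_le _⟩
  · intro z hz
    rw [htl] at hz
    rw [hfq z hz, hfe z hz]
    exact ⟨hz, le_rfl, B.ballots.off_le z⟩
  · intro z z' _ h1 h2
    rw [htl] at h2
    rw [hpos z (by omega)]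
    exact Nat.zero_le _
  · intro z z' _ _ _ h2
    rw [htl] at h2
    rw [hpos z' h2]
    exact Nat.zero_le _
  · intro a (ha : a < n) _
    exact ⟨a, by omega, by omega, hfq a ha, hfe a ha⟩
  · intro z z' _ h1 h2
    rw [hfq z (by omega), hfq z' (by omega)]
    omega
  · intro a _ _ e h1 h2
    omega
  · intro b x hx
    simp at hx
  · intro y hy
    omega
  · intro a _ h
    exact absurd (hdn a) h

/-- Initially all lists are empty and no vote is settled, so the potential is 140 times the sum of
all delegations and the `n` queue entries, that is, 140 `m`. -/
lemma halts_queue (hn : 0 < n) {s : State} {c : ℕ} (hs : HasOffsets B s)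
    (hc : 160 * B.numEdges + 8 ≤ c) : Halts queueProg s c (Searching B) := by
  have hm := B.numEdges_eq
  let I : State → ℕ → Prop := fun s' c =>
    s'.reg 0 = n ∧ s'.reg 6 ≤ n ∧ s'.reg 5 = 0 ∧ s'.reg 7 = 0 ∧ s'.reg 8 = 0 ∧
    (∀ A, A ≠ 6 → s'.arr A = s.arr A) ∧ (∀ a < s'.reg 6, s'.arr 6 a = a) ∧
    12 * (n - s'.reg 6) + 140 * B.numEdges + 8 ≤ c
  refine Halts.loop I ?_ ?_
  · rintro s' c ⟨h0, h6, h5, h7, h8, harr, hq, hc⟩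
    refine ⟨by simp only [Expr.cost]; omega, fun hb => ?_, fun hb => ?_⟩
    · replace hb : s'.reg 6 < s'.reg 0 := ite_one_zero_ne.1 hb
      refine Halts.straight rfl (by simp only [block, Prog.ticks, Expr.cost]; omega) ?_
      refine ⟨h0, ?_, h5, h7, h8, ?_, ?_, ?_⟩
      · change s'.reg 6 + 1 ≤ n
        omega
      · intro A hA
        rw [← harr A hA]
        change Function.update s'.arr 6 _ A = _
        rw [Function.update_of_ne hA]
      · intro a ha
        replace ha : a < s'.reg 6 + 1 := ha
        change Function.update (s'.arr 6) (s'.reg 6) (s'.reg 6) a = a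
        by_cases hae : a = s'.reg 6
        · rw [hae, Function.update_self]
        · rw [Function.update_of_ne hae]
          exact hq a (by omega)
      · change 12 * (n - (s'.reg 6 + 1)) + _ + _ ≤ _
        simp only [block, Prog.ticks, Expr.cost]; omega
    · replace hb : ¬ s'.reg 6 < s'.reg 0 := ite_one_zero_eq.1 hb
      have h6n : s'.reg 6 = n := by omega
      have harr' : ∀ A, A ≠ 4 → A ≠ 5 → A ≠ 6 → s'.arr A = B.input.arr A := fun A h1 h2 h3 => by
        rw [harr A h3, hs.arr_eq A h1 h2]
      refine ⟨⟨harr' 1 (by omega) (by omega) (by omega), fun a ha => ?_⟩, fun _ => [],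
        B.ballots.off, 0, searchInv_init hn h5 h6n h7 h8 (fun a ha => hq a (by omega)) ?_ ?_ ?_, ?_⟩
      · rw [harr 4 (by omega)]
        exact hs.off_eq a ha
      · intro a ha
        change s'.arr 5 a = _
        rw [harr 5 (by omega)]
        exact hs.cur_eq a ha
      · intro a
        change s'.arr 7 a = 0
        rw [harr' 7 (by omega) (by omega) (by omega)]
        rfl
      · intro a
        change s'.arr 9 a = 0
        rw [harr' 9 (by omega) (by omega) (by omega)]
        rfl
      · have h1 := B.ballots.sum_size n
        change 140 * (∑ a ∈ Finset.range n, (B.ballots.off (a + 1) - B.ballots.off a) +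
          (s'.reg 6 - s'.reg 5)) + 70 * ∑ b ∈ Finset.range n, 0 +
            20 * (s'.reg 7 - s'.reg 8) + 4 ≤ _
        rw [h1, Finset.sum_const_zero]
        simp only [Expr.cost]; omega
  · have h6 := hs.reg_eq 6 (by omega)
    exact ⟨hs.n_eq, by omega, hs.reg_eq 5 (by omega), hs.reg_eq 7 (by omega),
      hs.reg_eq 8 (by omega), fun A _ => rfl, fun a ha => by omega, by rw [h6]; omega⟩

theorem halts_minMax (B : Profile n d) (hn : 0 < n) :
    Halts minMaxProg B.input (200 * B.numEdges) fun s _ => ∃ c, B.IsOutput s c ∧ B.IsMinMax c := by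
  have h1 := B.numEdges_eq
  refine Halts.seq (halts_offsets B (c₀ := 160 * B.numEdges + 8) (by omega) ?_)
  intro s c hs hc
  refine Halts.seq ((halts_queue hn hs hc).mono fun s' c' h => ?_)
  exact halts_search h

theorem computableInTime_minMax : ComputableInTime (fun B c => B.IsMinMax c)
    (fun n m => (n : ℝ) + m) := by
  refine computableInTime_of_halts (fun n m hn => ?_) minMaxProg (by decide) 200
    fun n d B hn => halts_minMax B hn
  have : 0 ≤ (n : ℝ) := Nat.cast_nonneg n
  linarith

end Machine

end LiquidDemocracy

theorem mainTheorem5 :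
    LiquidDemocracy.ComputableInTime (fun B c => B.IsMinSum c)
      (fun n m => (n : ℝ) * Real.log n + m) ∧
    LiquidDemocracy.ComputableInTime (fun B c => B.IsMinMax c)
      (fun n m => (n : ℝ) + m) :=
  ⟨LiquidDemocracy.Machine.computableInTime_minSum,
    LiquidDemocracy.Machine.computableInTime_minMax⟩
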